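/- Let $n\ge 0$, let $z_1,\dots,z_n\in\mathbb C$ be pairwise distinct, let $m_1,\dots,m_n,k\in\mathbb C$ with $\kappa:=k+2\neq 0$, and put $z_{n+1}=\infty$, $m_{n+1}=m_1+\dots+m_n-2$, $U=\mathbb C\setminus\{z_1,\dots,z_n\}$. **Twisted de Rham complex.** $\Omega^p(U)$ is the space of rational differential $p$-forms on $\mathbb C$ regular on $U$ $(p=0,1)$, and $\partial=d+\alpha\wedge\cdot\,:\Omega^0(U)\to\Omega^1(U)$ with $\alpha=-\frac1\kappa\sum_{i=1}^n m_i\frac{dt}{t-z_i}=d\Phi/\Phi$, where $\Phi=\prod_i (t-z_i)^{-m_i/\kappa}$. In $\Omega^\bullet(U)[1]$ the space $\Omega^p(U)$ has degree $p-1$. **Modules.** $\widehat{\mathfrak{sl}_2}=\mathfrak{sl}_2[T,T^{-1}]\oplus\mathbb Cc$ with $c$ central and $[aT^i,bT^j]=[a,b]T^{i+j}+i\,\mathrm{tr}(ab)\,\delta_{i+j,0}\,c$. Put $e_1=e$, $f_1=f$, $h_1=h$, $e_2=fT$, $f_2=eT^{-1}$, $h_2=c-h$. For $j=1,\dots,n+1$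 let $V_j=V(m_j,k-m_j)$ be the Verma module generated by $v_j$ subject to $e_1v_j=e_2v_j=0$, $h_1v_j=m_jv_j$, $h_2v_j=(k-m_j)v_j$. It is $\mathbb Z_{\ge0}^2$-graded: $f_{i_1}\cdots f_{i_p}v_j$ has degree $(p_1,p_2)$, where $p_i$ is the number of indices equal to $i$. Let $V_j^*=\bigoplus_\gamma (V_j)_\gamma^*$ be the contragradient module, with $\langle f_i\phi,x\rangle=\langle\phi,e_ix\rangle$ and $\langle e_i\phi,x\rangle=\langle\phi,f_ix\rangle$. In the component of degree $(p_1,p_2)$ take the Poincaré–Birkhoff–Witt basis of vectors $$\tfrac f{T^{i_1}}\cdots\tfrac f{T^{i_a}}\,\tfrac h{T^{j_1}}\cdots\tfrac h{T^{j_b}}\,\tfrac e{T^{l_1}}\cdots\tfrac e{T^{l_c}}v_j\ \ (p_1>p_2),\qquad \tfrac e{T^{l_1}}\cdots\tfrac e{T^{l_c}}\,\tfrac h{T^{j_1}}\cdots\tfrac h{T^{j_b}}\,\tfrac f{T^{i_1}}\cdots\tfrac f{T^{i_a}}v_j\ \ (p_1<p_2),$$ with $i_1\ge\dots\ge i_a\ge0$,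 $j_1\ge\dots\ge j_b\ge1$, $l_1\ge\dots\ge l_c\ge1$, and in degree $(0,0)$ the basis $v_j$. For a basis vector $w$ let $(w)^*\in V_j^*$ be the corresponding vector of the dual basis. **Chain complex.** $\mathfrak{sl}_2(U)=\mathfrak{sl}_2\otimes\Omega^0(U)$ with the pointwise bracket acts on $W=V_1^*\otimes\cdots\otimes V_{n+1}^*$ by $$(x\otimes u)\cdot(w_1\otimes\cdots\otimes w_{n+1})=\sum_{j=1}^{n} w_1\otimes\cdots\otimes [x\otimes u]^{(z_j)}w_j\otimes\cdots\otimes w_{n+1}+w_1\otimes\cdots\otimes w_n\otimes\pi\big([x\otimes u]^{(\infty)}\big)w_{n+1},$$ where $[\,\cdot\,]^{(z_j)}$ and $[\,\cdot\,]^{(\infty)}$ are the Laurent expansions in the local coordinates $T=t-z_j$ and $T=1/t$, and $\pi$ is the automorphism $c\mapsto c$, $eT^i\mapsto fT^i$, $fT^i\mapsto eT^i$, $hT^i\mapsto -hT^i$. The last two terms of the standard chain complex $C_\bullet(\mathfrak{sl}_2(U);W)$ are $\mathfrak{sl}_2(U)\otimes W\xrightarrow{\ d\ }W\to0$ with $d(g\otimes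 w)=g\cdot w$, placed in degrees $-1$ and $0$. **The maps.** Write $[w]_j=(v_1)^*\otimes\cdots\otimes w\otimes\cdots\otimes(v_{n+1})^*$, with $w\in V_j^*$ at the $j$-th place, and $\mathbf v^*=(v_1)^*\otimes\cdots\otimes(v_{n+1})^*$. Consider the formulas for linear maps $\eta^1:\Omega^1(U)\to W$ and $\eta^0:\Omega^0(U)\to\mathfrak{sl}_2(U)\otimes W$: for $1\le p\le n$ and $a>0$, $$\eta^1\Big(\frac{dt}{(t-z_p)^a}\Big)=-\kappa\Big[\Big(\frac f{T^{a-1}}v_p\Big)^*\Big]_p,\qquad \eta^1(t^{a-1}dt)=\kappa\Big[\Big(\frac e{T^a}v_{n+1}\Big)^*\Big]_{n+1},$$ $$\eta^0\Big(\frac1{(t-z_p)^a}\Big)=\frac f{(t-z_p)^a}\otimes\mathbf v^*-\sum_{l=1}^a\bigg(\frac e{(t-z_p)^l}\otimes\Big[2\sum_{i+j=a-l,\ i\ge j\ge0}\Big(\frac f{T^i}\frac f{T^j}v_p\Big)^*\Big]_p+\frac h{(t-z_p)^l}\otimes\Big[\Big(\frac f{T^{a-l}}v_p\Big)^*\Big]_p\bigg),$$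 and for $a\ge0$, $$\eta^0(t^a)=ft^a\otimes\mathbf v^*-\sum_{l=0}^{a-2}\bigg(et^l\otimes\Big[2\sum_{i+j=a-l,\ i\ge j\ge1}\Big(\frac e{T^i}\frac e{T^j}v_{n+1}\Big)^*\Big]_{n+1}+ht^{l+1}\otimes\Big[\Big(\frac e{T^{a-l-1}}v_{n+1}\Big)^*\Big]_{n+1}\bigg).$$ **Theorem.** There are unique linear maps $\eta^0,\eta^1$ satisfying these formulas, and they define a homomorphism of complexes $\eta:\Omega^\bullet(U)[1]\to C_\bullet(\mathfrak{sl}_2(U);W)$, namely $d\circ\eta^0=\eta^1\circ\partial$. The homomorphism is injective, that is, both $\eta^0$ and $\eta^1$ are injective. -/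

import Mathlib

open scoped TensorProduct nonZeroDivisors

noncomputable section

namespace SlDeRham

/-! ### Rational functions and forms on the punctured line -/

/-- The algebra `Ω⁰(U)` of rational functions of `t` regular on `U = ℂ ∖ {z₁, …, zₙ}`: the
denominator in lowest terms does not vanish at any point of `U`. -/
def Omega0 {n : ℕ} (z : Fin n → ℂ) : Subalgebra ℂ (RatFunc ℂ) where
  carrier := {u | ∀ w : ℂ, (∀ i, w ≠ z i) → u.denom.eval w ≠ 0}
  mul_mem' {u v} hu hv w hw h := by
    have h1 := Polynomial.eval_dvd (x := w) (RatFunc.denom_mul_dvd u v)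
    rw [h, zero_dvd_iff, Polynomial.eval_mul] at h1
    exact mul_ne_zero (hu w hw) (hv w hw) h1
  add_mem' {u v} hu hv w hw h := by
    have h1 := Polynomial.eval_dvd (x := w) (RatFunc.denom_add_dvd u v)
    rw [h, zero_dvd_iff, Polynomial.eval_mul] at h1
    exact mul_ne_zero (hu w hw) (hv w hw) h1
  algebraMap_mem' c w _ h := by
    have h1 : (algebraMap ℂ (RatFunc ℂ) c).denom = 1 := RatFunc.denom_C c
    rw [h1] at h
    simp at h

/-- The derivative `du/dt` of a rational function (quotient rule). -/
def derivFun (u : RatFunc ℂ) : RatFunc ℂ :=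
  algebraMap (Polynomial ℂ) (RatFunc ℂ)
      (Polynomial.derivative u.num * u.denom - u.num * Polynomial.derivative u.denom) /
    algebraMap (Polynomial ℂ) (RatFunc ℂ) (u.denom ^ 2)

theorem quotientRule_aux {a b p q : Polynomial ℂ} (key : a * q = p * b) :
    (Polynomial.derivative a * b - a * Polynomial.derivative b) * q ^ 2 =
      (Polynomial.derivative p * q - p * Polynomial.derivative q) * b ^ 2 := by
  have hder := congrArg Polynomial.derivative key
  rw [Polynomial.derivative_mul, Polynomial.derivative_mul] at hder
  linear_combination (q * b) * hder -
    (Polynomial.derivative q * b + q * Polynomial.derivative b) * key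

theorem derivFun_div (p q : Polynomial ℂ) (hq : q ≠ 0) :
    derivFun (algebraMap _ _ p / algebraMap _ _ q) =
      algebraMap (Polynomial ℂ) (RatFunc ℂ)
        (Polynomial.derivative p * q - p * Polynomial.derivative q) /
      algebraMap (Polynomial ℂ) (RatFunc ℂ) (q ^ 2) := by
  generalize hu : algebraMap (Polynomial ℂ) (RatFunc ℂ) p / algebraMap _ _ q = u
  have hd := RatFunc.denom_ne_zero u
  rw [← RatFunc.num_div_denom u, div_eq_div_iff (RatFunc.algebraMap_ne_zero hq)
    (RatFunc.algebraMap_ne_zero hd), ← map_mul, ← map_mul] at hu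
  rw [derivFun, div_eq_div_iff (RatFunc.algebraMap_ne_zero (pow_ne_zero 2 hd))
    (RatFunc.algebraMap_ne_zero (pow_ne_zero 2 hq)), ← map_mul, ← map_mul,
    quotientRule_aux (RatFunc.algebraMap_injective ℂ hu).symm]

/-- The derivation `d/dt` of the field of rational functions, as a linear map. -/
def ratDeriv : RatFunc ℂ →ₗ[ℂ] RatFunc ℂ where
  toFun := derivFun
  map_add' u v := by
    have hu := RatFunc.denom_ne_zero u
    have hv := RatFunc.denom_ne_zero v
    have hu' := RatFunc.algebraMap_ne_zero (K := ℂ) hu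
    have hv' := RatFunc.algebraMap_ne_zero (K := ℂ) hv
    conv_lhs => rw [← RatFunc.num_div_denom u, ← RatFunc.num_div_denom v,
      div_add_div _ _ hu' hv', ← map_mul, ← map_mul, ← map_mul, ← map_add,
      derivFun_div _ _ (mul_ne_zero hu hv)]
    unfold derivFun
    simp only [map_mul, map_sub, map_add, map_pow, Polynomial.derivative_mul]
    field_simp
    ring
  map_smul' c u := by
    have hu := RatFunc.denom_ne_zero u
    conv_lhs => rw [← RatFunc.num_div_denom u, Algebra.smul_def,
      IsScalarTower.algebraMap_apply ℂ (Polynomial ℂ) (RatFunc ℂ), mul_div_assoc', ← map_mul,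
      derivFun_div _ _ hu]
    unfold derivFun
    rw [RingHom.id_apply, Algebra.smul_def,
      IsScalarTower.algebraMap_apply ℂ (Polynomial ℂ) (RatFunc ℂ), mul_div_assoc', ← map_mul]
    congr 2
    simp [Polynomial.derivative_mul]
    ring

theorem deriv_mem {n : ℕ} (z : Fin n → ℂ) {u : RatFunc ℂ} (hu : u ∈ Omega0 z) :
    ratDeriv u ∈ Omega0 z := by
  intro w hw h
  have h1 := Polynomial.eval_dvd (x := w) (RatFunc.denom_div_dvd
    (Polynomial.derivative u.num * u.denom - u.num * Polynomial.derivative u.denom) (u.denom ^ 2))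
  rw [show RatFunc.denom (_ / _) = (ratDeriv u).denom from rfl, h, zero_dvd_iff, Polynomial.eval_pow] at h1
  exact pow_ne_zero 2 (hu w hw) h1

/-- The space `Ω¹(U)` of rational differential 1-forms on `ℂ` regular on `U`.  Such a form is
`u dt` for a unique `u ∈ Ω⁰(U)`, and it is recorded by its coefficient `u`. -/
abbrev Omega1 {n : ℕ} (z : Fin n → ℂ) : Type := Omega0 z

/-- The de Rham differential `u ↦ (du/dt) dt`. -/
def deRham {n : ℕ} (z : Fin n → ℂ) : Omega0 z →ₗ[ℂ] Omega1 z :=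
  ratDeriv.restrict (p := Subalgebra.toSubmodule (Omega0 z)) (q := Subalgebra.toSubmodule (Omega0 z))
    fun _ hu => deriv_mem z hu

/-- The coordinate function `t`. -/
def coordT {n : ℕ} (z : Fin n → ℂ) : Omega0 z :=
  ⟨RatFunc.X, fun w _ => by simp⟩

/-- The function `1 / (t - z_i)`. -/
def invT {n : ℕ} (z : Fin n → ℂ) (i : Fin n) : Omega0 z :=
  ⟨(RatFunc.X - RatFunc.C (z i))⁻¹, fun w hw h => by
    have h0 : (RatFunc.X - RatFunc.C (z i) : RatFunc ℂ)⁻¹ =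
        algebraMap (Polynomial ℂ) (RatFunc ℂ) 1 /
          algebraMap (Polynomial ℂ) (RatFunc ℂ) (Polynomial.X - Polynomial.C (z i)) := by
      simp
    have h1 := Polynomial.eval_dvd (x := w)
      (RatFunc.denom_div_dvd 1 (Polynomial.X - Polynomial.C (z i)))
    rw [← h0, h, zero_dvd_iff] at h1
    simp only [Polynomial.eval_sub, Polynomial.eval_X, Polynomial.eval_C] at h1
    exact hw i (sub_eq_zero.mp h1)⟩

/-- The form `α = dΦ/Φ = -(1/κ) ∑ᵢ mᵢ dt/(t - zᵢ)` of the master function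
`Φ = ∏ᵢ (t - zᵢ)^(-mᵢ/κ)`. -/
def alphaForm {n : ℕ} (z m : Fin n → ℂ) (κ : ℂ) : Omega1 z :=
  (-(1 / κ)) • ∑ i, m i • invT z i

/-- The differential `∂ = d + α ∧ ·` of the twisted de Rham complex `0 → Ω⁰(U) → Ω¹(U) → 0`. -/
def twistedD {n : ℕ} (z m : Fin n → ℂ) (κ : ℂ) : Omega0 z →ₗ[ℂ] Omega1 z :=
  deRham z + LinearMap.mulLeft ℂ (alphaForm z m κ)

/-! ### Laurent expansions -/

theorem laurent_substitution {s : LaurentSeries ℂ} {d : ℤ} (hd : d ≠ 0) (hs : s.coeff d ≠ 0) :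
    (Polynomial ℂ)⁰ ≤ (LaurentSeries ℂ)⁰.comap (Polynomial.eval₂RingHom HahnSeries.C s) := by
  refine nonZeroDivisors_le_comap_nonZeroDivisors_of_injective _ ?_
  rw [injective_iff_map_eq_zero]
  intro p hp
  by_contra h0
  have hC : (algebraMap ℂ (LaurentSeries ℂ)) = HahnSeries.C :=
    RingHom.ext (LaurentSeries.algebraMap_apply ℂ)
  have halg : IsAlgebraic ℂ s := ⟨p, h0, by rw [Polynomial.aeval_def, hC]; exact hp⟩
  obtain ⟨c, rfl⟩ := minpoly.mem_range_of_degree_eq_one ℂ s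
    (IsAlgClosed.degree_eq_one_of_irreducible ℂ (minpoly.irreducible halg.isIntegral))
  apply hs
  rw [hC]
  exact HahnSeries.coeff_single_of_ne hd

/-- Laurent expansion at `t = c` in the local coordinate `T = t - c`, i.e. `t ↦ c + T`. -/
def expandAt (c : ℂ) : RatFunc ℂ →+* LaurentSeries ℂ :=
  RatFunc.liftRingHom
    (Polynomial.eval₂RingHom HahnSeries.C (HahnSeries.C c + HahnSeries.single (1 : ℤ) (1 : ℂ)))
    (laurent_substitution (d := 1) one_ne_zero (by simp))

/-- Laurent expansion at `t = ∞` in the local coordinate `T = 1/t`, i.e. `t ↦ T⁻¹`. -/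
def expandInfty : RatFunc ℂ →+* LaurentSeries ℂ :=
  RatFunc.liftRingHom
    (Polynomial.eval₂RingHom HahnSeries.C (HahnSeries.single (-1 : ℤ) (1 : ℂ)))
    (laurent_substitution (d := -1) (by norm_num) (by simp))

/-- Laurent expansion at the point of `ℙ¹` with the given label: `some i` stands for `z_i`,
and `none` for `z_{n+1} = ∞`. -/
def expand {n : ℕ} (z : Fin n → ℂ) : Option (Fin n) → (RatFunc ℂ →+* LaurentSeries ℂ)
  | some i => expandAt (z i)
  | none => expandInfty

theorem expand_C {n : ℕ} (z : Fin n → ℂ) (j : Option (Fin n)) (c : ℂ) :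
    expand z j (RatFunc.C c) = HahnSeries.C c := by
  have h0 : RatFunc.C c = algebraMap (Polynomial ℂ) (RatFunc ℂ) (Polynomial.C c) /
      algebraMap (Polynomial ℂ) (RatFunc ℂ) 1 := by simp
  cases j <;> simp only [expand, expandAt, expandInfty] <;>
    rw [h0, RatFunc.liftRingHom_apply_div] <;> simp

/-- The coefficient of `T ^ s` in the Laurent expansion, as a linear functional. -/
def laurentCoeff {n : ℕ} (z : Fin n → ℂ) (j : Option (Fin n)) (s : ℤ) : RatFunc ℂ →ₗ[ℂ] ℂ where
  toFun u := (expand z j u).coeff s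
  map_add' u v := by rw [map_add, HahnSeries.coeff_add]
  map_smul' c u := by
    rw [RatFunc.smul_eq_C_mul, map_mul, expand_C, HahnSeries.C_mul_eq_smul,
      HahnSeries.coeff_smul, RingHom.id_apply]

theorem laurentCoeff_bddBelow {n : ℕ} (z : Fin n → ℂ) (j : Option (Fin n)) (u : RatFunc ℂ) :
    ∃ N : ℤ, ∀ s < N, laurentCoeff z j s u = 0 :=
  ⟨(expand z j u).order, fun _ hs => HahnSeries.coeff_eq_zero_of_lt_order hs⟩

/-! ### The affine Lie algebra -/

/-- The Lie algebra of traceless complex `2 × 2` matrices. -/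
abbrev Sl2 : Type := LieAlgebra.SpecialLinear.sl (Fin 2) ℂ

theorem mem_sl2 (A : Matrix (Fin 2) (Fin 2) ℂ) :
    A ∈ LieAlgebra.SpecialLinear.sl (Fin 2) ℂ ↔ A.trace = 0 :=
  LinearMap.mem_ker

def e : Sl2 := ⟨!![0, 1; 0, 0], by simp [mem_sl2, Matrix.trace_fin_two]⟩
def f : Sl2 := ⟨!![0, 0; 1, 0], by simp [mem_sl2, Matrix.trace_fin_two]⟩
def h : Sl2 := ⟨!![1, 0; 0, -1], by simp [mem_sl2, Matrix.trace_fin_two]⟩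

/-- The invariant form `⟨a, b⟩ = tr(ab)`. -/
def trForm : LinearMap.BilinForm ℂ Sl2 :=
  LinearMap.mk₂ ℂ (fun a b => Matrix.trace (a.1 * b.1))
    (by intros; simp [add_mul]) (by intros; simp) (by intros; simp [mul_add]) (by intros; simp)

theorem trForm_isSymm : trForm.IsSymm := ⟨fun a b => Matrix.trace_mul_comm a.1 b.1⟩

theorem trForm_lieInvariant : trForm.lieInvariant Sl2 := by
  intro x y w
  simp only [trForm, LinearMap.mk₂_apply, LieAlgebra.SpecialLinear.sl_bracket, sub_mul, mul_sub,
    Matrix.trace_sub, neg_sub]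
  rw [Matrix.mul_assoc y.1 x.1, Matrix.mul_assoc x.1, Matrix.trace_mul_comm x.1, Matrix.mul_assoc]

theorem negTrForm_isSymm : (-trForm).IsSymm := ⟨fun a b => by simp [trForm_isSymm.eq a b]⟩

theorem negTrForm_lieInvariant : (-trForm).lieInvariant Sl2 := fun x y w => by
  simp [trForm_lieInvariant x y w]

/-- The 2-cocycle `(aTⁱ, bTʲ) ↦ i ⟨a, b⟩ δ_{i+j,0}` on the loop algebra (Mathlib's residue
cocycle is `(aTⁱ, bTʲ) ↦ j ⟨a, b⟩ δ_{i+j,0}`, whence the sign of the form). -/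
def affineCocycle := LieAlgebra.LoopAlgebra.twoCocycleOfBilinear ℂ ℤ Sl2 (-trForm)
  negTrForm_lieInvariant negTrForm_isSymm

/-- The affine Lie algebra `𝔰𝔩₂[T, T⁻¹] ⊕ ℂ c`. -/
def Affine : Type := LieAlgebra.ofTwoCocycle affineCocycle

instance : LieRing Affine := inferInstanceAs (LieRing (LieAlgebra.ofTwoCocycle affineCocycle))
instance : LieAlgebra ℂ Affine :=
  inferInstanceAs (LieAlgebra ℂ (LieAlgebra.ofTwoCocycle affineCocycle))

/-- The decomposition of the affine Lie algebra as a vector space. -/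
def affineEquiv : (LieAlgebra.loopAlgebra ℂ ℤ Sl2 × ℂ) ≃ₗ[ℂ] Affine where
  toFun x := LieAlgebra.ofProd affineCocycle (x.1, (TrivialLieModule.equiv ℂ _ ℂ).symm x.2)
  invFun y := (((LieAlgebra.ofProd affineCocycle).symm y).1,
    TrivialLieModule.equiv ℂ _ ℂ ((LieAlgebra.ofProd affineCocycle).symm y).2)
  map_add' _ _ := rfl
  map_smul' _ _ := rfl
  left_inv _ := rfl
  right_inv _ := rfl

/-- The element `x T ^ s`. -/
def mode (s : ℤ) : Sl2 →ₗ[ℂ] Affine :=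
  affineEquiv.toLinearMap ∘ₗ LinearMap.inl ℂ _ ℂ ∘ₗ
    TensorProduct.mk ℂ (AddMonoidAlgebra ℂ ℤ) Sl2 (AddMonoidAlgebra.single s 1)

/-- The central element `c`. -/
def central : Affine := affineEquiv (0, 1)

theorem mode_lie (i j : ℤ) (a b : Sl2) :
    ⁅mode i a, mode j b⁆ =
      mode (i + j) ⁅a, b⁆ + (if i + j = 0 then (i : ℂ) * Matrix.trace (a.1 * b.1) else 0) • central := by
  have h1 : ⁅mode i a, mode j b⁆ = affineEquiv
      (AddMonoidAlgebra.single (i + j) (1 : ℂ) ⊗ₜ ⁅a, b⁆,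
        (if i + j = 0 then (i : ℂ) * Matrix.trace (a.1 * b.1) else 0)) := by
    change LieAlgebra.ofProd affineCocycle _ = LieAlgebra.ofProd affineCocycle _
    congr 1
    refine Prod.ext ?_ ?_
    · change ⁅AddMonoidAlgebra.single i (1 : ℂ) ⊗ₜ[ℂ] a,
        AddMonoidAlgebra.single j (1 : ℂ) ⊗ₜ[ℂ] b⁆ = _
      rw [LieAlgebra.ExtendScalars.bracket_tmul, AddMonoidAlgebra.single_mul_single, one_mul]
    · change LieAlgebra.LoopAlgebra.residuePairing ℂ ℤ Sl2 (-trForm)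
        (AddMonoidAlgebra.single i (1 : ℂ) ⊗ₜ[ℂ] a)
        (AddMonoidAlgebra.single j (1 : ℂ) ⊗ₜ[ℂ] b) + 0 - 0 =
          (if i + j = 0 then (i : ℂ) * Matrix.trace (a.1 * b.1) else 0)
      rw [LieAlgebra.LoopAlgebra.residuePairing_apply_apply,
        LieAlgebra.LoopAlgebra.toFinsupp_single_tmul, LieAlgebra.LoopAlgebra.toFinsupp_single_tmul,
        Finsupp.sum_single_index (by simp), add_zero, sub_zero]
      by_cases hij : i + j = 0
      · obtain rfl : i = -j := by lia
        simp [trForm]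
      · have : i ≠ -j := by lia
        simp [hij, Finsupp.single_eq_of_ne' this]
  rw [h1, central, mode, ← map_smul, LinearMap.comp_apply, LinearEquiv.coe_coe, ← map_add]
  refine congrArg affineEquiv (Prod.ext ?_ ?_)
  · change _ = AddMonoidAlgebra.single (i + j) (1 : ℂ) ⊗ₜ[ℂ] ⁅a, b⁆ + _ • 0
    rw [smul_zero, add_zero]
  · change _ = 0 + _ • (1 : ℂ)
    rw [zero_add, smul_eq_mul, mul_one]

theorem central_lie (x : Affine) : ⁅central, x⁆ = 0 := by
  change LieAlgebra.ofProd affineCocycle _ = LieAlgebra.ofProd affineCocycle 0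
  congr 1
  refine Prod.ext ?_ ?_
  · change ⁅(0 : LieAlgebra.loopAlgebra ℂ ℤ Sl2), _⁆ = 0
    rw [zero_lie]
  · change LieAlgebra.LoopAlgebra.residuePairing ℂ ℤ Sl2 (-trForm) 0 _ + 0 - 0 = (0 : ℂ)
    rw [map_zero]; simp

theorem affine_induction {p : Affine → Prop} (x : Affine) (hc : p central)
    (hm : ∀ s a, p (mode s a)) (hadd : ∀ x y, p x → p y → p (x + y))
    (hs : ∀ (r : ℂ) x, p x → p (r • x)) : p x := by
  obtain ⟨⟨y, r⟩, rfl⟩ := affineEquiv.surjective x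
  have h1 : affineEquiv (y, r) = affineEquiv (y, 0) + r • central := by
    rw [central, ← map_smul, ← map_add]; simp
  rw [h1]
  refine hadd _ _ ?_ (hs _ _ hc)
  clear h1
  induction y using TensorProduct.induction_on with
  | zero =>
    have h0 := hs 0 _ hc
    rwa [zero_smul, ← map_zero affineEquiv] at h0
  | add x y hx hy =>
    have h0 := hadd _ _ hx hy
    rwa [← map_add, Prod.mk_add_mk, add_zero] at h0
  | tmul u a =>
    induction u using AddMonoidAlgebra.induction_linear with
    | zero =>
      have h0 := hs 0 _ hc
      rw [zero_smul, ← map_zero affineEquiv] at h0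
      rwa [TensorProduct.zero_tmul]
    | add x y hx hy =>
      have h0 := hadd _ _ hx hy
      rwa [← map_add, Prod.mk_add_mk, add_zero, ← TensorProduct.add_tmul] at h0
    | single s r =>
      have h0 := hs r _ (hm s a)
      rw [mode, LinearMap.comp_apply, LinearEquiv.coe_coe, ← map_smul] at h0
      convert h0 using 2
      refine Prod.ext ?_ (smul_zero r).symm
      change _ = r • (AddMonoidAlgebra.single s (1 : ℂ) ⊗ₜ[ℂ] a)
      rw [TensorProduct.smul_tmul', AddMonoidAlgebra.smul_single, smul_eq_mul, mul_one]

/-- Transposition of matrices. -/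
def sl2Transpose : Sl2 →ₗ[ℂ] Sl2 where
  toFun a := ⟨a.1.transpose, by rw [mem_sl2, Matrix.trace_transpose]; exact (mem_sl2 _).1 a.2⟩
  map_add' _ _ := rfl
  map_smul' _ _ := rfl

/-- The linear map `e ↦ f`, `f ↦ e`, `h ↦ -h`: interchange of the two basis vectors of `ℂ²`. -/
def sl2Swap : Sl2 →ₗ[ℂ] Sl2 where
  toFun a := ⟨a.1.submatrix Fin.rev Fin.rev, by
    have := (mem_sl2 _).1 a.2
    rw [Matrix.trace_fin_two] at this
    rw [mem_sl2, Matrix.trace_fin_two]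
    simpa [add_comm] using this⟩
  map_add' _ _ := rfl
  map_smul' _ _ := rfl

theorem sl2Transpose_val (a : Sl2) : (sl2Transpose a).1 = a.1.transpose := rfl
theorem sl2Swap_val (a : Sl2) : (sl2Swap a).1 = a.1.submatrix Fin.rev Fin.rev := rfl

/-- The automorphism `π` of the affine Lie algebra:
`c ↦ c`, `eTⁱ ↦ fTⁱ`, `fTⁱ ↦ eTⁱ`, `hTⁱ ↦ -hTⁱ`. -/
def piAut : Affine →ₗ[ℂ] Affine :=
  affineEquiv.toLinearMap ∘ₗ (LinearMap.prodMap (LinearMap.lTensor _ sl2Swap) LinearMap.id) ∘ₗ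
    affineEquiv.symm.toLinearMap

/-- The anti-automorphism `τ` of the affine Lie algebra with `c ↦ c`, `xTⁱ ↦ xᵗ T⁻ⁱ`, that is, the
one interchanging the Chevalley generators `e_i` and `f_i`. -/
def tau : Affine →ₗ[ℂ] Affine :=
  affineEquiv.toLinearMap ∘ₗ (LinearMap.prodMap (TensorProduct.map
    (AddMonoidAlgebra.mapDomainLinearMap ℂ ℂ (Neg.neg : ℤ → ℤ)) sl2Transpose) LinearMap.id) ∘ₗ
    affineEquiv.symm.toLinearMap

theorem piAut_mode (s : ℤ) (a : Sl2) : piAut (mode s a) = mode s (sl2Swap a) := by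
  simp [piAut, mode]

theorem piAut_central : piAut central = central := by
  simp [piAut, central]

theorem tau_mode (s : ℤ) (a : Sl2) : tau (mode s a) = mode (-s) (sl2Transpose a) := by
  have h0 : AddMonoidAlgebra.mapDomainLinearMap ℂ ℂ (Neg.neg : ℤ → ℤ)
      (AddMonoidAlgebra.single s (1 : ℂ)) = AddMonoidAlgebra.single (-s) (1 : ℂ) :=
    AddMonoidAlgebra.mapDomainLinearMap_single _ _ _
  simp only [tau, mode, LinearMap.comp_apply, LinearEquiv.coe_coe, LinearEquiv.symm_apply_apply,
    TensorProduct.mk_apply, LinearMap.inl_apply, LinearMap.prodMap_apply, TensorProduct.map_tmul,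
    LinearMap.id_apply, h0]

theorem tau_central : tau central = central := by
  simp [tau, central]


theorem tau_lie (x y : Affine) : tau ⁅x, y⁆ = ⁅tau y, tau x⁆ := by
  have hl : ∀ u : Affine, ⁅u, central⁆ = 0 := fun u => by rw [← lie_skew, central_lie, neg_zero]
  induction x using affine_induction with
  | hc => rw [central_lie, tau_central, hl, map_zero]
  | hadd x₁ x₂ h₁ h₂ => rw [add_lie, map_add, map_add, lie_add, h₁, h₂]
  | hs r x h => rw [smul_lie, map_smul, map_smul, lie_smul, h]
  | hm i a =>
    induction y using affine_induction with
    | hc => rw [hl, tau_central, central_lie, map_zero]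
    | hadd y₁ y₂ h₁ h₂ => rw [lie_add, map_add, map_add, add_lie, h₁, h₂]
    | hs r y h => rw [lie_smul, map_smul, map_smul, smul_lie, h]
    | hm j b =>
      rw [mode_lie, tau_mode, tau_mode, map_add, map_smul, tau_mode, tau_central, mode_lie]
      have h1 : sl2Transpose ⁅a, b⁆ = ⁅sl2Transpose b, sl2Transpose a⁆ := by
        apply Subtype.ext
        rw [sl2Transpose_val, LieAlgebra.SpecialLinear.sl_bracket,
          LieAlgebra.SpecialLinear.sl_bracket, sl2Transpose_val, sl2Transpose_val,
          Matrix.transpose_sub, Matrix.transpose_mul, Matrix.transpose_mul]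
      have h2 : -(i + j) = -j + -i := by ring
      rw [h1, h2]
      congr 2
      by_cases hij : i + j = 0
      · obtain rfl : i = -j := by lia
        rw [sl2Transpose_val, sl2Transpose_val, ← Matrix.transpose_mul, Matrix.trace_transpose]
        simp
      · have : ¬ (-j + -i = 0) := by lia
        simp [hij, this]

theorem piAut_lie (x y : Affine) : piAut ⁅x, y⁆ = ⁅piAut x, piAut y⁆ := by
  have hl : ∀ u : Affine, ⁅u, central⁆ = 0 := fun u => by rw [← lie_skew, central_lie, neg_zero]
  induction x using affine_induction with
  | hc => rw [central_lie, piAut_central, central_lie, map_zero]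
  | hadd x₁ x₂ h₁ h₂ => rw [add_lie, map_add, map_add, add_lie, h₁, h₂]
  | hs r x h => rw [smul_lie, map_smul, map_smul, smul_lie, h]
  | hm i a =>
    induction y using affine_induction with
    | hc => rw [hl, piAut_central, hl, map_zero]
    | hadd y₁ y₂ h₁ h₂ => rw [lie_add, map_add, map_add, lie_add, h₁, h₂]
    | hs r y h => rw [lie_smul, map_smul, map_smul, lie_smul, h]
    | hm j b =>
      rw [mode_lie, piAut_mode, piAut_mode, map_add, map_smul, piAut_mode, piAut_central, mode_lie]
      have h1 : sl2Swap ⁅a, b⁆ = ⁅sl2Swap a, sl2Swap b⁆ := by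
        apply Subtype.ext
        rw [sl2Swap_val, LieAlgebra.SpecialLinear.sl_bracket,
          LieAlgebra.SpecialLinear.sl_bracket, sl2Swap_val, sl2Swap_val]
        have h3 : ∀ A B : Matrix (Fin 2) (Fin 2) ℂ, (A * B).submatrix Fin.rev Fin.rev =
            A.submatrix Fin.rev Fin.rev * B.submatrix Fin.rev Fin.rev := fun A B =>
          (Matrix.submatrix_mul_equiv A B _ Fin.revPerm _).symm
        rw [← h3, ← h3]
        rfl
      have h2 : Matrix.trace ((sl2Swap a).1 * (sl2Swap b).1) = Matrix.trace (a.1 * b.1) := by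
        rw [sl2Swap_val, sl2Swap_val]
        simp [Matrix.trace_fin_two, Matrix.mul_apply]
        ring
      rw [h1, h2]


/-- Chevalley generators `e₁ = e`, `e₂ = fT` (indexed by `0, 1`). -/
def chevE : Fin 2 → Affine := ![mode 0 e, mode 1 f]
/-- Chevalley generators `f₁ = f`, `f₂ = eT⁻¹`. -/
def chevF : Fin 2 → Affine := ![mode 0 f, mode (-1) e]
/-- Chevalley generators `h₁ = h`, `h₂ = c - h`. -/
def chevH : Fin 2 → Affine := ![mode 0 h, central - mode 0 h]

theorem lie_ef : ⁅e, f⁆ = h := by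
  apply Subtype.ext
  rw [LieAlgebra.SpecialLinear.sl_bracket]
  ext i j
  fin_cases i <;> fin_cases j <;> simp [e, f, h]
theorem lie_he : ⁅h, e⁆ = (2 : ℂ) • e := by
  apply Subtype.ext
  rw [LieAlgebra.SpecialLinear.sl_bracket]
  ext i j
  fin_cases i <;> fin_cases j <;> simp [e, h]; norm_num
theorem lie_hf : ⁅h, f⁆ = (-2 : ℂ) • f := by
  apply Subtype.ext
  rw [LieAlgebra.SpecialLinear.sl_bracket]
  ext i j
  fin_cases i <;> fin_cases j <;> simp [f, h]; norm_num

theorem sl2_span (x : Sl2) : x = x.1 0 1 • e + x.1 1 0 • f + x.1 0 0 • h := by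
  have h0 := (mem_sl2 _).1 x.2
  rw [Matrix.trace_fin_two] at h0
  apply Subtype.ext
  ext i j
  fin_cases i <;> fin_cases j <;> simp [e, f, h]
  linear_combination h0

theorem sl2Transpose_e : sl2Transpose e = f := by
  apply Subtype.ext
  rw [sl2Transpose_val]
  ext i j
  fin_cases i <;> fin_cases j <;> simp [e, f]
theorem sl2Transpose_f : sl2Transpose f = e := by
  apply Subtype.ext
  rw [sl2Transpose_val]
  ext i j
  fin_cases i <;> fin_cases j <;> simp [e, f]
theorem sl2Transpose_h : sl2Transpose h = h := by
  apply Subtype.ext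
  rw [sl2Transpose_val]
  ext i j
  fin_cases i <;> fin_cases j <;> simp [h]
theorem sl2Swap_e : sl2Swap e = f := by
  apply Subtype.ext
  rw [sl2Swap_val]
  ext i j
  fin_cases i <;> fin_cases j <;> simp [e, f]
theorem sl2Swap_f : sl2Swap f = e := by
  apply Subtype.ext
  rw [sl2Swap_val]
  ext i j
  fin_cases i <;> fin_cases j <;> simp [e, f]
theorem sl2Swap_h : sl2Swap h = -h := by
  apply Subtype.ext
  rw [sl2Swap_val]
  ext i j
  fin_cases i <;> fin_cases j <;> simp [h]

theorem tau_chevE (i : Fin 2) : tau (chevE i) = chevF i := by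
  fin_cases i <;> simp [chevE, chevF, tau_mode, sl2Transpose_e, sl2Transpose_f]

theorem tau_chevF (i : Fin 2) : tau (chevF i) = chevE i := by
  fin_cases i <;> simp [chevE, chevF, tau_mode, sl2Transpose_e, sl2Transpose_f]

theorem lie_chevE_chevF (i j : Fin 2) :
    ⁅chevE i, chevF j⁆ = if i = j then chevH i else 0 := by
  have hfe : ⁅f, e⁆ = -h := by rw [← lie_skew, lie_ef]
  fin_cases i <;> fin_cases j <;> simp [chevE, chevF, chevH, mode_lie, lie_ef, hfe]
  all_goals simp [e, f, Matrix.trace_fin_two]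
  abel

/-! ### Verma modules -/

/-- The universal enveloping algebra of the affine Lie algebra. -/
abbrev UAffine : Type := UniversalEnvelopingAlgebra ℂ Affine

section

attribute [local instance] LieRing.ofAssociativeRing

/-- The inclusion of the affine Lie algebra in its enveloping algebra. -/
def toU : Affine →ₗ[ℂ] UAffine := (UniversalEnvelopingAlgebra.ι ℂ).toLinearMap

theorem toU_lie (x y : Affine) : toU ⁅x, y⁆ = toU x * toU y - toU y * toU x :=
  (UniversalEnvelopingAlgebra.ι ℂ).map_lie x y

theorem adjoin_toU : Algebra.adjoin ℂ (Set.range toU) = ⊤ := by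
  set S := Algebra.adjoin ℂ (Set.range toU)
  let g : Affine →ₗ⁅ℂ⁆ S :=
    { toFun x := ⟨toU x, Algebra.subset_adjoin ⟨x, rfl⟩⟩
      map_add' x y := Subtype.ext (map_add toU x y)
      map_smul' r x := Subtype.ext (map_smul toU r x)
      map_lie' {x y} := Subtype.ext (toU_lie x y) }
  have h1 : S.val.comp (UniversalEnvelopingAlgebra.lift ℂ g) = AlgHom.id ℂ UAffine := by
    apply UniversalEnvelopingAlgebra.hom_ext
    ext x
    have := UniversalEnvelopingAlgebra.lift_ι_apply ℂ g x
    simp only [LieHom.comp_apply, AlgHom.toLieHom_apply, AlgHom.comp_apply, this]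
    rfl
  rw [eq_top_iff]
  intro u _
  have h2 := DFunLike.congr_fun h1 u
  rw [AlgHom.id_apply] at h2
  rw [← h2]
  exact (UniversalEnvelopingAlgebra.lift ℂ g u).2

end

/-- The left ideal generated by `e₁`, `e₂`, `h₁ - m`, `h₂ - (k - m)`. -/
def vermaIdeal (m k : ℂ) : Submodule UAffine UAffine :=
  Submodule.span UAffine {toU (chevE 0), toU (chevE 1),
    toU (chevH 0) - algebraMap ℂ UAffine m, toU (chevH 1) - algebraMap ℂ UAffine (k - m)}

/-- The Verma module `V(m, k - m)`: generated by `v` subject to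
`e₁ v = e₂ v = 0`, `h₁ v = m v`, `h₂ v = (k - m) v`. -/
def Verma (m k : ℂ) : Type := UAffine ⧸ vermaIdeal m k

instance (m k : ℂ) : AddCommGroup (Verma m k) :=
  inferInstanceAs (AddCommGroup (UAffine ⧸ vermaIdeal m k))
instance (m k : ℂ) : Module UAffine (Verma m k) :=
  inferInstanceAs (Module UAffine (UAffine ⧸ vermaIdeal m k))
instance (m k : ℂ) : Module ℂ (Verma m k) :=
  inferInstanceAs (Module ℂ (UAffine ⧸ vermaIdeal m k))
instance (m k : ℂ) : IsScalarTower ℂ UAffine (Verma m k) :=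
  inferInstanceAs (IsScalarTower ℂ UAffine (UAffine ⧸ vermaIdeal m k))
instance (m k : ℂ) : SMulCommClass UAffine ℂ (Verma m k) := IsScalarTower.to_smulCommClass'

/-- The generating vector `v`. -/
def vac (m k : ℂ) : Verma m k := Submodule.Quotient.mk 1

/-- The action of the affine Lie algebra on the Verma module. -/
def vermaAct (m k : ℂ) : Affine →ₗ[ℂ] Module.End ℂ (Verma m k) :=
  (Algebra.lsmul ℂ ℂ (Verma m k)).toLinearMap ∘ₗ toU

theorem vermaAct_apply (m k : ℂ) (x : Affine) (y : Verma m k) : vermaAct m k x y = toU x • y := rfl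

theorem vermaAct_lie (m k : ℂ) (x y : Affine) :
    vermaAct m k ⁅x, y⁆ = vermaAct m k x * vermaAct m k y - vermaAct m k y * vermaAct m k x := by
  ext w
  simp [vermaAct_apply, toU_lie, sub_smul, mul_smul]



/-- Words in `f₁, f₂` applied to the generating vector. -/
def fWord (m k : ℂ) (l : List (Fin 2)) : Verma m k :=
  l.foldr (fun i w => vermaAct m k (chevF i) w) (vac m k)

/-- The homogeneous component `V_γ`, `γ = (p₁, p₂)`: the span of the words `f_{i₁} ⋯ f_{i_p} v`
with `p₁` letters `f₁` and `p₂` letters `f₂` (so it is zero unless `p₁, p₂ ≥ 0`). -/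
def gr (m k : ℂ) (p : ℤ × ℤ) : Submodule ℂ (Verma m k) :=
  Submodule.span ℂ {w | ∃ l : List (Fin 2), ((l.count 0 : ℤ), (l.count 1 : ℤ)) = p ∧ fWord m k l = w}

/-- `x` shifts the grading by `d`. -/
def Shifts (m k : ℂ) (x : Affine) (d : ℤ × ℤ) : Prop :=
  ∀ p, ∀ w ∈ gr m k p, vermaAct m k x w ∈ gr m k (p + d)

theorem mk_eq_smul_vac (m k : ℂ) (u : UAffine) :
    (Submodule.Quotient.mk u : UAffine ⧸ vermaIdeal m k) = u • vac m k := by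
  change (Submodule.Quotient.mk u : UAffine ⧸ vermaIdeal m k) =
    u • (Submodule.Quotient.mk 1 : UAffine ⧸ vermaIdeal m k)
  rw [← Submodule.Quotient.mk_smul, smul_eq_mul, mul_one]

theorem smul_vac_eq_zero (m k : ℂ) {u : UAffine} (hu : u ∈ vermaIdeal m k) : u • vac m k = 0 := by
  rw [← mk_eq_smul_vac]
  exact (Submodule.Quotient.mk_eq_zero _).2 hu

theorem chevE_vac (m k : ℂ) (i : Fin 2) : vermaAct m k (chevE i) (vac m k) = 0 := by
  rw [vermaAct_apply]
  apply smul_vac_eq_zero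
  apply Submodule.subset_span
  fin_cases i <;> simp

theorem chevH_vac (m k : ℂ) (i : Fin 2) :
    vermaAct m k (chevH i) (vac m k) = (![m, k - m] i) • vac m k := by
  rw [vermaAct_apply, ← sub_eq_zero, ← algebraMap_smul UAffine, ← sub_smul]
  apply smul_vac_eq_zero
  apply Submodule.subset_span
  fin_cases i <;> simp

theorem vermaAct_lie_apply (m k : ℂ) (x y : Affine) (w : Verma m k) :
    vermaAct m k ⁅x, y⁆ w =
      vermaAct m k x (vermaAct m k y w) - vermaAct m k y (vermaAct m k x w) := by
  rw [vermaAct_lie]; rfl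

theorem shifts_of_word {m k : ℂ} {x : Affine} {d : ℤ × ℤ}
    (hx : ∀ l : List (Fin 2), vermaAct m k x (fWord m k l) ∈
      gr m k (((l.count 0 : ℤ), (l.count 1 : ℤ)) + d)) : Shifts m k x d := by
  intro p w hw
  refine Submodule.span_induction (p := fun w _ => vermaAct m k x w ∈ gr m k (p + d))
    ?_ ?_ ?_ ?_ hw
  · rintro _ ⟨l, rfl, rfl⟩
    exact hx l
  · rw [map_zero]; exact zero_mem _
  · intro a b _ _ ha hb
    rw [map_add]; exact add_mem ha hb
  · intro r a _ ha
    rw [map_smul]; exact Submodule.smul_mem _ _ ha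

theorem fWord_mem (m k : ℂ) (l : List (Fin 2)) :
    fWord m k l ∈ gr m k ((l.count 0 : ℤ), (l.count 1 : ℤ)) :=
  Submodule.subset_span ⟨l, rfl, rfl⟩

/-- The degree of `f_i`. -/
def simpleDeg : Fin 2 → ℤ × ℤ := ![(1, 0), (0, 1)]

theorem count_cons_eq (i : Fin 2) (l : List (Fin 2)) :
    ((((i :: l).count 0 : ℕ) : ℤ), (((i :: l).count 1 : ℕ) : ℤ)) =
      ((l.count 0 : ℤ), (l.count 1 : ℤ)) + simpleDeg i := by
  fin_cases i <;> simp [simpleDeg]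

theorem shifts_chevF (m k : ℂ) (i : Fin 2) : Shifts m k (chevF i) (simpleDeg i) := by
  apply shifts_of_word
  intro l
  rw [← count_cons_eq]
  exact fWord_mem m k (i :: l)

theorem lie_chevH_chevF (i j : Fin 2) : ∃ r : ℂ, ⁅chevH i, chevF j⁆ = r • chevF j := by
  have hl : ∀ u : Affine, ⁅u, central⁆ = 0 := fun u => by rw [← lie_skew, central_lie, neg_zero]
  have t1 : Matrix.trace (h.1 * f.1) = 0 := by simp [h, f, Matrix.trace_fin_two]
  fin_cases i <;> fin_cases j
  · exact ⟨-2, by simp [chevH, chevF, mode_lie, lie_hf]⟩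
  · exact ⟨2, by simp [chevH, chevF, mode_lie, lie_he]⟩
  · exact ⟨2, by simp [chevH, chevF, mode_lie, lie_hf, central_lie, sub_lie]⟩
  · exact ⟨-2, by simp [chevH, chevF, mode_lie, lie_he, central_lie, sub_lie]⟩

theorem chevH_word (m k : ℂ) (i : Fin 2) (l : List (Fin 2)) :
    ∃ r : ℂ, vermaAct m k (chevH i) (fWord m k l) = r • fWord m k l := by
  induction l with
  | nil => exact ⟨_, chevH_vac m k i⟩
  | cons j l ih =>
    obtain ⟨r, hr⟩ := ih
    obtain ⟨s, hs⟩ := lie_chevH_chevF i j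
    refine ⟨s + r, ?_⟩
    have h1 := vermaAct_lie_apply m k (chevH i) (chevF j) (fWord m k l)
    rw [hs, hr, map_smul, map_smul, LinearMap.smul_apply, eq_sub_iff_add_eq] at h1
    change vermaAct m k (chevH i) (vermaAct m k (chevF j) (fWord m k l)) =
      _ • vermaAct m k (chevF j) (fWord m k l)
    rw [← h1, add_smul]

theorem shifts_chevH (m k : ℂ) (i : Fin 2) : Shifts m k (chevH i) 0 := by
  apply shifts_of_word
  intro l
  obtain ⟨r, hr⟩ := chevH_word m k i l
  rw [hr, add_zero]
  exact Submodule.smul_mem _ _ (fWord_mem m k l)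

theorem shifts_chevE (m k : ℂ) (i : Fin 2) : Shifts m k (chevE i) (-simpleDeg i) := by
  apply shifts_of_word
  intro l
  induction l with
  | nil =>
    change vermaAct m k (chevE i) (vac m k) ∈ _
    rw [chevE_vac]
    exact zero_mem _
  | cons j l ih =>
    have h1 := vermaAct_lie_apply m k (chevE i) (chevF j) (fWord m k l)
    rw [eq_sub_iff_add_eq] at h1
    change vermaAct m k (chevE i) (vermaAct m k (chevF j) (fWord m k l)) ∈ _
    rw [← h1, count_cons_eq]
    refine add_mem ?_ ?_
    · rw [lie_chevE_chevF]
      split_ifs with hij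
      · subst hij
        have := shifts_chevH m k i _ _ (fWord_mem m k l)
        simpa using this
      · simp
    · have := shifts_chevF m k j _ _ ih
      convert this using 2
      abel

theorem Shifts.lie {m k : ℂ} {x y : Affine} {d d' : ℤ × ℤ} (hx : Shifts m k x d)
    (hy : Shifts m k y d') : Shifts m k ⁅x, y⁆ (d + d') := by
  intro p w hw
  rw [vermaAct_lie_apply]
  refine sub_mem ?_ ?_
  · have := hx _ _ (hy _ _ hw)
    rwa [add_assoc, add_comm d'] at this
  · have := hy _ _ (hx _ _ hw)
    rwa [add_assoc] at this

theorem Shifts.smul {m k : ℂ} {x : Affine} {d : ℤ × ℤ} (hx : Shifts m k x d) (r : ℂ) :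
    Shifts m k (r • x) d := by
  intro p w hw
  rw [map_smul, LinearMap.smul_apply]
  exact Submodule.smul_mem _ _ (hx p w hw)

theorem Shifts.add {m k : ℂ} {x y : Affine} {d : ℤ × ℤ} (hx : Shifts m k x d)
    (hy : Shifts m k y d) : Shifts m k (x + y) d := by
  intro p w hw
  rw [map_add, LinearMap.add_apply]
  exact add_mem (hx p w hw) (hy p w hw)

theorem Shifts.congr {m k : ℂ} {x y : Affine} {d d' : ℤ × ℤ} (hx : Shifts m k x d)
    (hxy : y = x) (hd : d' = d) : Shifts m k y d' := by
  subst hxy hd; exact hx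

theorem shifts_central (m k : ℂ) : Shifts m k central 0 := by
  refine ((shifts_chevH m k 0).add (shifts_chevH m k 1)).congr ?_ rfl
  simp [chevH]

theorem lie_fh : ⁅f, h⁆ = (2 : ℂ) • f := by rw [← lie_skew, lie_hf]; simp
theorem lie_fe : ⁅f, e⁆ = -h := by rw [← lie_skew, lie_ef]

theorem shifts_mode_nat (m k : ℂ) (s : ℕ) :
    Shifts m k (mode s e) (-1 - s, -s) ∧ Shifts m k (mode s f) (1 - s, -s) ∧
      Shifts m k (mode s h) (-s, -s) := by
  have e0 := shifts_chevE m k 0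
  have f1 := shifts_chevE m k 1
  have f0 := shifts_chevF m k 0
  have h0 := shifts_chevH m k 0
  induction s with
  | zero =>
    exact ⟨e0.congr rfl (by simp [simpleDeg]), f0.congr rfl (by simp [simpleDeg]),
      h0.congr rfl (by ext <;> simp)⟩
  | succ s ih =>
    obtain ⟨ie, -, ih⟩ := ih
    have n0 : ¬ ((s : ℤ) + 1 = 0) := by lia
    have hh : Shifts m k (mode (s + 1 : ℕ) h) (-(s + 1 : ℕ), -(s + 1 : ℕ)) := by
      refine (ie.lie f1).congr ?_ ?_
      · simp [chevE, mode_lie, lie_ef, n0]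
      · ext <;> simp [simpleDeg] <;> ring
    refine ⟨?_, ?_, hh⟩
    · refine ((hh.lie e0).smul (1 / 2)).congr ?_ ?_
      · simp [chevE, mode_lie, lie_he, n0]
      · ext <;> simp [simpleDeg] <;> ring
    · refine ((ih.lie f1).smul (-1 / 2)).congr ?_ ?_
      · simp [chevE, mode_lie, lie_hf, n0, smul_smul]
      · ext <;> simp [simpleDeg] <;> ring

theorem shifts_mode_neg (m k : ℂ) (s : ℕ) :
    Shifts m k (mode (-s) e) (-1 + s, s) ∧ Shifts m k (mode (-s) f) (1 + s, s) ∧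
      Shifts m k (mode (-s) h) (s, s) := by
  have e0 := shifts_chevE m k 0
  have e1 := shifts_chevF m k 1
  have f0 := shifts_chevF m k 0
  have h0 := shifts_chevH m k 0
  induction s with
  | zero =>
    exact ⟨e0.congr (by simp [chevE]) (by simp [simpleDeg]),
      f0.congr (by simp [chevF]) (by simp [simpleDeg]),
      h0.congr (by simp [chevH]) (by ext <;> simp)⟩
  | succ s ih =>
    obtain ⟨-, jf, jh⟩ := ih
    have n0 : ¬ (-1 + -(s : ℤ) = 0) := by lia
    have n1 : ¬ (-(s : ℤ) + -1 = 0) := by lia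
    have n2 : -1 + -(s : ℤ) = -(s : ℤ) + -1 := by ring
    have hh : Shifts m k (mode (-(s + 1 : ℕ)) h) ((s + 1 : ℕ), (s + 1 : ℕ)) := by
      refine (e1.lie jf).congr ?_ ?_
      · simp [chevF, mode_lie, lie_ef, n0]
      · ext <;> simp [simpleDeg] <;> ring
    refine ⟨?_, ?_, hh⟩
    · refine ((jh.lie e1).smul (1 / 2)).congr ?_ ?_
      · simp [chevF, mode_lie, lie_he, n1, n2]
      · ext <;> simp [simpleDeg] <;> ring
    · refine ((hh.lie f0).smul (-1 / 2)).congr ?_ ?_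
      · simp [chevF, mode_lie, lie_hf, n0, smul_smul]
      · ext <;> simp [simpleDeg] <;> ring

theorem shifts_mode (m k : ℂ) (s : ℤ) :
    Shifts m k (mode s e) (-1 - s, -s) ∧ Shifts m k (mode s f) (1 - s, -s) ∧
      Shifts m k (mode s h) (-s, -s) := by
  obtain ⟨n, rfl | rfl⟩ := s.eq_nat_or_neg
  · exact shifts_mode_nat m k n
  · simpa using shifts_mode_neg m k n

theorem iSup_gr (m k : ℂ) : ⨆ p, gr m k p = ⊤ := by
  have shift_mem : ∀ {x : Affine} {d : ℤ × ℤ}, Shifts m k x d → ∀ w ∈ ⨆ p, gr m k p,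
      vermaAct m k x w ∈ ⨆ p, gr m k p := by
    intro x d hx w hw
    refine Submodule.iSup_induction _ (motive := fun w => vermaAct m k x w ∈ ⨆ p, gr m k p)
      hw ?_ ?_ ?_
    · exact fun p w hw => Submodule.mem_iSup_of_mem _ (hx p w hw)
    · rw [map_zero]; exact zero_mem _
    · intro a b ha hb
      rw [map_add]; exact add_mem ha hb
  have act_mem : ∀ x : Affine, ∀ w ∈ ⨆ p, gr m k p, vermaAct m k x w ∈ ⨆ p, gr m k p := by
    intro x w hw
    induction x using affine_induction with
    | hc => exact shift_mem (shifts_central m k) w hw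
    | hadd x y hx hy => rw [map_add]; exact add_mem hx hy
    | hs r x hx => rw [map_smul]; exact Submodule.smul_mem _ _ hx
    | hm s a =>
      obtain ⟨he, hf, hh⟩ := shifts_mode m k s
      rw [sl2_span a]
      simp only [map_add, map_smul, LinearMap.add_apply, LinearMap.smul_apply]
      exact add_mem (add_mem (Submodule.smul_mem _ _ (shift_mem he w hw))
        (Submodule.smul_mem _ _ (shift_mem hf w hw))) (Submodule.smul_mem _ _ (shift_mem hh w hw))
  rw [eq_top_iff]
  rintro y -
  obtain ⟨u, rfl⟩ := Submodule.Quotient.mk_surjective (vermaIdeal m k) y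
  rw [mk_eq_smul_vac]
  have hu : u ∈ Algebra.adjoin ℂ (Set.range toU) := by rw [adjoin_toU]; trivial
  have key : ∀ w ∈ ⨆ p, gr m k p, u • w ∈ ⨆ p, gr m k p := by
    induction hu using Algebra.adjoin_induction with
    | mem x hx =>
      obtain ⟨x, rfl⟩ := hx
      exact act_mem x
    | algebraMap r =>
      intro w hw
      rw [algebraMap_smul]
      exact Submodule.smul_mem _ _ hw
    | add a b _ _ ha hb =>
      intro w hw
      rw [add_smul]
      exact add_mem (ha w hw) (hb w hw)
    | mul a b _ _ ha hb =>
      intro w hw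
      rw [mul_smul]
      exact ha _ (hb w hw)
  exact key _ (Submodule.mem_iSup_of_mem _ (fWord_mem m k []))

/-! ### Contragradient Verma modules -/

/-- The contragradient module `V(m, k - m)^* = ⨁_γ V_γ^*`, realised as the space of linear
functionals on `V` that vanish on all but finitely many homogeneous components `V_γ`. -/
def Contra (m k : ℂ) : Submodule ℂ (Module.Dual ℂ (Verma m k)) where
  carrier := {φ | {p | ∃ w ∈ gr m k p, φ w ≠ 0}.Finite}
  zero_mem' := by simp
  add_mem' {φ ψ} hφ hψ := by
    refine (hφ.union hψ).subset ?_
    rintro p ⟨w, hw, hne⟩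
    by_cases h0 : φ w = 0
    · exact Or.inr ⟨w, hw, fun h1 => hne (by rw [LinearMap.add_apply, h0, h1, add_zero])⟩
    · exact Or.inl ⟨w, hw, h0⟩
  smul_mem' r φ hφ := by
    refine hφ.subset ?_
    rintro p ⟨w, hw, hne⟩
    exact ⟨w, hw, fun h1 => hne (by rw [LinearMap.smul_apply, h1, smul_zero])⟩

theorem Shifts.comp_mem {m k : ℂ} {x : Affine} {d : ℤ × ℤ} (hx : Shifts m k x d)
    {φ : Module.Dual ℂ (Verma m k)} (hφ : φ ∈ Contra m k) : φ ∘ₗ vermaAct m k x ∈ Contra m k := by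
  have h1 : {p | ∃ w ∈ gr m k p, φ w ≠ 0}.Finite := hφ
  refine (h1.preimage (f := fun p => p + d) (add_left_injective d).injOn).subset ?_
  rintro p ⟨w, hw, hne⟩
  exact ⟨_, hx p w hw, hne⟩

theorem comp_vermaAct_mem (m k : ℂ) (x : Affine) {φ : Module.Dual ℂ (Verma m k)}
    (hφ : φ ∈ Contra m k) : φ ∘ₗ vermaAct m k x ∈ Contra m k := by
  induction x using affine_induction with
  | hc => exact (shifts_central m k).comp_mem hφ
  | hadd x y hx hy => rw [map_add, LinearMap.comp_add]; exact add_mem hx hy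
  | hs r x hx => rw [map_smul, LinearMap.comp_smul]; exact Submodule.smul_mem _ _ hx
  | hm s a =>
    obtain ⟨he, hf, hh⟩ := shifts_mode m k s
    rw [sl2_span a]
    simp only [map_add, map_smul, LinearMap.comp_add, LinearMap.comp_smul]
    exact add_mem (add_mem (Submodule.smul_mem _ _ (he.comp_mem hφ))
      (Submodule.smul_mem _ _ (hf.comp_mem hφ))) (Submodule.smul_mem _ _ (hh.comp_mem hφ))

/-- The action of the affine Lie algebra on the contragradient module,
`⟨x φ, y⟩ = ⟨φ, τ(x) y⟩`. -/
def contraAct (m k : ℂ) : Affine →ₗ[ℂ] Module.End ℂ (Contra m k) :=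
  LinearMap.mk₂ ℂ
    (fun x φ => (⟨φ.1 ∘ₗ vermaAct m k (tau x), comp_vermaAct_mem m k (tau x) φ.2⟩ : Contra m k))
    (fun x y φ => by ext w; simp) (fun r x φ => by ext w; simp)
    (fun x φ ψ => by ext w; simp) (fun r x φ => by ext w; simp)

theorem contraAct_apply (m k : ℂ) (x : Affine) (φ : Contra m k) (w : Verma m k) :
    (contraAct m k x φ).1 w = φ.1 (vermaAct m k (tau x) w) := rfl

theorem contraAct_chevF (m k : ℂ) (i : Fin 2) (φ : Contra m k) (w : Verma m k) :
    (contraAct m k (chevF i) φ).1 w = φ.1 (vermaAct m k (chevE i) w) := by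
  rw [contraAct_apply, tau_chevF]

theorem contraAct_chevE (m k : ℂ) (i : Fin 2) (φ : Contra m k) (w : Verma m k) :
    (contraAct m k (chevE i) φ).1 w = φ.1 (vermaAct m k (chevF i) w) := by
  rw [contraAct_apply, tau_chevE]

theorem contraAct_lie (m k : ℂ) (x y : Affine) :
    contraAct m k ⁅x, y⁆ = contraAct m k x * contraAct m k y - contraAct m k y * contraAct m k x := by
  ext φ w
  change φ.1 (vermaAct m k (tau ⁅x, y⁆) w) = φ.1 (vermaAct m k (tau y) (vermaAct m k (tau x) w)) -
    φ.1 (vermaAct m k (tau x) (vermaAct m k (tau y) w))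
  rw [tau_lie, vermaAct_lie_apply, map_sub]

/-- The finiteness property of a module `W` over the affine Lie algebra: for all `w ∈ W` and
`x ∈ 𝔰𝔩₂`, one has `xTʲ · w = 0` for all `j ≫ 0`. -/
def FinitenessProperty {W : Type*} [AddCommGroup W] [Module ℂ W]
    (A : Affine →ₗ[ℂ] Module.End ℂ W) : Prop :=
  ∀ (w : W) (x : Sl2), ∃ N : ℤ, ∀ j ≥ N, A (mode j x) w = 0

theorem Shifts.eq_zero {m k : ℂ} {x : Affine} {d : ℤ × ℤ} (hx : Shifts m k x d)
    {φ : Module.Dual ℂ (Verma m k)} {N : ℤ} (hN : ∀ p, ∀ w ∈ gr m k p, φ w ≠ 0 → p.2 < N)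
    (hd : N ≤ d.2) : φ ∘ₗ vermaAct m k x = 0 := by
  have h1 : ⨆ p, gr m k p ≤ LinearMap.ker (φ ∘ₗ vermaAct m k x) := by
    refine iSup_le fun p => Submodule.span_le.2 ?_
    rintro _ ⟨l, rfl, rfl⟩
    by_contra hne
    have h2 := hN _ _ (hx _ _ (fWord_mem m k l)) hne
    simp only [Prod.snd_add] at h2
    lia
  rw [iSup_gr, top_le_iff] at h1
  exact LinearMap.ker_eq_top.1 h1

theorem contra_finiteness (m k : ℂ) : FinitenessProperty (contraAct m k) := by
  intro φ x
  have hfin : {p | ∃ w ∈ gr m k p, φ.1 w ≠ 0}.Finite := φ.2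
  obtain ⟨N, hN⟩ := (hfin.image Prod.snd).bddAbove
  have hN' : ∀ p, ∀ w ∈ gr m k p, φ.1 w ≠ 0 → p.2 < N + 1 := fun p w hw hne =>
    Int.lt_add_one_of_le (hN ⟨p, ⟨w, hw, hne⟩, rfl⟩)
  refine ⟨N + 1, fun j hj => ?_⟩
  obtain ⟨he, hf, hh⟩ := shifts_mode m k (-j)
  apply Subtype.ext
  change φ.1 ∘ₗ vermaAct m k (tau (mode j x)) = 0
  rw [tau_mode, sl2_span (sl2Transpose x)]
  simp only [map_add, map_smul, LinearMap.comp_add, LinearMap.comp_smul]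
  rw [he.eq_zero hN' (by simpa using hj), hf.eq_zero hN' (by simpa using hj),
    hh.eq_zero hN' (by simpa using hj)]
  simp

/-! ### Dual basis vectors -/

/-- Labels of the Poincaré–Birkhoff–Witt vectors: three finite multisets of exponents. -/
structure PBWIndex where
  /-- the exponents `i` of the factors `f/Tⁱ` -/
  fs : Multiset ℕ
  /-- the exponents `j` of the factors `h/Tʲ` -/
  hs : Multiset ℕ
  /-- the exponents `l` of the factors `e/Tˡ` -/
  es : Multiset ℕ

/-- Exponents of `h` and `e` have to be at least `1`. -/
def PBWIndex.Valid (d : PBWIndex) : Prop := 0 ∉ d.hs ∧ 0 ∉ d.es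

/-- The product `x/T^{i₁} ⋯ x/T^{iᵣ}` with `i₁ ≥ ⋯ ≥ iᵣ` as an operator on the Verma module. -/
def lowering (m k : ℂ) (x : Sl2) (s : Multiset ℕ) : Module.End ℂ (Verma m k) :=
  ((s.sort (fun i j : ℕ => j ≤ i)).map fun i : ℕ => vermaAct m k (mode (-(i : ℤ)) x)).prod

/-- The PBW vectors.  In a component `V_{(p₁, p₂)}` with `p₁ > p₂` (more `f`'s than `e`'s) the
order of the factors is `f, h, e`, and for `p₁ < p₂` it is `e, h, f`.  For `p₁ = p₂` only the
vector `v` of `V_{(0,0)}` plays a role (the order there is immaterial, and taken as `f, h, e`). -/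
def pbwVec (m k : ℂ) (d : PBWIndex) : Verma m k :=
  if d.fs.card < d.es.card then
    lowering m k e d.es (lowering m k h d.hs (lowering m k f d.fs (vac m k)))
  else
    lowering m k f d.fs (lowering m k h d.hs (lowering m k e d.es (vac m k)))

open Classical in
/-- `φ` is the element of `V^*` dual to the basis vector labelled by `d`. -/
def IsDualVec {m k : ℂ} (d : PBWIndex) (φ : Contra m k) : Prop :=
  ∀ d' : PBWIndex, d'.Valid → φ.1 (pbwVec m k d') = if d' = d then 1 else 0

open Classical in
/-- The vector `(w)^* ∈ V^*` of the dual basis, where `w` is the basis vector labelled by `d`.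
(The vectors `pbwVec` with valid labels form a homogeneous basis of `V` by the
Poincaré–Birkhoff–Witt theorem, so that it exists and is unique for every valid label.) -/
def dualVec (m k : ℂ) (d : PBWIndex) : Contra m k :=
  if hd : ∃ φ : Contra m k, IsDualVec d φ then hd.choose else 0

/-- The label of `v`. -/
def idxV : PBWIndex := ⟨0, 0, 0⟩
/-- The label of `(f/Tⁱ) v`. -/
def idxF (i : ℕ) : PBWIndex := ⟨{i}, 0, 0⟩
/-- The label of `(f/Tⁱ)(f/Tʲ) v`. -/
def idxFF (i j : ℕ) : PBWIndex := ⟨{i, j}, 0, 0⟩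
/-- The label of `(e/Tⁱ) v`, `i ≥ 1`. -/
def idxE (i : ℕ) : PBWIndex := ⟨0, 0, {i}⟩
/-- The label of `(e/Tⁱ)(e/Tʲ) v`, `i, j ≥ 1`. -/
def idxEE (i j : ℕ) : PBWIndex := ⟨0, 0, {i, j}⟩

/-! ### The Lie algebra `𝔰𝔩₂(U)`, its action, and the chain complex -/

/-- The Lie algebra `𝔰𝔩₂(U)` of `𝔰𝔩₂`-valued rational functions regular on `U`,
with the pointwise bracket `[u₁ ⊗ x, u₂ ⊗ y] = u₁u₂ ⊗ [x, y]`. -/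
abbrev Sl2U {n : ℕ} (z : Fin n → ℂ) : Type := Omega0 z ⊗[ℂ] Sl2

theorem sl2U_bracket {n : ℕ} (z : Fin n → ℂ) (u₁ u₂ : Omega0 z) (x y : Sl2) :
    ⁅(u₁ ⊗ₜ x : Sl2U z), (u₂ ⊗ₜ y : Sl2U z)⁆ = (u₁ * u₂) ⊗ₜ ⁅x, y⁆ := rfl

theorem laurent_finite {W : Type*} [AddCommGroup W] [Module ℂ W]
    {A : Affine →ₗ[ℂ] Module.End ℂ W} (hA : FinitenessProperty A)
    {n : ℕ} (z : Fin n → ℂ) (j : Option (Fin n)) (u : RatFunc ℂ) (x : Sl2) (w : W) :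
    (Function.support fun s : ℤ => laurentCoeff z j s u • A (mode s x) w).Finite := by
  obtain ⟨N, hN⟩ := hA w x
  obtain ⟨M, hM⟩ := laurentCoeff_bddBelow z j u
  refine (Set.finite_Ico M N).subset fun s hs => ⟨?_, ?_⟩
  · by_contra hlt
    exact hs (by simp only [hM s (not_le.1 hlt), zero_smul])
  · by_contra hge
    exact hs (by simp only [hN s (not_lt.1 hge), smul_zero])

/-- For a module with the finiteness property, the action of the Laurent expansion
`[x ⊗ u]^{(z_j)} = ∑ₛ uₛ xTˢ` of `u ⊗ x ∈ 𝔰𝔩₂(U)` at the point `z_j`. -/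
def laurentAct {W : Type*} [AddCommGroup W] [Module ℂ W]
    (A : Affine →ₗ[ℂ] Module.End ℂ W) (hA : FinitenessProperty A)
    {n : ℕ} (z : Fin n → ℂ) (j : Option (Fin n)) : Sl2U z →ₗ[ℂ] Module.End ℂ W :=
  TensorProduct.lift <| LinearMap.mk₂ ℂ
    (fun (u : Omega0 z) (x : Sl2) =>
      ({ toFun w := ∑ᶠ s : ℤ, laurentCoeff z j s u.1 • A (mode s x) w
         map_add' w w' := by
          simp only [map_add, smul_add]
          exact finsum_add_distrib (laurent_finite hA z j u.1 x w) (laurent_finite hA z j u.1 x w')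
         map_smul' r w := by
          simp only [map_smul, RingHom.id_apply]
          rw [smul_finsum' _ (laurent_finite hA z j u.1 x w)]
          exact finsum_congr fun s => smul_comm _ _ _ } : Module.End ℂ W))
    (fun u u' x => by
      ext w
      simp only [LinearMap.coe_mk, AddHom.coe_mk, LinearMap.add_apply, Subalgebra.coe_add, map_add,
        add_smul]
      exact finsum_add_distrib (laurent_finite hA z j u.1 x w) (laurent_finite hA z j u'.1 x w))
    (fun r u x => by
      ext w
      simp only [LinearMap.coe_mk, AddHom.coe_mk, LinearMap.smul_apply, Subalgebra.coe_smul,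
        map_smul]
      rw [smul_finsum' _ (laurent_finite hA z j u.1 x w)]
      exact finsum_congr fun s => smul_assoc _ _ _)
    (fun u x x' => by
      ext w
      simp only [LinearMap.coe_mk, AddHom.coe_mk, LinearMap.add_apply, map_add, smul_add]
      exact finsum_add_distrib (laurent_finite hA z j u.1 x w) (laurent_finite hA z j u.1 x' w))
    (fun r u x => by
      ext w
      simp only [LinearMap.coe_mk, AddHom.coe_mk, LinearMap.smul_apply, map_smul]
      rw [smul_finsum' _ (laurent_finite hA z j u.1 x w)]
      exact finsum_congr fun s => smul_comm _ _ _)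

theorem laurentAct_apply {W : Type*} [AddCommGroup W] [Module ℂ W]
    (A : Affine →ₗ[ℂ] Module.End ℂ W) (hA : FinitenessProperty A)
    {n : ℕ} (z : Fin n → ℂ) (j : Option (Fin n)) (u : Omega0 z) (x : Sl2) (w : W) :
    laurentAct A hA z j (u ⊗ₜ x) w = ∑ᶠ s : ℤ, laurentCoeff z j s u.1 • A (mode s x) w := rfl

/-- The numbers `m₁, …, mₙ` and `m_{n+1} = m₁ + ⋯ + mₙ - 2` (label `none`). -/
def weight {n : ℕ} (m : Fin n → ℂ) : Option (Fin n) → ℂ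
  | some i => m i
  | none => (∑ i, m i) - 2

/-- The structure of a module over the affine Lie algebra used at each of the `n + 1` points: the
contragradient action at `z₁, …, zₙ`, and its twist by the automorphism `π` at `∞`. -/
def pointAct {n : ℕ} (m : Fin n → ℂ) (k : ℂ) :
    (j : Option (Fin n)) → (Affine →ₗ[ℂ] Module.End ℂ (Contra (weight m j) k))
  | some i => contraAct (weight m (some i)) k
  | none => contraAct (weight m none) k ∘ₗ piAut

theorem pointAct_finiteness {n : ℕ} (m : Fin n → ℂ) (k : ℂ) (j : Option (Fin n)) :
    FinitenessProperty (pointAct m k j) := by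
  cases j with
  | some i => exact contra_finiteness _ k
  | none =>
    intro w x
    obtain ⟨N, hN⟩ := contra_finiteness (weight m none) k w (sl2Swap x)
    refine ⟨N, fun j hj => ?_⟩
    rw [pointAct, LinearMap.comp_apply, piAut_mode]
    exact hN j hj

/-- The tensor product `V₁^* ⊗ ⋯ ⊗ V_{n+1}^*`, where `V_j = V(m_j, k - m_j)`. -/
abbrev TensorV {n : ℕ} (m : Fin n → ℂ) (k : ℂ) : Type :=
  ⨂[ℂ] j : Option (Fin n), Contra (weight m j) k

/-- The action of `𝔰𝔩₂(U)` on `V₁^* ⊗ ⋯ ⊗ V_{n+1}^*`: the sum over the points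
`z₁, …, zₙ, z_{n+1} = ∞` of the actions of the Laurent expansions on the tensor factors. -/
def tensorAct {n : ℕ} (z m : Fin n → ℂ) (k : ℂ) : Sl2U z →ₗ[ℂ] Module.End ℂ (TensorV m k) :=
  ∑ j : Option (Fin n),
    (PiTensorProduct.mapMultilinear ℂ (fun j => Contra (weight m j) k)
      (fun j => Contra (weight m j) k)).toLinearMap (fun _ => LinearMap.id) j ∘ₗ
      laurentAct (pointAct m k j) (pointAct_finiteness m k j) z j

/-- The last differential `d = μ : C₁ = 𝔰𝔩₂(U) ⊗ W → C₀ = W`, `g ⊗ w ↦ g w`, of the standard chain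
complex of `𝔰𝔩₂(U)` with coefficients in `W = V₁^* ⊗ ⋯ ⊗ V_{n+1}^*`. -/
def chainD {n : ℕ} (z m : Fin n → ℂ) (k : ℂ) : Sl2U z ⊗[ℂ] TensorV m k →ₗ[ℂ] TensorV m k :=
  TensorProduct.lift (tensorAct z m k)

theorem tensorAct_tprod {n : ℕ} (z m : Fin n → ℂ) (k : ℂ) (g : Sl2U z)
    (w : (j : Option (Fin n)) → Contra (weight m j) k) :
    tensorAct z m k g (PiTensorProduct.tprod ℂ w) =
      ∑ j, PiTensorProduct.tprod ℂ (Function.update w j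
        (laurentAct (pointAct m k j) (pointAct_finiteness m k j) z j g (w j))) := by
  simp only [tensorAct, LinearMap.sum_apply, LinearMap.comp_apply]
  refine Finset.sum_congr rfl fun j _ => ?_
  change PiTensorProduct.map _ _ = _
  rw [PiTensorProduct.map_tprod]
  congr 1
  ext1 i
  by_cases hi : i = j
  · subst hi; simp
  · simp [hi]

/-! ### The map `η` -/

/-- The tensor `(v₁)^* ⊗ ⋯ ⊗ w ⊗ ⋯ ⊗ (v_{n+1})^*` with `w` at the place `j`. -/
def insertAt {n : ℕ} (m : Fin n → ℂ) (k : ℂ) (j : Option (Fin n)) (w : Contra (weight m j) k) :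
    TensorV m k :=
  PiTensorProduct.tprod ℂ (Function.update (fun i => dualVec (weight m i) k idxV) j w)

/-- The tensor `(v₁)^* ⊗ ⋯ ⊗ (v_{n+1})^*`. -/
def vacTensor {n : ℕ} (m : Fin n → ℂ) (k : ℂ) : TensorV m k :=
  PiTensorProduct.tprod ℂ fun i => dualVec (weight m i) k idxV

/-- The formulas for `η¹` on the forms `dt/(t - z_i)^a` and `t^(a-1) dt`, `a > 0`. -/
def EtaOneFormulas {n : ℕ} (z m : Fin n → ℂ) (k : ℂ) (η : Omega1 z →ₗ[ℂ] TensorV m k) : Prop :=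
  (∀ (i : Fin n) (a : ℕ), 0 < a →
    η (invT z i ^ a) =
      -((k + 2) • insertAt m k (some i) (dualVec (weight m (some i)) k (idxF (a - 1))))) ∧
  ∀ a : ℕ, 0 < a →
    η (coordT z ^ (a - 1)) = (k + 2) • insertAt m k none (dualVec (weight m none) k (idxE a))

/-- The formulas for `η⁰` on the functions `1/(t - z_i)^a`, `a > 0`, and `t^a`, `a ≥ 0`. -/
def EtaZeroFormulas {n : ℕ} (z m : Fin n → ℂ) (k : ℂ)
    (η : Omega0 z →ₗ[ℂ] Sl2U z ⊗[ℂ] TensorV m k) : Prop :=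
  (∀ (i : Fin n) (a : ℕ), 0 < a →
    η (invT z i ^ a) =
      ((invT z i ^ a) ⊗ₜ[ℂ] f) ⊗ₜ[ℂ] vacTensor m k -
      ∑ l ∈ Finset.Icc 1 a,
        (((invT z i ^ l) ⊗ₜ[ℂ] e) ⊗ₜ[ℂ] insertAt m k (some i)
            ((2 : ℂ) • ∑ p ∈ (Finset.HasAntidiagonal.antidiagonal (a - l)).filter (fun p => p.2 ≤ p.1),
              dualVec (weight m (some i)) k (idxFF p.1 p.2)) +
          ((invT z i ^ l) ⊗ₜ[ℂ] h) ⊗ₜ[ℂ] insertAt m k (some i)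
            (dualVec (weight m (some i)) k (idxF (a - l))))) ∧
  ∀ a : ℕ,
    η (coordT z ^ a) =
      ((coordT z ^ a) ⊗ₜ[ℂ] f) ⊗ₜ[ℂ] vacTensor m k -
      ∑ l ∈ Finset.range (a - 1),
        (((coordT z ^ l) ⊗ₜ[ℂ] e) ⊗ₜ[ℂ] insertAt m k none
            ((2 : ℂ) • ∑ p ∈ (Finset.HasAntidiagonal.antidiagonal (a - l)).filter (fun p => 1 ≤ p.2 ∧ p.2 ≤ p.1),
              dualVec (weight m none) k (idxEE p.1 p.2)) +
          ((coordT z ^ (l + 1)) ⊗ₜ[ℂ] h) ⊗ₜ[ℂ] insertAt m k none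
            (dualVec (weight m none) k (idxE (a - l - 1))))

end SlDeRham
end

/-!
The formulas prescribe `η⁰` and `η¹` on the functions `1/(t - z_p)ᵃ` and `tᵃ`, which form a basis
of `Ω⁰(U)` by the partial fraction decomposition (`partialFractionBasis`), so the maps exist and are
unique. The substance is the chain map property, a comparison of two explicit vectors, and it
depends on knowing how the affine algebra acts on the dual vectors `v^*`, `(f/Tᵃ v)^*`,
`((f/Tⁱ)(f/Tʲ) v)^*` and their analogues with `e`.

To get hold of these vectors without a Poincaré–Birkhoff–Witt theorem, note that a dual vector
`(w)^*` is unique because the vectors `pbwVec` span (`span_pbwVec`), and that it exists because it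
can be written down. The Verma module maps to any module `W` over the affine algebra by an
`𝔫₋`-equivariant map sending `v` to a prescribed vector (`exists_verma_map`; it is freely generated
by `v` over `𝔫₋`, which is seen by realizing the induced module on the enveloping algebra of `𝔫₋`).
Taking for `W` the level zero module `ℂ[X_i : i ∈ ℤ]`, on which `f/Tⁱ` is multiplication by `X_i`
and `h`, `e` act by differential operators of orders one and two without constant terms
(`polyTriple`), and `v ↦ 1`, the coefficient of `∏_{i ∈ s} X_i` is the vector dual to
`∏_{i ∈ s} (f/Tⁱ) v` (`exists_functionals_f`). Twisting by the automorphism that interchanges `f₁`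
and `f₂` gives the vectors dual to words in `e` (`exists_functionals_e`).

Two properties of these functionals suffice: composing one with `f/Tʲ` deletes the letter `j`, and
they have definite weights. A functional of weight `m - 2` is determined by its compositions with
the `f/Tʲ`, `j ≥ 0`, and comparing these yields the identity
`(f/Tᵃ) v^* - ∑_{l=1}^a (2 ∑ (e/Tˡ) ((f/Tⁱ)(f/Tʲ) v)^* + (h/Tˡ) (f/T^(a-l) v)^*)
= (m + aκ) (f/Tᵃ v)^*`, the inner sum being over `i + j = a - l`, `i ≥ j` (`pole_identity`). The
identity needed at `∞` is its twist. These are the local contributions of the pole to `d (η⁰ u)`. At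
every other point `u` is regular and acts on `v^*` through its value there, `f v^* = m (f v)^*`,
`h v^* = m v^*`, `e v^* = 0`, and together these terms reproduce the partial fraction decomposition
of `∂u`.

Injectivity is read off by pairing with vectors of the Verma modules: the coefficient of
`f ⊗ v^* ⊗ ⋯ ⊗ v^*` in `η⁰ u` is `u`, and the vectors `η¹` of the basis forms have, up to the factors
`∓κ ≠ 0`, a dual system.
-/

noncomputable section

namespace SlDeRham

/-! ### Modules induced from a complementary subalgebra -/

section Induced

attribute [local instance] LieRing.ofAssociativeRing

variable {L : Type*} [LieRing L] [LieAlgebra ℂ L] (A : LieSubalgebra ℂ L) (P : L →ₗ[ℂ] A)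

/-- The component of `x` in the kernel of the projection `P` onto the subalgebra `A`. -/
def complPart : L →ₗ[ℂ] L := LinearMap.id - A.toSubmodule.subtype ∘ₗ P

theorem complPart_apply (x : L) : complPart A P x = x - P x := rfl

/-- The operator `x ↦ [x, a]`. -/
def rightBracket (a : L) : L →ₗ[ℂ] L where
  toFun x := ⁅x, a⁆
  map_add' x y := add_lie x y a
  map_smul' r x := smul_lie r x a

/-- The operator by which `a ∈ A` acts on pairs `(u, ψ)`, where `u ∈ U(A)` and `ψ x` stands for
the value of the still unknown operator of `x ∈ L` at `u`: the pair is sent to `a u` and the value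
at `a u` that is dictated by `x a = a x + [x, a]`. -/
def pairOp (a : A) : Module.End ℂ (UniversalEnvelopingAlgebra ℂ A ×
    (L →ₗ[ℂ] UniversalEnvelopingAlgebra ℂ A)) where
  toFun p := (UniversalEnvelopingAlgebra.ι ℂ a * p.1,
    LinearMap.mulLeft ℂ (UniversalEnvelopingAlgebra.ι ℂ a) ∘ₗ p.2 +
    LinearMap.mulRight ℂ p.1 ∘ₗ (UniversalEnvelopingAlgebra.ι ℂ : A →ₗ⁅ℂ⁆ _).toLinearMap ∘ₗ P ∘ₗ
      rightBracket (a : L) +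
    p.2 ∘ₗ complPart A P ∘ₗ rightBracket (a : L))
  map_add' p q := by
    refine Prod.ext (mul_add _ _ _) (LinearMap.ext fun x => ?_)
    simp [mul_add]
    abel
  map_smul' r p := by
    refine Prod.ext (by simp) (LinearMap.ext fun x => ?_)
    simp

theorem pairOp_fst (a : A) (p) : (pairOp A P a p).1 = UniversalEnvelopingAlgebra.ι ℂ a * p.1 := rfl

theorem pairOp_snd (a : A) (p) (x : L) : (pairOp A P a p).2 x =
    UniversalEnvelopingAlgebra.ι ℂ a * p.2 x + UniversalEnvelopingAlgebra.ι ℂ (P ⁅x, (a : L)⁆) * p.1 +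
      p.2 (complPart A P ⁅x, (a : L)⁆) := rfl

theorem ι_lie (a b : A) : UniversalEnvelopingAlgebra.ι ℂ ⁅a, b⁆ =
    UniversalEnvelopingAlgebra.ι ℂ a * UniversalEnvelopingAlgebra.ι ℂ b -
      UniversalEnvelopingAlgebra.ι ℂ b * UniversalEnvelopingAlgebra.ι ℂ a :=
  (UniversalEnvelopingAlgebra.ι ℂ : A →ₗ⁅ℂ⁆ _).map_lie a b

variable {A P}

/-- The pair operators represent `A`; this is the Jacobi identity for `x ∈ L` and `a, b ∈ A`. -/
theorem pairOp_lie (hP : ∀ a : A, P a = a) (a b : A) :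
    pairOp A P ⁅a, b⁆ = pairOp A P a * pairOp A P b - pairOp A P b * pairOp A P a := by
  have hPl : ∀ c d : A, P ⁅(c : L), (d : L)⁆ = ⁅c, d⁆ := fun c d => by
    rw [← LieSubalgebra.coe_bracket, hP]
  have hQ : ∀ c : A, complPart A P (c : L) = 0 := fun c => by rw [complPart_apply, hP, sub_self]
  have hQl : ∀ c d : A, complPart A P ⁅(c : L), (d : L)⁆ = 0 := fun c d => by
    rw [← LieSubalgebra.coe_bracket, hQ]
  refine LinearMap.ext fun p => Prod.ext ?_ (LinearMap.ext fun x => ?_)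
  · simp only [LinearMap.sub_apply, Module.End.mul_apply, Prod.fst_sub, pairOp_fst, ι_lie, sub_mul,
      mul_assoc]
  · have split : ∀ y : L, y = (P y : L) + complPart A P y := fun y => by
      rw [complPart_apply]; abel
    have hj : ⁅x, ((⁅a, b⁆ : A) : L)⁆ = ⁅(P ⁅x, (a : L)⁆ : L), (b : L)⁆ - ⁅(P ⁅x, (b : L)⁆ : L), (a : L)⁆ +
        (⁅complPart A P ⁅x, (a : L)⁆, (b : L)⁆ - ⁅complPart A P ⁅x, (b : L)⁆, (a : L)⁆) := by
      rw [LieSubalgebra.coe_bracket, leibniz_lie, ← lie_skew (a : L) ⁅x, (b : L)⁆]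
      conv_lhs => rw [split ⁅x, (a : L)⁆, split ⁅x, (b : L)⁆, add_lie, add_lie]
      abel
    simp only [LinearMap.sub_apply, Module.End.mul_apply, Prod.snd_sub, pairOp_fst, pairOp_snd, hj,
      map_sub, map_add, hPl, hQl, ι_lie, sub_zero, zero_add]
    noncomm_ring

variable (A P) in
/-- The representation of `A` by the operators `pairOp`. -/
def pairRep (hP : ∀ a : A, P a = a) : A →ₗ⁅ℂ⁆ Module.End ℂ (UniversalEnvelopingAlgebra ℂ A ×
    (L →ₗ[ℂ] UniversalEnvelopingAlgebra ℂ A)) where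
  toFun := pairOp A P
  map_add' a b := by
    refine LinearMap.ext fun p => Prod.ext ?_ (LinearMap.ext fun x => ?_)
    · simp only [LinearMap.add_apply, Prod.fst_add, pairOp_fst, map_add, add_mul]
    · simp only [LinearMap.add_apply, Prod.snd_add, pairOp_snd, map_add, add_mul,
        show ((a + b : A) : L) = a + b from rfl, lie_add]
      abel
  map_smul' r a := by
    refine LinearMap.ext fun p => Prod.ext ?_ (LinearMap.ext fun x => ?_)
    · simp only [LinearMap.smul_apply, Prod.smul_fst, pairOp_fst, map_smul, smul_mul_assoc,
        RingHom.id_apply]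
    · simp only [LinearMap.smul_apply, Prod.smul_snd, pairOp_snd, map_smul, smul_mul_assoc,
        RingHom.id_apply, show ((r • a : A) : L) = r • (a : L) from rfl, lie_smul, smul_add]
  map_lie' {a b} := pairOp_lie hP a b

variable (A P) in
/-- The pair of `u` and the linear map sending `x ∈ L` to the value at `u` of its operator (used
for `x` in the complement of `A` only).  At `u = 1` this map is the character `χ`. -/
def inducedPair (hP : ∀ a : A, P a = a) (χ : L →ₗ[ℂ] ℂ) (u : UniversalEnvelopingAlgebra ℂ A) :
    UniversalEnvelopingAlgebra ℂ A × (L →ₗ[ℂ] UniversalEnvelopingAlgebra ℂ A) :=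
  UniversalEnvelopingAlgebra.lift ℂ (pairRep A P hP) u (1, (Algebra.linearMap ℂ _) ∘ₗ χ)

theorem inducedPair_mul (hP : ∀ a : A, P a = a) (χ : L →ₗ[ℂ] ℂ) (a : A)
    (u : UniversalEnvelopingAlgebra ℂ A) :
    inducedPair A P hP χ (UniversalEnvelopingAlgebra.ι ℂ a * u) =
      pairOp A P a (inducedPair A P hP χ u) := by
  rw [inducedPair, map_mul, UniversalEnvelopingAlgebra.lift_ι_apply]
  rfl

/-- Induction on elements of an enveloping algebra, multiplying from the left. -/
theorem enveloping_induction {p : UniversalEnvelopingAlgebra ℂ A → Prop}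
    (u : UniversalEnvelopingAlgebra ℂ A) (h1 : p 1) (hadd : ∀ u v, p u → p v → p (u + v))
    (hsmul : ∀ (r : ℂ) u, p u → p (r • u))
    (hmul : ∀ a u, p u → p (UniversalEnvelopingAlgebra.ι ℂ a * u)) : p u := by
  let S : Submodule ℂ (UniversalEnvelopingAlgebra ℂ A) :=
    { carrier := {u | p u}
      add_mem' := fun {u v} => hadd u v
      zero_mem' := by simpa using hsmul 0 _ h1
      smul_mem' := hsmul }
  let T : Subalgebra ℂ (UniversalEnvelopingAlgebra ℂ A) :=
    { carrier := {u | ∀ v ∈ S, u * v ∈ S}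
      mul_mem' := fun {a b} ha hb v hv => by rw [mul_assoc]; exact ha _ (hb _ hv)
      add_mem' := fun {a b} ha hb v hv => by rw [add_mul]; exact S.add_mem (ha _ hv) (hb _ hv)
      algebraMap_mem' := fun r v hv => by
        rw [← Algebra.smul_def]; exact S.smul_mem _ hv }
  let g : A →ₗ⁅ℂ⁆ T :=
    { toFun x := ⟨UniversalEnvelopingAlgebra.ι ℂ x, hmul x⟩
      map_add' x y := Subtype.ext (map_add _ x y)
      map_smul' r x := Subtype.ext (map_smul _ r x)
      map_lie' {x y} := Subtype.ext (ι_lie A x y) }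
  have h2 : T.val.comp (UniversalEnvelopingAlgebra.lift ℂ g) = AlgHom.id ℂ _ := by
    apply UniversalEnvelopingAlgebra.hom_ext
    ext x
    have := UniversalEnvelopingAlgebra.lift_ι_apply ℂ g x
    simp only [LieHom.comp_apply, AlgHom.toLieHom_apply, AlgHom.comp_apply, this]
    rfl
  have h3 := DFunLike.congr_fun h2 u
  rw [AlgHom.id_apply] at h3
  have h4 := (UniversalEnvelopingAlgebra.lift ℂ g u).2 1 h1
  rw [mul_one] at h4
  rw [← h3]
  exact h4

theorem inducedPair_fst (hP : ∀ a : A, P a = a) (χ : L →ₗ[ℂ] ℂ) (u : UniversalEnvelopingAlgebra ℂ A) :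
    (inducedPair A P hP χ u).1 = u := by
  induction u using enveloping_induction with
  | h1 => simp [inducedPair]
  | hadd u v hu hv =>
    rw [inducedPair, map_add, LinearMap.add_apply, Prod.fst_add]; exact congrArg₂ _ hu hv
  | hsmul r u hu => rw [inducedPair, map_smul, LinearMap.smul_apply, Prod.smul_fst]; exact congrArg _ hu
  | hmul a u hu => rw [inducedPair_mul, pairOp_fst, hu]

variable (A P) in
/-- The operator of `x` on `U(A)`, the space of the `L`-module induced from the character `χ` of
the complement of `A`. -/
def inducedOp (hP : ∀ a : A, P a = a) (χ : L →ₗ[ℂ] ℂ) (x : L) :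
    Module.End ℂ (UniversalEnvelopingAlgebra ℂ A) where
  toFun u := UniversalEnvelopingAlgebra.ι ℂ (P x) * u + (inducedPair A P hP χ u).2 (complPart A P x)
  map_add' u v := by
    simp only [inducedPair, map_add, LinearMap.add_apply, Prod.snd_add, mul_add]; abel
  map_smul' r u := by
    simp [inducedPair, map_smul]

theorem inducedOp_apply (hP : ∀ a : A, P a = a) (χ : L →ₗ[ℂ] ℂ) (x : L)
    (u : UniversalEnvelopingAlgebra ℂ A) : inducedOp A P hP χ x u =
      UniversalEnvelopingAlgebra.ι ℂ (P x) * u + (inducedPair A P hP χ u).2 (complPart A P x) := rfl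

theorem inducedOp_sub (hP : ∀ a : A, P a = a) (χ : L →ₗ[ℂ] ℂ) (a : A) :
    inducedOp A P hP χ a = LinearMap.mulLeft ℂ (UniversalEnvelopingAlgebra.ι ℂ a) := by
  ext u
  rw [inducedOp_apply, hP, complPart_apply, hP, sub_self, map_zero, add_zero]
  rfl

theorem inducedOp_one (hP : ∀ a : A, P a = a) (χ : L →ₗ[ℂ] ℂ) {x : L} (hx : P x = 0) :
    inducedOp A P hP χ x 1 = χ x • 1 := by
  rw [inducedOp_apply, hx, complPart_apply, hx]
  simp [inducedPair, Algebra.smul_def]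

theorem inducedOp_add (hP : ∀ a : A, P a = a) (χ : L →ₗ[ℂ] ℂ) (x y : L) :
    inducedOp A P hP χ (x + y) = inducedOp A P hP χ x + inducedOp A P hP χ y := by
  ext u
  simp only [inducedOp_apply, LinearMap.add_apply, map_add, add_mul]
  abel

theorem inducedOp_smul (hP : ∀ a : A, P a = a) (χ : L →ₗ[ℂ] ℂ) (r : ℂ) (x : L) :
    inducedOp A P hP χ (r • x) = r • inducedOp A P hP χ x := by
  ext u
  simp only [inducedOp_apply, LinearMap.smul_apply, map_smul, smul_mul_assoc, smul_add]

/-- Moving an element of `A` past the operator of an arbitrary element. -/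
theorem inducedOp_mul (hP : ∀ a : A, P a = a) (χ : L →ₗ[ℂ] ℂ) (x : L) (a : A)
    (u : UniversalEnvelopingAlgebra ℂ A) :
    inducedOp A P hP χ x (UniversalEnvelopingAlgebra.ι ℂ a * u) =
      UniversalEnvelopingAlgebra.ι ℂ a * inducedOp A P hP χ x u + inducedOp A P hP χ ⁅x, (a : L)⁆ u := by
  have h1 : ⁅x, (a : L)⁆ = ((⁅P x, a⁆ : A) : L) + ⁅complPart A P x, (a : L)⁆ := by
    rw [complPart_apply, LieSubalgebra.coe_bracket, sub_lie]; abel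
  rw [h1, inducedOp_add, LinearMap.add_apply, inducedOp_sub, inducedOp_apply, inducedPair_mul,
    pairOp_snd, inducedPair_fst, inducedOp_apply, inducedOp_apply, LinearMap.mulLeft_apply, ι_lie]
  noncomm_ring

/-- The operators `inducedOp` represent `L` if the kernel of `P` is a subalgebra on which `χ` is a
character.  Relations with an element of `A` hold by construction; those between two elements of
the kernel hold at `1`, and are carried to `a u` by the Jacobi identity. -/
theorem inducedOp_lie (hP : ∀ a : A, P a = a) (χ : L →ₗ[ℂ] ℂ)
    (hB : ∀ x y, P x = 0 → P y = 0 → P ⁅x, y⁆ = 0)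
    (hχ : ∀ x y, P x = 0 → P y = 0 → χ ⁅x, y⁆ = 0) (x y : L) :
    inducedOp A P hP χ ⁅x, y⁆ = inducedOp A P hP χ x * inducedOp A P hP χ y -
      inducedOp A P hP χ y * inducedOp A P hP χ x := by
  have key : ∀ (x : L) (a : A), inducedOp A P hP χ ⁅x, (a : L)⁆ =
      inducedOp A P hP χ x * inducedOp A P hP χ a - inducedOp A P hP χ a * inducedOp A P hP χ x := by
    intro x a
    ext u
    simp only [LinearMap.sub_apply, Module.End.mul_apply, inducedOp_sub, LinearMap.mulLeft_apply,
      inducedOp_mul]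
    abel
  -- both elements in the kernel of `P`: induction on `u`
  have key2 : ∀ x y : L, P x = 0 → P y = 0 → inducedOp A P hP χ ⁅x, y⁆ =
      inducedOp A P hP χ x * inducedOp A P hP χ y - inducedOp A P hP χ y * inducedOp A P hP χ x := by
    intro x y hx hy
    ext u
    simp only [LinearMap.sub_apply, Module.End.mul_apply]
    induction u using enveloping_induction generalizing x y with
    | h1 =>
      rw [inducedOp_one hP χ (hB x y hx hy), inducedOp_one hP χ hx, inducedOp_one hP χ hy,
        hχ x y hx hy, map_smul, map_smul, inducedOp_one hP χ hx, inducedOp_one hP χ hy, smul_smul,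
        smul_smul, mul_comm, sub_self, zero_smul]
    | hadd u v hu hv =>
      simp only [map_add, hu x y hx hy, hv x y hx hy]; abel
    | hsmul r u hu => simp only [map_smul, hu x y hx hy, smul_sub]
    | hmul a u hu =>
      have split : ∀ z : L, z = (P z : L) + complPart A P z := fun z => by
        rw [complPart_apply]; abel
      have hq : ∀ z : L, P (complPart A P z) = 0 := fun z => by
        rw [complPart_apply, map_sub, hP, sub_self]
      -- the relation for one element of the complement and an arbitrary one, at `u`
      have gen : ∀ x z : L, P x = 0 → inducedOp A P hP χ ⁅x, z⁆ u =
          inducedOp A P hP χ x (inducedOp A P hP χ z u) -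
            inducedOp A P hP χ z (inducedOp A P hP χ x u) := by
        intro x z hx
        conv_lhs => rw [split z, lie_add, inducedOp_add, LinearMap.add_apply, key, hu x _ hx (hq z)]
        conv_rhs => rw [split z, inducedOp_add]
        simp only [LinearMap.sub_apply, Module.End.mul_apply, LinearMap.add_apply, map_add]
        abel
      have hj : ⁅⁅x, y⁆, (a : L)⁆ = ⁅x, ⁅y, (a : L)⁆⁆ - ⁅y, ⁅x, (a : L)⁆⁆ := lie_lie x y _
      simp only [inducedOp_mul, map_add, hu x y hx hy, hj, sub_eq_add_neg, inducedOp_add]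
      rw [← neg_one_smul ℂ ⁅y, ⁅x, (a : L)⁆⁆, inducedOp_smul, LinearMap.add_apply,
        LinearMap.smul_apply, gen x ⁅y, (a : L)⁆ hx, gen y ⁅x, (a : L)⁆ hy]
      simp only [neg_one_smul, mul_add, mul_neg]
      abel
  have split : ∀ z : L, z = (P z : L) + complPart A P z := fun z => by
    rw [complPart_apply]; abel
  have hq : ∀ z : L, P (complPart A P z) = 0 := fun z => by
    rw [complPart_apply, map_sub, hP, sub_self]
  have gen : ∀ x z : L, P x = 0 → inducedOp A P hP χ ⁅x, z⁆ =
      inducedOp A P hP χ x * inducedOp A P hP χ z - inducedOp A P hP χ z * inducedOp A P hP χ x := by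
    intro x z hx
    conv_lhs => rw [split z, lie_add, inducedOp_add, key, key2 x _ hx (hq z)]
    conv_rhs => rw [split z, inducedOp_add]
    noncomm_ring
  have neg : ∀ z : L, inducedOp A P hP χ (-z) = -inducedOp A P hP χ z := fun z => by
    rw [← neg_one_smul ℂ, inducedOp_smul, neg_one_smul]
  have h1 : ⁅x, y⁆ = -⁅y, (P x : L)⁆ + ⁅complPart A P x, y⁆ := by
    rw [lie_skew, ← add_lie, ← split]
  rw [h1, inducedOp_add, neg, key, gen _ y (hq x)]
  conv_rhs => rw [split x, inducedOp_add]
  noncomm_ring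

end Induced

/-! ### Linear maps out of the affine Lie algebra -/

section AffineLift

variable {W : Type*} [AddCommGroup W] [Module ℂ W]

/-- The linear map on the affine Lie algebra with values `g s x` at `x T ^ s` and `w` at `c`. -/
def affineLift (g : ℤ → Sl2 →ₗ[ℂ] W) (w : W) : Affine →ₗ[ℂ] W :=
  LinearMap.coprod (Finsupp.lsum ℂ g ∘ₗ (LieAlgebra.LoopAlgebra.toFinsupp ℂ ℤ Sl2).toLinearMap)
    (LinearMap.toSpanSingleton ℂ W w) ∘ₗ affineEquiv.symm.toLinearMap

theorem affineLift_mode (g : ℤ → Sl2 →ₗ[ℂ] W) (w : W) (s : ℤ) (x : Sl2) :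
    affineLift g w (mode s x) = g s x := by
  simp only [affineLift, mode, LinearMap.comp_apply, LinearEquiv.coe_coe,
    LinearEquiv.symm_apply_apply, LinearMap.inl_apply, LinearMap.coprod_apply,
    TensorProduct.mk_apply, LieAlgebra.LoopAlgebra.toFinsupp_single_tmul, map_zero, add_zero,
    Finsupp.lsum_single]

theorem affineLift_central (g : ℤ → Sl2 →ₗ[ℂ] W) (w : W) : affineLift g w central = w := by
  simp [affineLift, central]

/-- The linear map on `𝔰𝔩₂` with prescribed values at `e`, `f` and `h`. -/
def sl2Lift (a b c : W) : Sl2 →ₗ[ℂ] W where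
  toFun x := x.1 0 1 • a + x.1 1 0 • b + x.1 0 0 • c
  map_add' x y := by simp [add_smul]; abel
  map_smul' r x := by simp [mul_smul]

theorem sl2Lift_e (a b c : W) : sl2Lift a b c e = a := by simp [sl2Lift, e]
theorem sl2Lift_f (a b c : W) : sl2Lift a b c f = b := by simp [sl2Lift, f]
theorem sl2Lift_h (a b c : W) : sl2Lift a b c h = c := by simp [sl2Lift, h]

end AffineLift

theorem affine_basis_induction {p : Affine → Prop} (x : Affine) (hc : p central)
    (he : ∀ s, p (mode s e)) (hf : ∀ s, p (mode s f)) (hh : ∀ s, p (mode s h))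
    (hadd : ∀ x y, p x → p y → p (x + y)) (hs : ∀ (r : ℂ) x, p x → p (r • x)) : p x := by
  induction x using affine_induction with
  | hc => exact hc
  | hadd x y hx hy => exact hadd x y hx hy
  | hs r x hx => exact hs r x hx
  | hm s a =>
    rw [sl2_span a, map_add, map_add, map_smul, map_smul, map_smul]
    exact hadd _ _ (hadd _ _ (hs _ _ (he s)) (hs _ _ (hf s))) (hs _ _ (hh s))

theorem lie_central (x : Affine) : ⁅x, central⁆ = 0 := by
  rw [← lie_skew, central_lie, neg_zero]

theorem lie_eh : ⁅e, h⁆ = (-2 : ℂ) • e := by rw [← lie_skew, lie_he]; simp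

section Brackets

variable (s t : ℤ)

theorem mode_e_e : ⁅mode s e, mode t e⁆ = 0 := by
  simp [mode_lie, e, Matrix.trace_fin_two]
theorem mode_f_f : ⁅mode s f, mode t f⁆ = 0 := by
  simp [mode_lie, f, Matrix.trace_fin_two]
theorem mode_e_f : ⁅mode s e, mode t f⁆ =
    mode (s + t) h + (if s + t = 0 then (s : ℂ) else 0) • central := by
  rw [mode_lie, lie_ef]; simp [e, f, Matrix.trace_fin_two]
theorem mode_f_e : ⁅mode s f, mode t e⁆ =
    -mode (s + t) h + (if s + t = 0 then (s : ℂ) else 0) • central := by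
  rw [mode_lie, lie_fe]; simp [e, f, Matrix.trace_fin_two]
theorem mode_h_h : ⁅mode s h, mode t h⁆ = (if s + t = 0 then 2 * (s : ℂ) else 0) • central := by
  rw [mode_lie, lie_self]; simp [h, Matrix.trace_fin_two, ← two_mul, mul_comm]
theorem mode_h_e : ⁅mode s h, mode t e⁆ = (2 : ℂ) • mode (s + t) e := by
  have h0 : Matrix.trace (h.1 * e.1) = 0 := by simp [h, e, Matrix.trace_fin_two]
  rw [mode_lie, lie_he, map_smul]; simp [h0]
theorem mode_h_f : ⁅mode s h, mode t f⁆ = (-2 : ℂ) • mode (s + t) f := by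
  have h0 : Matrix.trace (h.1 * f.1) = 0 := by simp [h, f, Matrix.trace_fin_two]
  rw [mode_lie, lie_hf, map_smul]; simp [h0]
theorem mode_e_h : ⁅mode s e, mode t h⁆ = (-2 : ℂ) • mode (s + t) e := by
  have h0 : Matrix.trace (e.1 * h.1) = 0 := by simp [h, e, Matrix.trace_fin_two]
  rw [mode_lie, lie_eh, map_smul]; simp [h0]
theorem mode_f_h : ⁅mode s f, mode t h⁆ = (2 : ℂ) • mode (s + t) f := by
  have h0 : Matrix.trace (f.1 * h.1) = 0 := by simp [h, f, Matrix.trace_fin_two]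
  rw [mode_lie, lie_fh, map_smul]; simp [h0]

end Brackets

/-! ### The triangular decomposition and maps out of Verma modules -/

/-- The projection of the affine Lie algebra onto the span `𝔫₋` of `eTˢ`, `hTˢ` for `s < 0` and
`fTˢ` for `s ≤ 0`, along the span of the remaining modes and `c`. -/
def negProj : Affine →ₗ[ℂ] Affine :=
  affineLift (fun s => sl2Lift (if s < 0 then mode s e else 0) (if s ≤ 0 then mode s f else 0)
    (if s < 0 then mode s h else 0)) 0

theorem negProj_central : negProj central = 0 := affineLift_central _ _
theorem negProj_e (s : ℤ) : negProj (mode s e) = if s < 0 then mode s e else 0 := by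
  rw [negProj, affineLift_mode, sl2Lift_e]
theorem negProj_f (s : ℤ) : negProj (mode s f) = if s ≤ 0 then mode s f else 0 := by
  rw [negProj, affineLift_mode, sl2Lift_f]
theorem negProj_h (s : ℤ) : negProj (mode s h) = if s < 0 then mode s h else 0 := by
  rw [negProj, affineLift_mode, sl2Lift_h]

theorem negProj_negProj (x : Affine) : negProj (negProj x) = negProj x := by
  induction x using affine_basis_induction with
  | hc => simp [negProj_central]
  | he s => rw [negProj_e]; split_ifs with hs <;> simp [negProj_e, hs]
  | hf s => rw [negProj_f]; split_ifs with hs <;> simp [negProj_f, hs]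
  | hh s => rw [negProj_h]; split_ifs with hs <;> simp [negProj_h, hs]
  | hadd x y hx hy => simp only [map_add, hx, hy]
  | hs r x hx => simp only [map_smul, hx]

theorem negProj_lie_neg (x y : Affine) :
    negProj ⁅negProj x, negProj y⁆ = ⁅negProj x, negProj y⁆ := by
  induction x using affine_basis_induction with
  | hadd x x' hx hx' => simp only [map_add, add_lie, hx, hx']
  | hs r x hx => simp only [map_smul, smul_lie, hx]
  | hc => simp [negProj_central]
  | he s | hf s | hh s =>
    induction y using affine_basis_induction with
    | hadd x x' hx hx' => simp only [map_add, lie_add, hx, hx']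
    | hs r x hx => simp only [map_smul, lie_smul, hx]
    | hc => simp [negProj_central]
    | he t | hf t | hh t =>
      simp only [negProj_e, negProj_f, negProj_h]
      split_ifs with hs ht <;> try simp only [lie_zero, zero_lie, map_zero]
      first
        | have h0 : ¬ (s + t = 0) := by lia
          have h1 : s + t < 0 := by lia
          have h2 : s + t ≤ 0 := by lia
          simp [mode_e_e, mode_e_f, mode_e_h, mode_f_e, mode_f_h, mode_h_e, mode_h_f,
            mode_h_h, h0, h1, h2, negProj_e, negProj_f, negProj_h]
        | simp [mode_f_f]

/-- The nilpotent subalgebra `𝔫₋`, generated by `f₁` and `f₂`. -/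
def nMinus : LieSubalgebra ℂ Affine where
  __ := LinearMap.ker (negProj - LinearMap.id)
  lie_mem' {x y} hx hy := by
    have hx' : negProj x = x := sub_eq_zero.1 hx
    have hy' : negProj y = y := sub_eq_zero.1 hy
    have := negProj_lie_neg x y
    rw [hx', hy'] at this
    exact sub_eq_zero.2 this

theorem mem_nMinus {x : Affine} : x ∈ nMinus ↔ negProj x = x := sub_eq_zero (a := negProj x)

/-- The projection `negProj` with values in the subalgebra `𝔫₋`. -/
def nMinusProj : Affine →ₗ[ℂ] nMinus :=
  negProj.codRestrict nMinus.toSubmodule fun x => mem_nMinus.2 (negProj_negProj x)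

theorem nMinusProj_coe (x : Affine) : (nMinusProj x : Affine) = negProj x := rfl

theorem nMinusProj_apply (a : nMinus) : nMinusProj a = a := Subtype.ext (mem_nMinus.1 a.2)

theorem nMinusProj_eq_zero {x : Affine} : nMinusProj x = 0 ↔ negProj x = 0 := by
  rw [← nMinusProj_coe, ZeroMemClass.coe_eq_zero]

/-- The character of the Borel subalgebra by which it acts on the generating vector of
`V(m, k - m)`, extended by zero to `𝔫₋`. -/
def highestWeight (m k : ℂ) : Affine →ₗ[ℂ] ℂ :=
  affineLift (fun s => sl2Lift 0 0 (if s = 0 then m else 0)) k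

/-- The Borel subalgebra is closed under the bracket, and its derived algebra is killed by the
highest weight. -/
theorem borel_lie (m k : ℂ) (x y : Affine) : negProj ⁅x - negProj x, y - negProj y⁆ = 0 ∧
    highestWeight m k ⁅x - negProj x, y - negProj y⁆ = 0 := by
  induction x using affine_basis_induction with
  | hadd x x' hx hx' => simp only [map_add, add_sub_add_comm, add_lie, hx, hx', add_zero, and_self]
  | hs r x hx => simp only [map_smul, ← smul_sub, smul_lie, hx, smul_zero, and_self]
  | hc => simp [negProj_central, central_lie]
  | he s | hf s | hh s =>
    induction y using affine_basis_induction with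
    | hadd x x' hx hx' =>
      simp only [map_add, add_sub_add_comm, lie_add, hx, hx', add_zero, and_self]
    | hs r x hx => simp only [map_smul, ← smul_sub, lie_smul, hx, smul_zero, and_self]
    | hc => simp [negProj_central, lie_central]
    | he t | hf t | hh t =>
      simp only [negProj_e, negProj_f, negProj_h]
      split_ifs with hs ht <;> simp only [sub_self, sub_zero, lie_zero, zero_lie, map_zero, and_self]
      simp only [mode_e_e, mode_e_f, mode_e_h, mode_f_e, mode_f_f, mode_f_h, mode_h_e, mode_h_f,
        mode_h_h, map_add, map_neg, map_smul, map_zero, negProj_e, negProj_f, negProj_h,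
        negProj_central, highestWeight, affineLift_mode, affineLift_central, sl2Lift_e, sl2Lift_f,
        sl2Lift_h, and_self]
      try
        have h1 : ¬ (s + t < 0) := by lia
        simp only [h1, if_false, smul_zero, neg_zero, add_zero, true_and, and_self]
      try
        have h2 : ¬ (s + t ≤ 0) := by lia
        simp [h2]
      try
        have h3 : ¬ (s + t = 0) := by lia
        simp [h3]
      try
        split_ifs with h4
        · have h5 : s = 0 := by lia
          simp [h5]
        · simp

/-- A linear map `V(m, k - m) → W` commuting with `𝔫₋` may send the generating vector anywhere:
the Verma module is free over `U(𝔫₋)`. -/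
theorem exists_verma_map (m k : ℂ) {W : Type*} [AddCommGroup W] [Module ℂ W]
    (ρ : Affine →ₗ[ℂ] Module.End ℂ W) (hρ : ∀ x y, ρ ⁅x, y⁆ = ρ x * ρ y - ρ y * ρ x) (w₀ : W) :
    ∃ Θ : Verma m k →ₗ[ℂ] W, Θ (vac m k) = w₀ ∧
      ∀ x, negProj x = x → ∀ w, Θ (vermaAct m k x w) = ρ x (Θ w) := by
  let _ := LieRing.ofAssociativeRing (A := Module.End ℂ W)
  let _ := LieRing.ofAssociativeRing (A := Module.End ℂ (UniversalEnvelopingAlgebra ℂ nMinus))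
  have proj0 : ∀ x, nMinusProj x = 0 → x = x - negProj x := fun x hx => by
    rw [nMinusProj_eq_zero.1 hx, sub_zero]
  let op : Affine →ₗ⁅ℂ⁆ Module.End ℂ (UniversalEnvelopingAlgebra ℂ nMinus) :=
    { toFun := inducedOp nMinus nMinusProj nMinusProj_apply (highestWeight m k)
      map_add' := inducedOp_add _ _
      map_smul' := inducedOp_smul _ _
      map_lie' {x y} := inducedOp_lie _ _
        (fun x y hx hy => by
          rw [nMinusProj_eq_zero, proj0 x hx, proj0 y hy]
          exact (borel_lie m k x y).1)
        (fun x y hx hy => by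
          rw [proj0 x hx, proj0 y hy]
          exact (borel_lie m k x y).2) x y }
  let res : nMinus →ₗ⁅ℂ⁆ Module.End ℂ W :=
    { toFun a := ρ a
      map_add' a b := map_add ρ _ _
      map_smul' r a := map_smul ρ _ _
      map_lie' {a b} := hρ a b }
  let Φ := UniversalEnvelopingAlgebra.lift ℂ op
  have hΦ : ∀ x, Φ (toU x) = inducedOp nMinus nMinusProj nMinusProj_apply (highestWeight m k) x :=
    UniversalEnvelopingAlgebra.lift_ι_apply ℂ op
  let T : UAffine →ₗ[ℂ] UniversalEnvelopingAlgebra ℂ nMinus := (LinearMap.applyₗ 1) ∘ₗ Φ.toLinearMap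
  have hT : ∀ u, T u = Φ u 1 := fun _ => rfl
  have one : ∀ x, negProj x = 0 → T (toU x) = highestWeight m k x • 1 := fun x hx => by
    rw [hT, hΦ, inducedOp_one _ _ (nMinusProj_eq_zero.2 hx)]
  have ker : (vermaIdeal m k).restrictScalars ℂ ≤ LinearMap.ker T := by
    intro u hu
    rw [Submodule.restrictScalars_mem, vermaIdeal] at hu
    rw [LinearMap.mem_ker]
    induction hu using Submodule.span_induction with
    | zero => exact map_zero T
    | add u v _ _ hu hv => rw [map_add, hu, hv, add_zero]
    | smul a u _ hu => rw [hT] at hu; rw [hT, smul_eq_mul, map_mul, Module.End.mul_apply, hu, map_zero]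
    | mem u hu =>
      have alg : ∀ r : ℂ, T (algebraMap ℂ UAffine r) = r • 1 := fun r => by
        rw [hT, AlgHom.commutes]; rfl
      simp only [Set.mem_insert_iff, Set.mem_singleton_iff] at hu
      rcases hu with rfl | rfl | rfl | rfl
      · rw [one _ (by simp [chevE, negProj_e])]
        simp [chevE, highestWeight, affineLift_mode, sl2Lift_e]
      · rw [one _ (by simp [chevE, negProj_f])]
        simp [chevE, highestWeight, affineLift_mode, sl2Lift_f]
      · rw [map_sub, alg, one _ (by simp [chevH, negProj_h])]
        simp [chevH, highestWeight, affineLift_mode, sl2Lift_h]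
      · rw [map_sub, alg, one _ (by simp [chevH, negProj_h, negProj_central])]
        simp [chevH, highestWeight, affineLift_mode, affineLift_central, sl2Lift_h]
  let Ψ : UniversalEnvelopingAlgebra ℂ nMinus →ₗ[ℂ] W :=
    (LinearMap.applyₗ w₀) ∘ₗ (UniversalEnvelopingAlgebra.lift ℂ res).toLinearMap
  have hΨ : ∀ u, Ψ u = UniversalEnvelopingAlgebra.lift ℂ res u w₀ := fun _ => rfl
  let T' : Verma m k →ₗ[ℂ] UniversalEnvelopingAlgebra ℂ nMinus :=
    Submodule.liftQ ((vermaIdeal m k).restrictScalars ℂ) T ker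
  have hT' : ∀ u : UAffine, T' (u • vac m k) = T u := fun u => by
    rw [← mk_eq_smul_vac]; rfl
  refine ⟨Ψ ∘ₗ T', ?_, ?_⟩
  · have h1 : T' (vac m k) = 1 := by
      rw [← one_smul UAffine (vac m k), hT', hT, map_one Φ]; rfl
    rw [LinearMap.comp_apply, h1, hΨ, map_one (UniversalEnvelopingAlgebra.lift ℂ res)]; rfl
  · intro x hx w
    obtain ⟨u, rfl⟩ := Submodule.Quotient.mk_surjective (vermaIdeal m k) w
    have h1 : ∀ u : UAffine, (Ψ ∘ₗ T') (u • vac m k) = Ψ (Φ u 1) := fun u => by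
      rw [LinearMap.comp_apply, hT', hT]
    rw [mk_eq_smul_vac, vermaAct_apply, ← mul_smul, h1, h1, map_mul, Module.End.mul_apply, hΦ]
    have h2 := inducedOp_sub nMinusProj_apply (highestWeight m k) ⟨x, mem_nMinus.2 hx⟩
    rw [show inducedOp nMinus nMinusProj nMinusProj_apply (highestWeight m k) x = _ from h2,
      LinearMap.mulLeft_apply, hΨ, map_mul, UniversalEnvelopingAlgebra.lift_ι_apply]
    rfl

/-! ### Representations of the affine Lie algebra by triples of currents -/

/-- Operators `f s`, `h s`, `e s` satisfying the relations of `fTˢ`, `hTˢ`, `eTˢ` at level `k`. -/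
structure LoopTriple (V : Type*) [AddCommGroup V] [Module ℂ V] (k : ℂ) where
  /-- the operators of `fTˢ` -/
  f : ℤ → Module.End ℂ V
  /-- the operators of `hTˢ` -/
  h : ℤ → Module.End ℂ V
  /-- the operators of `eTˢ` -/
  e : ℤ → Module.End ℂ V
  f_f : ∀ s t w, f s (f t w) = f t (f s w)
  e_e : ∀ s t w, e s (e t w) = e t (e s w)
  h_h : ∀ s t w, h s (h t w) = h t (h s w) + (if s + t = 0 then 2 * s * k else 0) • w
  h_f : ∀ s t w, h s (f t w) = f t (h s w) - (2 : ℂ) • f (s + t) w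
  h_e : ∀ s t w, h s (e t w) = e t (h s w) + (2 : ℂ) • e (s + t) w
  e_f : ∀ s t w, e s (f t w) = f t (e s w) + h (s + t) w + (if s + t = 0 then s * k else 0) • w

namespace LoopTriple

variable {V : Type*} [AddCommGroup V] [Module ℂ V] {k : ℂ}

/-- The triple twisted by the automorphism `eTˢ ↦ fTˢ⁺¹`, `fTˢ ↦ eTˢ⁻¹`, `hTˢ ↦ -hTˢ + δ_{s,0} c`,
which interchanges the two nodes of the Dynkin diagram. -/
def swap (T : LoopTriple V k) : LoopTriple V k where
  f s := T.e (s - 1)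
  h s := -T.h s + (if s = 0 then k else 0) • 1
  e s := T.f (s + 1)
  f_f s t := T.e_e _ _
  e_e s t := T.f_f _ _
  h_h s t w := by
    simp only [LinearMap.add_apply, LinearMap.neg_apply, LinearMap.smul_apply, Module.End.one_apply,
      map_add, map_neg, map_smul, T.h_h s t]
    module
  h_f s t w := by
    simp only [LinearMap.add_apply, LinearMap.neg_apply, LinearMap.smul_apply, Module.End.one_apply,
      map_add, map_neg, map_smul, T.h_e, show s + t - 1 = s + (t - 1) by ring]
    module
  h_e s t w := by
    simp only [LinearMap.add_apply, LinearMap.neg_apply, LinearMap.smul_apply, Module.End.one_apply,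
      map_add, map_neg, map_smul, T.h_f, show s + t + 1 = s + (t + 1) by ring]
    module
  e_f s t w := by
    have h1 : t - 1 + (s + 1) = s + t := by ring
    simp only [LinearMap.add_apply, LinearMap.neg_apply, LinearMap.smul_apply, Module.End.one_apply,
      T.e_f (t - 1), h1]
    by_cases h2 : s + t = 0
    · obtain rfl : s = -t := by lia
      simp only [neg_add_cancel, if_true]
      push_cast
      module
    · simp only [h2, if_false]
      module

/-- The operator of an arbitrary element of the affine Lie algebra; `c` acts by the level. -/
def act (T : LoopTriple V k) : Affine →ₗ[ℂ] Module.End ℂ V :=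
  affineLift (fun s => sl2Lift (T.e s) (T.f s) (T.h s)) (k • 1)

theorem act_central (T : LoopTriple V k) : T.act central = k • 1 := affineLift_central _ _
theorem act_e (T : LoopTriple V k) (s : ℤ) : T.act (mode s SlDeRham.e) = T.e s := by
  rw [act, affineLift_mode, sl2Lift_e]
theorem act_f (T : LoopTriple V k) (s : ℤ) : T.act (mode s SlDeRham.f) = T.f s := by
  rw [act, affineLift_mode, sl2Lift_f]
theorem act_h (T : LoopTriple V k) (s : ℤ) : T.act (mode s SlDeRham.h) = T.h s := by
  rw [act, affineLift_mode, sl2Lift_h]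

theorem act_lie (T : LoopTriple V k) (x y : Affine) :
    T.act ⁅x, y⁆ = T.act x * T.act y - T.act y * T.act x := by
  have comm : ∀ z : Affine, T.act z * (k • 1) = (k • 1) * T.act z := fun z => by simp
  induction x using affine_basis_induction with
  | hadd x x' hx hx' => simp only [map_add, add_lie, hx, hx']; noncomm_ring
  | hs r x hx => simp only [map_smul, smul_lie, hx, smul_sub, smul_mul_assoc, mul_smul_comm]
  | hc => rw [central_lie, map_zero, act_central, comm, sub_self]
  | he s | hf s | hh s =>
    induction y using affine_basis_induction with
    | hadd x x' hx hx' => simp only [map_add, lie_add, hx, hx']; noncomm_ring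
    | hs r x hx => simp only [map_smul, lie_smul, hx, smul_sub, smul_mul_assoc, mul_smul_comm]
    | hc => rw [lie_central, map_zero, act_central, comm, sub_self]
    | he t | hf t | hh t =>
      ext w
      simp only [mode_e_e, mode_e_f, mode_e_h, mode_f_e, mode_f_f, mode_f_h, mode_h_e, mode_h_f,
        mode_h_h, map_add, map_neg, map_smul, map_zero, act_e, act_f, act_h, act_central,
        LinearMap.sub_apply, Module.End.mul_apply, LinearMap.add_apply, LinearMap.neg_apply,
        LinearMap.smul_apply, Module.End.one_apply, LinearMap.zero_apply]
      first
        | rw [T.e_e s t, sub_self]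
        | rw [T.f_f s t, sub_self]
        | rw [T.h_f s t]; module
        | rw [T.h_e s t]; module
        | rw [T.h_f t s, add_comm t s]; module
        | rw [T.h_e t s, add_comm t s]; module
        | rw [T.h_h s t]; split_ifs <;> module
        | rw [T.e_f s t]; split_ifs <;> module
        | rw [T.e_f t s, add_comm t s]
          split_ifs with h0
          · obtain rfl : s = -t := by lia
            push_cast; module
          · module

end LoopTriple

/-- The Verma module is spanned by what is obtained from `v` by applying `f₁ = f` and
`f₂ = eT⁻¹`. -/
theorem verma_induction {m k : ℂ} {p : Verma m k → Prop} (w : Verma m k) (hv : p (vac m k))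
    (hadd : ∀ w w', p w → p w' → p (w + w')) (hsmul : ∀ (r : ℂ) w, p w → p (r • w))
    (hf : ∀ w, p w → p (vermaAct m k (mode 0 f) w))
    (he : ∀ w, p w → p (vermaAct m k (mode (-1) e) w)) : p w := by
  have h0 : p 0 := by simpa using hsmul 0 _ hv
  have hw : w ∈ ⨆ q, gr m k q := by rw [iSup_gr]; trivial
  refine Submodule.iSup_induction _ (motive := p) hw (fun q w hw => ?_) h0 hadd
  refine Submodule.span_induction (p := fun w _ => p w) ?_ h0 (fun _ _ _ _ => hadd _ _)
    (fun r w _ => hsmul r w) hw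
  rintro _ ⟨l, -, rfl⟩
  induction l with
  | nil => exact hv
  | cons i l ih =>
    change p (vermaAct m k (chevF i) (fWord m k l))
    fin_cases i
    · exact hf _ ih
    · exact he _ ih

theorem vermaAct_central (m k : ℂ) (w : Verma m k) : vermaAct m k central w = k • w := by
  have comm : ∀ x w, vermaAct m k central (vermaAct m k x w) =
      vermaAct m k x (vermaAct m k central w) := fun x w => by
    have := vermaAct_lie_apply m k central x w
    rw [central_lie, map_zero] at this
    exact sub_eq_zero.1 this.symm
  induction w using verma_induction with
  | hv =>
    have h1 : central = chevH 0 + chevH 1 := by simp [chevH]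
    rw [h1, map_add, LinearMap.add_apply, chevH_vac, chevH_vac]
    simp only [Matrix.cons_val_zero, Matrix.cons_val_one]
    module
  | hadd w w' hw hw' => rw [map_add, hw, hw', smul_add]
  | hsmul r w hw => rw [map_smul, hw, smul_comm]
  | hf w hw => rw [comm, hw, map_smul]
  | he w hw => rw [comm, hw, map_smul]

/-- The operators of a Verma module. -/
def vermaTriple (m k : ℂ) : LoopTriple (Verma m k) k where
  f s := vermaAct m k (mode s f)
  h s := vermaAct m k (mode s h)
  e s := vermaAct m k (mode s e)
  f_f s t w := by
    have := vermaAct_lie_apply m k (mode s f) (mode t f) w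
    rw [mode_f_f, map_zero] at this
    exact sub_eq_zero.1 this.symm
  e_e s t w := by
    have := vermaAct_lie_apply m k (mode s e) (mode t e) w
    rw [mode_e_e, map_zero] at this
    exact sub_eq_zero.1 this.symm
  h_h s t w := by
    have := vermaAct_lie_apply m k (mode s h) (mode t h) w
    rw [mode_h_h, map_smul, LinearMap.smul_apply, vermaAct_central, eq_sub_iff_add_eq] at this
    rw [← this]; split_ifs <;> module
  h_f s t w := by
    have := vermaAct_lie_apply m k (mode s h) (mode t f) w
    rw [mode_h_f, map_smul, LinearMap.smul_apply, eq_sub_iff_add_eq] at this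
    rw [← this]; module
  h_e s t w := by
    have := vermaAct_lie_apply m k (mode s h) (mode t e) w
    rw [mode_h_e, map_smul, LinearMap.smul_apply, eq_sub_iff_add_eq] at this
    rw [← this]; module
  e_f s t w := by
    have := vermaAct_lie_apply m k (mode s e) (mode t f) w
    rw [mode_e_f, map_add, map_smul, LinearMap.add_apply, LinearMap.smul_apply, vermaAct_central,
      eq_sub_iff_add_eq] at this
    rw [← this]; split_ifs <;> module

/-! ### The representation on polynomials -/

section Poly

open MvPolynomial

/-- The polynomial ring on which the currents act. -/
abbrev Poly : Type := MvPolynomial ℤ ℂ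

/-- The derivation `X_i ↦ X_{i+j}`. -/
def shiftDer (j : ℤ) : Derivation ℂ Poly Poly := mkDerivation ℂ fun i => X (i + j)

theorem shiftDer_X (i j : ℤ) : shiftDer j (X i) = X (i + j) := mkDerivation_X _ _ _

/-- The family of all partial derivatives of a polynomial. -/
def partials : Derivation ℂ Poly (ℤ →₀ Poly) := mkDerivation ℂ fun i => Finsupp.single i 1

theorem partials_X (i : ℤ) : partials (X i) = Finsupp.single i 1 := mkDerivation_X _ _ _

/-- The second order operator `∑_{a,b} X_{a+b+l} ∂_a ∂_b`. -/
def shiftSecond (l : ℤ) : Poly →ₗ[ℂ] Poly :=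
  (Finsupp.lsum ℂ fun a => (shiftDer (a + l)).toLinearMap) ∘ₗ partials.toLinearMap

theorem shiftSecond_C (l : ℤ) (r : ℂ) : shiftSecond l (C r) = 0 := by
  simp [shiftSecond, partials]

theorem shiftSecond_one (l : ℤ) : shiftSecond l 1 = 0 := by rw [← C_1, shiftSecond_C]

theorem shiftSecond_X_mul (l i : ℤ) (p : Poly) :
    shiftSecond l (X i * p) = X i * shiftSecond l p + (2 : ℂ) • shiftDer (i + l) p := by
  have h1 : ∀ q : ℤ →₀ Poly, Finsupp.lsum ℂ (fun a => (shiftDer (a + l)).toLinearMap) ((X i : Poly) • q) =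
      X i * Finsupp.lsum ℂ (fun a => (shiftDer (a + l)).toLinearMap) q +
        q.sum fun a r => X (i + (a + l)) * r := by
    intro q
    induction q using Finsupp.induction_linear with
    | zero => simp
    | add q q' hq hq' =>
      rw [smul_add, map_add, map_add, hq, hq', Finsupp.sum_add_index' (by simp) (by simp [mul_add])]
      ring
    | single a r =>
      rw [Finsupp.smul_single, Finsupp.lsum_single, Finsupp.lsum_single,
        Finsupp.sum_single_index (by simp), smul_eq_mul, Derivation.coeFn_coe, Derivation.leibniz,
        shiftDer_X]
      simp only [smul_eq_mul]
      ring
  have h2 : ∀ p : Poly, (partials p).sum (fun a r => X (i + (a + l)) * r) = shiftDer (i + l) p := by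
    intro p
    induction p using MvPolynomial.induction_on with
    | C r => simp [partials, shiftDer]
    | add p q hp hq =>
      rw [map_add, map_add, Finsupp.sum_add_index' (by simp) (by simp [mul_add]), hp, hq]
    | mul_X p j hp =>
      rw [Derivation.leibniz, Derivation.leibniz, partials_X, shiftDer_X,
        Finsupp.sum_add_index' (by simp) (by simp [mul_add]), Finsupp.smul_single,
        Finsupp.sum_single_index (by simp), Finsupp.sum_smul_index' (by simp), ← hp,
        Finsupp.sum, Finsupp.sum, Finset.smul_sum]
      simp only [smul_eq_mul, mul_one]
      rw [show i + (j + l) = j + (i + l) by ring, mul_comm (X (j + (i + l)) : Poly) p]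
      congr 1
      exact Finset.sum_congr rfl fun a _ => by ring
  change Finsupp.lsum ℂ _ (partials (X i * p)) = _
  rw [Derivation.leibniz, partials_X, map_add, h1, h2, Finsupp.smul_single]
  change _ + _ + _ = X i * Finsupp.lsum ℂ _ (partials p) + _
  simp
  module

/-- An operator on polynomials is zero if it kills `1` and commutes with the variables. -/
theorem poly_op_eq_zero {D : Poly →ₗ[ℂ] Poly} (h1 : D 1 = 0) (hX : ∀ i p, D (X i * p) = X i * D p) :
    D = 0 := by
  refine LinearMap.ext fun p => ?_
  induction p using MvPolynomial.induction_on with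
  | C r => rw [← mul_one (C r), ← smul_eq_C_mul, map_smul, h1, smul_zero]; rfl
  | add p q hp hq => rw [map_add, hp, hq]; simp
  | mul_X p j hp => rw [mul_comm, hX, hp]; simp

theorem shiftDer_comm (s t : ℤ) (p : Poly) : shiftDer s (shiftDer t p) = shiftDer t (shiftDer s p) := by
  induction p using MvPolynomial.induction_on with
  | C r => simp [shiftDer]
  | add p q hp hq => simp only [map_add, hp, hq]
  | mul_X p j hp =>
    simp only [Derivation.leibniz, map_add, shiftDer_X, smul_eq_mul, hp, add_assoc, add_comm s t]
    ring

theorem shiftDer_shiftSecond (s t : ℤ) (p : Poly) :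
    shiftDer s (shiftSecond t p) = shiftSecond t (shiftDer s p) - shiftSecond (s + t) p := by
  have h1 : (shiftDer s).toLinearMap ∘ₗ shiftSecond t - shiftSecond t ∘ₗ (shiftDer s).toLinearMap +
      shiftSecond (s + t) = 0 := by
    apply poly_op_eq_zero
    · simp [shiftSecond_one]
    · intro i p
      simp only [LinearMap.add_apply, LinearMap.sub_apply, LinearMap.comp_apply,
        Derivation.coeFn_coe, shiftSecond_X_mul, Derivation.leibniz, map_add, smul_eq_mul,
        shiftDer_X, map_smul]
      rw [mul_comm (shiftSecond t p), mul_comm p, shiftSecond_X_mul, shiftDer_comm s,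
        show i + s + t = i + (s + t) by ring]
      simp only [Algebra.smul_def]
      ring
  have h2 := DFunLike.congr_fun h1 p
  simp only [LinearMap.add_apply, LinearMap.sub_apply, LinearMap.comp_apply, LinearMap.zero_apply,
    Derivation.coeFn_coe] at h2
  linear_combination h2

theorem shiftSecond_comm (s t : ℤ) (p : Poly) :
    shiftSecond s (shiftSecond t p) = shiftSecond t (shiftSecond s p) := by
  have h1 : shiftSecond s ∘ₗ shiftSecond t - shiftSecond t ∘ₗ shiftSecond s = 0 := by
    apply poly_op_eq_zero
    · simp [shiftSecond_one]
    · intro i p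
      simp only [LinearMap.sub_apply, LinearMap.comp_apply, shiftSecond_X_mul, map_add, map_smul,
        shiftDer_shiftSecond, show i + t + s = i + s + t by ring]
      simp only [Algebra.smul_def]
      ring
  exact sub_eq_zero.1 (DFunLike.congr_fun h1 p)

/-- The level zero representation of the affine Lie algebra on polynomials in `X_i`, `i ∈ ℤ`, in
which `f/Tⁱ` is the multiplication by `X_i`, while `hTˢ` and `eTˢ` are differential operators of
orders one and two killing `1`. -/
def polyTriple : LoopTriple Poly 0 where
  f s := LinearMap.mulLeft ℂ (X (-s))
  h s := (-2 : ℂ) • (shiftDer (-s)).toLinearMap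
  e s := -shiftSecond (-s)
  f_f s t w := by simp only [LinearMap.mulLeft_apply]; ring
  e_e s t w := by simp [shiftSecond_comm (-s)]
  h_h s t w := by simp [shiftDer_comm (-s)]
  h_f s t w := by
    simp only [LinearMap.mulLeft_apply, LinearMap.smul_apply, Derivation.coeFn_coe,
      Derivation.leibniz, shiftDer_X, smul_eq_mul, ← neg_add, add_comm t]
    simp only [Algebra.smul_def]
    simp
    ring
  h_e s t w := by
    simp only [LinearMap.neg_apply, LinearMap.smul_apply, Derivation.coeFn_coe, map_neg, map_smul,
      shiftDer_shiftSecond, ← neg_add]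
    module
  e_f s t w := by
    simp only [LinearMap.mulLeft_apply, LinearMap.neg_apply, LinearMap.smul_apply,
      Derivation.coeFn_coe, shiftSecond_X_mul, ← neg_add, add_comm t s, mul_zero, ite_self, mul_neg]
    module

end Poly

/-! ### Coefficient functionals on polynomials -/

section Coefficients

open MvPolynomial

/-- The exponent of the monomial `∏_{i ∈ s} X_i`. -/
def expo (s : Multiset ℕ) : ℤ →₀ ℕ := Multiset.toFinsupp (s.map (Nat.cast : ℕ → ℤ))

theorem expo_cons (i : ℕ) (s : Multiset ℕ) : expo (i ::ₘ s) = Finsupp.single (i : ℤ) 1 + expo s := by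
  rw [expo, Multiset.map_cons, ← Multiset.singleton_add, map_add, Multiset.toFinsupp_singleton, expo]

theorem coeff_expo_X_mul (s : Multiset ℕ) (j : ℕ) (p : Poly) :
    coeff (expo s) (X (j : ℤ) * p) = if j ∈ s then coeff (expo (s.erase j)) p else 0 := by
  split_ifs with hj
  · conv_lhs => rw [← Multiset.cons_erase hj, expo_cons, coeff_X_mul]
  · rw [coeff_X_mul', if_neg]
    simp [expo, Multiset.mem_map, hj]

theorem coeff_expo_one (s : Multiset ℕ) : coeff (expo s) (1 : Poly) = if s = 0 then 1 else 0 := by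
  rw [coeff_one]
  refine if_congr ?_ rfl rfl
  rw [eq_comm, expo, EmbeddingLike.map_eq_zero_iff, Multiset.map_eq_zero]

/-- The derivation `X_i ↦ (α + β i) X_i`. -/
def weightDer (α β : ℂ) : Derivation ℂ Poly Poly :=
  mkDerivation ℂ fun i => (α + β * i) • X i

theorem weightDer_X (α β : ℂ) (i : ℤ) : weightDer α β (X i) = (α + β * i) • X i :=
  mkDerivation_X _ _ _

theorem weightDer_zero_apply (p : Poly) : weightDer 1 0 p = shiftDer 0 p := by
  have : weightDer 1 0 = shiftDer 0 := by
    apply MvPolynomial.derivation_ext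
    intro i
    rw [weightDer_X, shiftDer_X]; simp
  rw [this]

/-- Monomials in the `X_i`, `i ≥ 0`, are weight vectors: `α` counts the degree and `β` the sum of
the indices. -/
theorem coeff_weightDer (α β : ℂ) (s : Multiset ℕ) (p : Poly) : coeff (expo s) (weightDer α β p) =
    (s.card * α + s.sum * β) * coeff (expo s) p := by
  -- the statement for an arbitrary monomial
  have gen : ∀ (d : ℤ →₀ ℕ) (p : Poly), coeff d (weightDer α β p) =
      (d.sum fun i n => n * (α + β * i)) * coeff d p := by
    intro d p
    induction p using MvPolynomial.induction_on generalizing d with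
    | C r =>
      rw [show weightDer α β (C r) = 0 by simp [weightDer], coeff_zero, coeff_C]
      split_ifs with h0
      · simp [← h0]
      · simp
    | add p q hp hq => rw [map_add, coeff_add, coeff_add, hp, hq, mul_add]
    | mul_X p j hp =>
      rw [Derivation.leibniz, weightDer_X, coeff_add, smul_eq_mul, smul_eq_mul, mul_smul_comm,
        coeff_smul, mul_comm p, coeff_X_mul', coeff_X_mul', smul_eq_mul]
      split_ifs with hj
      · have hd : d = Finsupp.single j 1 + (d - Finsupp.single j 1) := by
          rw [add_tsub_cancel_of_le]
          rw [Finsupp.single_le_iff]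
          exact Nat.one_le_iff_ne_zero.2 (Finsupp.mem_support_iff.1 hj)
        rw [hp]
        conv_rhs => rw [hd, Finsupp.sum_add_index' (by simp) (by intros; push_cast; ring)]
        rw [add_tsub_cancel_left, Finsupp.sum_single_index (by simp)]
        push_cast
        ring
      · simp
  rw [gen]
  congr 1
  induction s using Multiset.induction with
  | empty => simp [expo]
  | cons i s ih =>
    rw [expo_cons, Finsupp.sum_add_index' (by simp) (by intros; push_cast; ring), ih,
      Finsupp.sum_single_index (by simp)]
    simp
    ring

theorem weightDer_shiftDer (α β : ℂ) (t : ℤ) (p : Poly) : weightDer α β (shiftDer t p) =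
    shiftDer t (weightDer α β p) + (β * t) • shiftDer t p := by
  induction p using MvPolynomial.induction_on with
  | C r => simp [shiftDer, weightDer]
  | add p q hp hq => simp only [map_add, hp, hq, smul_add]; abel
  | mul_X p j hp =>
    simp only [Derivation.leibniz, map_add, shiftDer_X, weightDer_X, smul_eq_mul, hp, Derivation.map_smul]
    simp only [smul_eq_C_mul]
    push_cast
    simp only [map_add, map_mul]
    ring

theorem weightDer_shiftSecond (α β : ℂ) (t : ℤ) (p : Poly) : weightDer α β (shiftSecond t p) =
    shiftSecond t (weightDer α β p) + (β * t - α) • shiftSecond t p := by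
  have h1 : (weightDer α β).toLinearMap ∘ₗ shiftSecond t -
      shiftSecond t ∘ₗ (weightDer α β).toLinearMap - (β * t - α) • shiftSecond t = 0 := by
    apply poly_op_eq_zero
    · simp [shiftSecond_one]
    · intro i p
      simp only [LinearMap.smul_apply, LinearMap.sub_apply, LinearMap.comp_apply,
        Derivation.coeFn_coe, shiftSecond_X_mul, Derivation.leibniz, map_add, smul_eq_mul,
        weightDer_X, map_smul, mul_smul_comm, weightDer_shiftDer]
      rw [mul_comm (shiftSecond t p), mul_comm p, shiftSecond_X_mul]
      simp only [smul_eq_C_mul]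
      push_cast
      simp only [map_add, map_mul, map_sub]
      ring
  have h2 := DFunLike.congr_fun h1 p
  simp only [LinearMap.sub_apply, LinearMap.comp_apply, LinearMap.zero_apply,
    Derivation.coeFn_coe, LinearMap.smul_apply] at h2
  linear_combination h2

end Coefficients

/-! ### Poincaré–Birkhoff–Witt words -/

section Words

variable {m k : ℂ}

theorem commute_f (i j : ℕ) : Commute (vermaAct m k (mode (-(i : ℤ)) f))
    (vermaAct m k (mode (-(j : ℤ)) f)) := LinearMap.ext fun w => (vermaTriple m k).f_f _ _ w

theorem commute_e (i j : ℕ) : Commute (vermaAct m k (mode (-(i : ℤ)) e))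
    (vermaAct m k (mode (-(j : ℤ)) e)) := LinearMap.ext fun w => (vermaTriple m k).e_e _ _ w

theorem commute_h (i j : ℕ) : Commute (vermaAct m k (mode (-(i : ℤ)) h))
    (vermaAct m k (mode (-(j : ℤ)) h)) := LinearMap.ext fun w => by
  refine ((vermaTriple m k).h_h (-(i : ℤ)) (-(j : ℤ)) w).trans ?_
  split_ifs with h0
  · obtain rfl : i = 0 := by lia
    simp; rfl
  · simp; rfl

theorem lowering_zero (x : Sl2) : lowering m k x 0 = 1 := by simp [lowering]

/-- The lowering operators for one letter commute, so that the sorting in `lowering` is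
immaterial. -/
theorem lowering_cons {x : Sl2} (hx : ∀ i j : ℕ, Commute (vermaAct m k (mode (-(i : ℤ)) x))
    (vermaAct m k (mode (-(j : ℤ)) x))) (i : ℕ) (s : Multiset ℕ) :
    lowering m k x (i ::ₘ s) = vermaAct m k (mode (-(i : ℤ)) x) * lowering m k x s := by
  rw [lowering, lowering, ← List.prod_cons, ← List.map_cons
    (f := fun i : ℕ => vermaAct m k (mode (-(i : ℤ)) x))]
  refine List.Perm.prod_eq' (List.Perm.map _ ?_) ?_
  · rw [← Multiset.coe_eq_coe, Multiset.sort_eq, ← Multiset.cons_coe, Multiset.sort_eq]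
  · rw [List.pairwise_map]
    exact List.pairwise_of_forall (fun _ _ => hx _ _)

/-- The words with the letters `x`, `y`, `z` in this order. -/
def word (m k : ℂ) (x y z : Sl2) (s : Multiset ℕ × Multiset ℕ × Multiset ℕ) : Verma m k :=
  lowering m k x s.1 (lowering m k y s.2.1 (lowering m k z s.2.2 (vac m k)))

/-- Abstract straightening: the span of ordered words in three families of operators is stable
under the first and the third family, if commuting a letter past a letter of an earlier family
produces a multiple of a letter of the earlier family, or of the middle one. -/
theorem span_words_stable {V : Type*} [AddCommGroup V] [Module ℂ V] {X Y Z : ℕ → Module.End ℂ V}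
    {WX WY WZ : Multiset ℕ → Module.End ℂ V} {A B C : ℕ → Prop} {v : V}
    (hX0 : WX 0 = 1) (hX : ∀ i s, WX (i ::ₘ s) = X i * WX s)
    (hY0 : WY 0 = 1) (hY : ∀ i s, WY (i ::ₘ s) = Y i * WY s)
    (hZ : ∀ i s, WZ (i ::ₘ s) = Z i * WZ s)
    (hYX : ∀ j i, B j → A i → ∃ (c : ℂ) (i' : ℕ), A i' ∧ ∀ w, Y j (X i w) = X i (Y j w) + c • X i' w)
    (hZY : ∀ l j, C l → B j → ∃ (c : ℂ) (l' : ℕ), C l' ∧ ∀ w, Z l (Y j w) = Y j (Z l w) + c • Z l' w)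
    (hZX : ∀ l i, C l → A i → ∃ (c : ℂ) (j' : ℕ), B j' ∧ ∀ w, Z l (X i w) = X i (Z l w) + c • Y j' w)
    {S : Submodule ℂ V} (hS : S = Submodule.span ℂ {w | ∃ s t u : Multiset ℕ, (∀ i ∈ s, A i) ∧
      (∀ i ∈ t, B i) ∧ (∀ i ∈ u, C i) ∧ w = WX s (WY t (WZ u v))}) :
    (∀ i, A i → ∀ w ∈ S, X i w ∈ S) ∧ (∀ l, C l → ∀ w ∈ S, Z l w ∈ S) := by
  have lift : ∀ (S : Submodule ℂ V) (G : Set V) (D : Module.End ℂ V), S = Submodule.span ℂ G →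
      (∀ w ∈ G, D w ∈ S) → ∀ w ∈ S, D w ∈ S := by
    intro S G D hG hD
    have h1 : S ≤ S.comap D := by
      conv_lhs => rw [hG]
      exact Submodule.span_le.2 hD
    exact h1
  have mem : ∀ s t u : Multiset ℕ, (∀ i ∈ s, A i) → (∀ i ∈ t, B i) → (∀ i ∈ u, C i) →
      WX s (WY t (WZ u v)) ∈ S := fun s t u hs ht hu => by
    rw [hS]; exact Submodule.subset_span ⟨s, t, u, hs, ht, hu, rfl⟩
  obtain ⟨S₀, hS₀⟩ : ∃ S₀ : Submodule ℂ V, S₀ = Submodule.span ℂ {w | ∃ t u : Multiset ℕ,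
    (∀ i ∈ t, B i) ∧ (∀ i ∈ u, C i) ∧ w = WY t (WZ u v)} := ⟨_, rfl⟩
  have mem₀ : ∀ t u : Multiset ℕ, (∀ i ∈ t, B i) → (∀ i ∈ u, C i) → WY t (WZ u v) ∈ S₀ :=
    fun t u ht hu => by rw [hS₀]; exact Submodule.subset_span ⟨t, u, ht, hu, rfl⟩
  have le : S₀ ≤ S := by
    rw [hS₀, Submodule.span_le]
    rintro _ ⟨t, u, ht, hu, rfl⟩
    simpa [hX0] using mem 0 t u (by simp) ht hu
  have cX : ∀ i, A i → ∀ w ∈ S, X i w ∈ S := fun i hi => by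
    refine lift S _ _ hS ?_
    rintro _ ⟨s, t, u, hs, ht, hu, rfl⟩
    rw [← Module.End.mul_apply, ← hX]
    exact mem _ t u (by simpa [hi] using hs) ht hu
  have cY₀ : ∀ i, B i → ∀ w ∈ S₀, Y i w ∈ S₀ := fun i hi => by
    refine lift S₀ _ _ hS₀ ?_
    rintro _ ⟨t, u, ht, hu, rfl⟩
    rw [← Module.End.mul_apply, ← hY]
    exact mem₀ _ u (by simpa [hi] using ht) hu
  have cZ₀ : ∀ l, C l → ∀ w ∈ S₀, Z l w ∈ S₀ := fun l hl => by
    refine lift S₀ _ _ hS₀ ?_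
    rintro _ ⟨t, u, ht, hu, rfl⟩
    induction t using Multiset.induction generalizing l with
    | empty =>
      rw [hY0, Module.End.one_apply, ← Module.End.mul_apply, ← hZ]
      simpa [hY0] using mem₀ 0 (l ::ₘ u) (by simp) (by simpa [hl] using hu)
    | cons j t ih =>
      obtain ⟨c, l', hl', h1⟩ := hZY l j hl (ht j (by simp))
      have ht' : ∀ i ∈ t, B i := fun i hi => ht i (by simp [hi])
      rw [hY, Module.End.mul_apply, h1]
      exact add_mem (cY₀ j (ht j (by simp)) _ (ih l hl ht'))
        (Submodule.smul_mem _ _ (ih l' hl' ht'))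
  have cY : ∀ j, B j → ∀ w ∈ S, Y j w ∈ S := fun j hj => by
    refine lift S _ _ hS ?_
    rintro _ ⟨s, t, u, hs, ht, hu, rfl⟩
    induction s using Multiset.induction with
    | empty =>
      rw [hX0, Module.End.one_apply]
      exact le (cY₀ j hj _ (mem₀ t u ht hu))
    | cons i s ih =>
      obtain ⟨c, i', hi', h1⟩ := hYX j i hj (hs i (by simp))
      have hs' : ∀ i ∈ s, A i := fun i hi => hs i (by simp [hi])
      rw [hX, Module.End.mul_apply, h1]
      exact add_mem (cX i (hs i (by simp)) _ (ih hs'))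
        (Submodule.smul_mem _ _ (cX i' hi' _ (mem s t u hs' ht hu)))
  refine ⟨cX, fun l hl => ?_⟩
  refine lift S _ _ hS ?_
  rintro _ ⟨s, t, u, hs, ht, hu, rfl⟩
  induction s using Multiset.induction with
  | empty =>
    rw [hX0, Module.End.one_apply]
    exact le (cZ₀ l hl _ (mem₀ t u ht hu))
  | cons i s ih =>
    obtain ⟨c, j, hj, h1⟩ := hZX l i hl (hs i (by simp))
    have hs' : ∀ i ∈ s, A i := fun i hi => hs i (by simp [hi])
    rw [hX, Module.End.mul_apply, h1]
    exact add_mem (cX i (hs i (by simp)) _ (ih hs'))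
      (Submodule.smul_mem _ _ (cY j hj _ (mem s t u hs' ht hu)))

/-- The words in the order `f`, `h`, `e` span the Verma module. -/
theorem span_word_fhe (m k : ℂ) : Submodule.span ℂ {w | ∃ s t u : Multiset ℕ, (∀ i ∈ s, True) ∧
    (∀ i ∈ t, 1 ≤ i) ∧ (∀ i ∈ u, 1 ≤ i) ∧ w = word m k f h e (s, t, u)} = ⊤ := by
  obtain ⟨cX, cZ⟩ := span_words_stable (A := fun _ => True) (B := (1 ≤ ·)) (C := (1 ≤ ·))
    (v := vac m k) (lowering_zero f) (lowering_cons commute_f) (lowering_zero h)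
    (lowering_cons commute_h) (lowering_cons commute_e)
    (fun j i _ _ => ⟨-2, i + j, trivial, fun w => by
      refine ((vermaTriple m k).h_f _ _ w).trans ?_
      rw [sub_eq_add_neg, ← neg_smul, show -(j : ℤ) + -(i : ℤ) = -((i + j : ℕ) : ℤ) by push_cast; ring]
      rfl⟩)
    (fun l j hl hj => ⟨-2, l + j, by lia, fun w => by
      have h1 := (vermaTriple m k).h_e (-(j : ℤ)) (-(l : ℤ)) w
      rw [show -(j : ℤ) + -(l : ℤ) = -((l + j : ℕ) : ℤ) by push_cast; ring,
        ← sub_eq_iff_eq_add, sub_eq_add_neg, ← neg_smul] at h1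
      exact h1.symm⟩)
    (fun l i hl _ => ⟨1, l + i, by lia, fun w => by
      have h1 := (vermaTriple m k).e_f (-(l : ℤ)) (-(i : ℤ)) w
      rw [show -(l : ℤ) + -(i : ℤ) = -((l + i : ℕ) : ℤ) by push_cast; ring, if_neg (by lia),
        zero_smul, add_zero] at h1
      rw [one_smul]
      exact h1⟩) rfl
  refine eq_top_iff.2 fun w _ => ?_
  induction w using verma_induction with
  | hv => exact Submodule.subset_span ⟨0, 0, 0, by simp, by simp, by simp,
      by simp [word, lowering_zero]⟩
  | hadd w w' hw hw' => exact add_mem (hw trivial) (hw' trivial)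
  | hsmul r w hw => exact Submodule.smul_mem _ _ (hw trivial)
  | hf w hw =>
    have h1 := cX 0 trivial w (hw trivial)
    simp only [Nat.cast_zero, neg_zero] at h1
    exact h1
  | he w hw =>
    have h1 := cZ 1 le_rfl w (hw trivial)
    simp only [Nat.cast_one] at h1
    exact h1

/-- The words in the order `e`, `h`, `f` span the Verma module. -/
theorem span_word_ehf (m k : ℂ) : Submodule.span ℂ {w | ∃ s t u : Multiset ℕ, (∀ i ∈ s, 1 ≤ i) ∧
    (∀ i ∈ t, 1 ≤ i) ∧ (∀ i ∈ u, True) ∧ w = word m k e h f (s, t, u)} = ⊤ := by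
  obtain ⟨cX, cZ⟩ := span_words_stable (A := (1 ≤ ·)) (B := (1 ≤ ·)) (C := fun _ => True)
    (v := vac m k) (lowering_zero e) (lowering_cons commute_e) (lowering_zero h)
    (lowering_cons commute_h) (lowering_cons commute_f)
    (fun j i hj hi => ⟨2, i + j, by lia, fun w => by
      refine ((vermaTriple m k).h_e _ _ w).trans ?_
      rw [show -(j : ℤ) + -(i : ℤ) = -((i + j : ℕ) : ℤ) by push_cast; ring]
      rfl⟩)
    (fun l j hl hj => ⟨2, l + j, by lia, fun w => by
      have h1 := (vermaTriple m k).h_f (-(j : ℤ)) (-(l : ℤ)) w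
      rw [show -(j : ℤ) + -(l : ℤ) = -((l + j : ℕ) : ℤ) by push_cast; ring,
        eq_sub_iff_add_eq] at h1
      exact h1.symm⟩)
    (fun l i hl hi => ⟨-1, l + i, by lia, fun w => by
      have h1 := (vermaTriple m k).e_f (-(i : ℤ)) (-(l : ℤ)) w
      rw [show -(i : ℤ) + -(l : ℤ) = -((l + i : ℕ) : ℤ) by push_cast; ring, if_neg (by lia),
        zero_smul, add_zero] at h1
      rw [neg_one_smul, ← sub_eq_add_neg]
      exact eq_sub_of_add_eq h1.symm⟩) rfl
  refine eq_top_iff.2 fun w _ => ?_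
  induction w using verma_induction with
  | hv => exact Submodule.subset_span ⟨0, 0, 0, by simp, by simp, by simp,
      by simp [word, lowering_zero]⟩
  | hadd w w' hw hw' => exact add_mem (hw trivial) (hw' trivial)
  | hsmul r w hw => exact Submodule.smul_mem _ _ (hw trivial)
  | hf w hw =>
    have h1 := cZ 0 trivial w (hw trivial)
    simp only [Nat.cast_zero, neg_zero] at h1
    exact h1
  | he w hw =>
    have h1 := cX 1 le_rfl w (hw trivial)
    simp only [Nat.cast_one] at h1
    exact h1

/-! ### Weights -/

theorem h0_vac : vermaAct m k (mode 0 h) (vac m k) = m • vac m k := chevH_vac m k 0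

theorem h0_lowering_f {r : ℂ} {w : Verma m k} (hw : vermaAct m k (mode 0 h) w = r • w)
    (s : Multiset ℕ) : vermaAct m k (mode 0 h) (lowering m k f s w) =
      (r - 2 * s.card) • lowering m k f s w := by
  induction s using Multiset.induction with
  | empty => simp [lowering_zero, hw]
  | cons i s ih =>
    rw [lowering_cons commute_f, Module.End.mul_apply]
    refine ((vermaTriple m k).h_f 0 (-(i : ℤ)) _).trans ?_
    rw [zero_add]
    change vermaAct m k (mode (-(i : ℤ)) f) (vermaAct m k (mode 0 h) _) -
      (2 : ℂ) • vermaAct m k (mode (-(i : ℤ)) f) _ = _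
    rw [ih, map_smul, Multiset.card_cons]
    push_cast
    module

theorem h0_lowering_e {r : ℂ} {w : Verma m k} (hw : vermaAct m k (mode 0 h) w = r • w)
    (s : Multiset ℕ) : vermaAct m k (mode 0 h) (lowering m k e s w) =
      (r + 2 * s.card) • lowering m k e s w := by
  induction s using Multiset.induction with
  | empty => simp [lowering_zero, hw]
  | cons i s ih =>
    rw [lowering_cons commute_e, Module.End.mul_apply]
    refine ((vermaTriple m k).h_e 0 (-(i : ℤ)) _).trans ?_
    rw [zero_add]
    change vermaAct m k (mode (-(i : ℤ)) e) (vermaAct m k (mode 0 h) _) +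
      (2 : ℂ) • vermaAct m k (mode (-(i : ℤ)) e) _ = _
    rw [ih, map_smul, Multiset.card_cons]
    push_cast
    module

theorem h0_lowering_h {r : ℂ} {w : Verma m k} (hw : vermaAct m k (mode 0 h) w = r • w)
    (s : Multiset ℕ) : vermaAct m k (mode 0 h) (lowering m k h s w) = r • lowering m k h s w := by
  induction s using Multiset.induction with
  | empty => simp [lowering_zero, hw]
  | cons i s ih =>
    rw [lowering_cons commute_h, Module.End.mul_apply]
    refine ((vermaTriple m k).h_h 0 (-(i : ℤ)) _).trans ?_
    change vermaAct m k (mode (-(i : ℤ)) h) (vermaAct m k (mode 0 h) _) + _ = _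
    rw [ih, map_smul]
    simp

theorem h0_word_fhe (s t u : Multiset ℕ) : vermaAct m k (mode 0 h) (word m k f h e (s, t, u)) =
    (m + 2 * u.card - 2 * s.card) • word m k f h e (s, t, u) :=
  h0_lowering_f (h0_lowering_h (h0_lowering_e h0_vac u) t) s

theorem h0_word_ehf (s t u : Multiset ℕ) : vermaAct m k (mode 0 h) (word m k e h f (s, t, u)) =
    (m - 2 * u.card + 2 * s.card) • word m k e h f (s, t, u) :=
  h0_lowering_e (h0_lowering_h (h0_lowering_f h0_vac u) t) s

/-- An eigenvector is a combination of those vectors of a spanning family of eigenvectors that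
have the same eigenvalue. -/
theorem mem_span_of_eigenvector {V : Type*} [AddCommGroup V] [Module ℂ V] {D : Module.End ℂ V}
    {G : Set V} (hG : Submodule.span ℂ G = ⊤) (hD : ∀ w ∈ G, ∃ μ : ℂ, D w = μ • w) {ν : ℂ} {x : V}
    (hx : D x = ν • x) : x ∈ Submodule.span ℂ {w ∈ G | D w = ν • w} := by
  have le : Submodule.span ℂ {w ∈ G | D w = ν • w} ≤ D.eigenspace ν := by
    rw [Submodule.span_le]
    exact fun w hw => Module.End.mem_eigenspace_iff.2 hw.2
  have top : Submodule.span ℂ {w ∈ G | D w = ν • w} ⊔ ⨆ μ ≠ ν, D.eigenspace μ = ⊤ := by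
    rw [eq_top_iff, ← hG, Submodule.span_le]
    intro w hw
    obtain ⟨μ, hμ⟩ := hD w hw
    by_cases h0 : μ = ν
    · exact Submodule.mem_sup_left (Submodule.subset_span ⟨hw, h0 ▸ hμ⟩)
    · exact Submodule.mem_sup_right (Submodule.mem_iSup_of_mem μ (Submodule.mem_iSup_of_mem h0
        (Module.End.mem_eigenspace_iff.2 hμ)))
  have h1 : x ∈ D.eigenspace ν ⊓ (Submodule.span ℂ {w ∈ G | D w = ν • w} ⊔
      ⨆ μ ≠ ν, D.eigenspace μ) :=
    ⟨Module.End.mem_eigenspace_iff.2 hx, by rw [top]; trivial⟩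
  rw [inf_comm, sup_inf_assoc_of_le _ le, inf_comm,
    (Module.End.eigenspaces_iSupIndep D ν).eq_bot, sup_bot_eq] at h1
  exact h1

/-- The Poincaré–Birkhoff–Witt vectors span the Verma module.  The order of the letters in `pbwVec`
depends on the weight, so words in the other order are expanded in words of the same weight. -/
theorem span_pbwVec (m k : ℂ) :
    Submodule.span ℂ {w | ∃ d : PBWIndex, d.Valid ∧ w = pbwVec m k d} = ⊤ := by
  rw [eq_top_iff, ← span_word_fhe m k, Submodule.span_le]
  rintro _ ⟨s, t, u, -, ht, hu, rfl⟩
  have pos : ∀ {t : Multiset ℕ}, (∀ i ∈ t, 1 ≤ i) → 0 ∉ t := fun ht h0 => absurd (ht 0 h0) (by lia)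
  by_cases hc : s.card < u.card
  · have h1 := mem_span_of_eigenvector (span_word_ehf m k) (by
      rintro _ ⟨s, t, u, -, -, -, rfl⟩
      exact ⟨_, h0_word_ehf s t u⟩) (h0_word_fhe (m := m) (k := k) s t u)
    refine Submodule.span_le.2 ?_ h1
    rintro _ ⟨⟨s', t', u', hs', ht', -, rfl⟩, h2⟩
    by_cases h3 : word m k e h f (s', t', u') = 0
    · rw [h3]; exact zero_mem _
    rw [h0_word_ehf] at h2
    have h4 := smul_left_injective ℂ h3 h2
    have h5 : (s'.card + s.card : ℂ) = u.card + u'.card := by linear_combination h4 / 2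
    have h6 : s'.card + s.card = u.card + u'.card := by exact_mod_cast h5
    refine Submodule.subset_span ⟨⟨u', t', s'⟩, ⟨pos ht', pos hs'⟩, ?_⟩
    rw [pbwVec, if_pos (by change u'.card < s'.card; lia)]
    rfl
  · refine Submodule.subset_span ⟨⟨s, t, u⟩, ⟨pos ht, pos hu⟩, ?_⟩
    rw [pbwVec, if_neg hc]
    rfl

/-- There is at most one vector dual to a given Poincaré–Birkhoff–Witt vector. -/
theorem dualVec_eq {d : PBWIndex} {φ : Contra m k} (hφ : IsDualVec d φ) : dualVec m k d = φ := by
  have hd : ∃ φ : Contra m k, IsDualVec d φ := ⟨φ, hφ⟩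
  rw [dualVec, dif_pos hd]
  apply Subtype.ext
  refine LinearMap.ext_on (span_pbwVec m k) ?_
  rintro _ ⟨d', hd', rfl⟩
  rw [hd.choose_spec d' hd', hφ d' hd']

/-- A functional of weight `m - 2` is zero if it kills the images of all `f/Tʲ`, `j ≥ 0`: the words
`h ⋯ h e ⋯ e v` without a letter `f` have weight at least `m`. -/
theorem eq_zero_of_weight_f {G : Module.Dual ℂ (Verma m k)}
    (hG : ∀ w, G (vermaAct m k (mode 0 h) w) = (m - 2) * G w)
    (hf : ∀ (j : ℕ) w, G (vermaAct m k (mode (-(j : ℤ)) f) w) = 0) : G = 0 := by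
  refine LinearMap.ext_on (span_word_fhe m k) ?_
  rintro _ ⟨s, t, u, -, -, -, rfl⟩
  rw [LinearMap.zero_apply]
  induction s using Multiset.induction with
  | cons i s ih =>
    rw [word, lowering_cons commute_f, Module.End.mul_apply, hf]
  | empty =>
    have h1 := hG (word m k f h e (0, t, u))
    rw [h0_word_fhe, map_smul, smul_eq_mul, ← sub_eq_zero, ← sub_mul] at h1
    refine (mul_eq_zero.1 h1).resolve_left fun h2 => ?_
    have h3 : ((u.card + 1 : ℕ) : ℂ) = 0 := by
      push_cast; simp at h2; linear_combination h2 / 2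
    exact Nat.cast_ne_zero.2 (Nat.succ_ne_zero _) h3

/-- A functional of weight `m + 2` is zero if it kills the images of all `e/Tʲ`, `j ≥ 1`: the words
`h ⋯ h f ⋯ f v` without a letter `e` have weight at most `m`. -/
theorem eq_zero_of_weight_e {G : Module.Dual ℂ (Verma m k)}
    (hG : ∀ w, G (vermaAct m k (mode 0 h) w) = (m + 2) * G w)
    (he : ∀ (j : ℕ) w, G (vermaAct m k (mode (-(j : ℤ) - 1) e) w) = 0) : G = 0 := by
  refine LinearMap.ext_on (span_word_ehf m k) ?_
  rintro _ ⟨s, t, u, hs, -, -, rfl⟩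
  rw [LinearMap.zero_apply]
  induction s using Multiset.induction with
  | cons i s ih =>
    obtain ⟨j, rfl⟩ := Nat.exists_eq_add_of_le' (hs i (by simp))
    rw [word, lowering_cons commute_e, Module.End.mul_apply]
    have := he j (lowering m k e s (lowering m k h t (lowering m k f u (vac m k))))
    rwa [show -(j : ℤ) - 1 = -((j + 1 : ℕ) : ℤ) by push_cast; ring] at this
  | empty =>
    have h1 := hG (word m k e h f (0, t, u))
    rw [h0_word_ehf, map_smul, smul_eq_mul, ← sub_eq_zero, ← sub_mul] at h1
    refine (mul_eq_zero.1 h1).resolve_left fun h2 => ?_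
    have h3 : ((u.card + 1 : ℕ) : ℂ) = 0 := by
      push_cast; simp at h2; linear_combination -h2 / 2
    exact Nat.cast_ne_zero.2 (Nat.succ_ne_zero _) h3

end Words

/-! ### The dual vectors of words in one kind of letters -/

section DualVectors

open MvPolynomial

variable {m k : ℂ}

/-- The differential operators preserve the degree or lower it to no less than one, so their
values have no constant term. -/
theorem coeff_zero_shiftDer (j : ℤ) (p : Poly) : coeff 0 (shiftDer j p) = 0 := by
  induction p using MvPolynomial.induction_on with
  | C r => simp [shiftDer]
  | add p q hp hq => rw [map_add, coeff_add, hp, hq, add_zero]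
  | mul_X p i hp =>
    rw [Derivation.leibniz, shiftDer_X, coeff_add, smul_eq_mul, smul_eq_mul, mul_comm p,
      coeff_X_mul', coeff_X_mul']
    simp

theorem coeff_zero_shiftSecond (l : ℤ) (p : Poly) : coeff 0 (shiftSecond l p) = 0 := by
  induction p using MvPolynomial.induction_on with
  | C r => rw [shiftSecond_C, coeff_zero]
  | add p q hp hq => rw [map_add, coeff_add, hp, hq, add_zero]
  | mul_X p i hp =>
    rw [mul_comm, shiftSecond_X_mul, coeff_add, coeff_smul, coeff_zero_shiftDer, coeff_X_mul']
    simp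

theorem expo_zero : expo 0 = 0 := by simp [expo]

/-- A coefficient of an `𝔫₋`-equivariant map to polynomials lives in a single degree, because the
letters `f` and `e/T` shift the weights of monomials by fixed amounts `a` and `b`, and the weights
of a monomial determine the numbers `c` and `c'` of these letters (`hq`). -/
theorem coeff_mem_contra {Θ : Verma m k →ₗ[ℂ] Poly} (hv : Θ (vac m k) = 1)
    {A B : Module.End ℂ Poly} (hA : ∀ w, Θ (vermaAct m k (mode 0 f) w) = A (Θ w))
    (hB : ∀ w, Θ (vermaAct m k (mode (-1) e) w) = B (Θ w)) {a b : ℂ → ℂ → ℂ}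
    (wA : ∀ α β p, weightDer α β (A p) = A (weightDer α β p) + a α β • A p)
    (wB : ∀ α β p, weightDer α β (B p) = B (weightDer α β p) + b α β • B p)
    {s : Multiset ℕ} {q : ℤ × ℤ}
    (hq : ∀ c c' : ℕ, (∀ α β : ℂ, s.card * α + s.sum * β = c * a α β + c' * b α β) →
      ((c : ℤ), (c' : ℤ)) = q) :
    lcoeff ℂ (expo s) ∘ₗ Θ ∈ Contra m k := by
  refine (Set.finite_singleton q).subset ?_
  rintro p ⟨w, hw, hne⟩
  by_contra hp
  refine hne ?_
  refine Submodule.span_induction (p := fun w _ => (lcoeff ℂ (expo s) ∘ₗ Θ) w = 0) ?_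
    (map_zero _) (fun x y _ _ hx hy => by rw [map_add, hx, hy, add_zero])
    (fun r x _ hx => by rw [map_smul, hx, smul_zero]) hw
  rintro _ ⟨l, rfl, rfl⟩
  have key : ∀ α β, weightDer α β (Θ (fWord m k l)) =
      (l.count 0 * a α β + l.count 1 * b α β : ℂ) • Θ (fWord m k l) := by
    intro α β
    clear hne hp hw
    induction l with
    | nil =>
      change weightDer α β (Θ (vac m k)) = _ • Θ (vac m k)
      rw [hv]; simp
    | cons i l ih =>
      fin_cases i
      · change weightDer α β (Θ (vermaAct m k (mode 0 f) (fWord m k l))) =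
          _ • Θ (vermaAct m k (mode 0 f) (fWord m k l))
        rw [hA, wA, ih, map_smul]
        simp
        module
      · change weightDer α β (Θ (vermaAct m k (mode (-1) e) (fWord m k l))) =
          _ • Θ (vermaAct m k (mode (-1) e) (fWord m k l))
        rw [hB, wB, ih, map_smul]
        simp
        module
  by_contra h0
  refine hp (hq _ _ fun α β => ?_)
  have h1 := congrArg (coeff (expo s)) (key α β)
  rw [coeff_weightDer, coeff_smul, smul_eq_mul] at h1
  exact mul_right_cancel₀ h0 h1

/-- The vector `v^*` is characterized by killing the image of `𝔫₋`. -/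
theorem isDualVec_idxV {φ : Contra m k} (hv : φ.1 (vac m k) = 1)
    (hf : ∀ (j : ℕ) w, φ.1 (vermaAct m k (mode (-(j : ℤ)) f) w) = 0)
    (hh : ∀ (j : ℕ) w, 1 ≤ j → φ.1 (vermaAct m k (mode (-(j : ℤ)) h) w) = 0)
    (he : ∀ (j : ℕ) w, 1 ≤ j → φ.1 (vermaAct m k (mode (-(j : ℤ)) e) w) = 0) :
    IsDualVec idxV φ := by
  rintro ⟨s, t, u⟩ ⟨ht, hu⟩
  have kf : ∀ s w, φ.1 (lowering m k f s w) = if s = 0 then φ.1 w else 0 := fun s w => by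
    induction s using Multiset.induction with
    | empty => simp [lowering_zero]
    | cons i s _ => rw [lowering_cons commute_f, Module.End.mul_apply, hf]; simp
  have kh : ∀ s w, 0 ∉ s → φ.1 (lowering m k h s w) = if s = 0 then φ.1 w else 0 := fun s w h0 => by
    induction s using Multiset.induction with
    | empty => simp [lowering_zero]
    | cons i s _ =>
      have : 1 ≤ i := Nat.one_le_iff_ne_zero.2 fun h1 => h0 (by simp [h1])
      rw [lowering_cons commute_h, Module.End.mul_apply, hh _ _ this]; simp
  have ke : ∀ s w, 0 ∉ s → φ.1 (lowering m k e s w) = if s = 0 then φ.1 w else 0 := fun s w h0 => by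
    induction s using Multiset.induction with
    | empty => simp [lowering_zero]
    | cons i s _ =>
      have : 1 ≤ i := Nat.one_le_iff_ne_zero.2 fun h1 => h0 (by simp [h1])
      rw [lowering_cons commute_e, Module.End.mul_apply, he _ _ this]; simp
  change 0 ∉ t at ht
  change 0 ∉ u at hu
  simp only [pbwVec, idxV, PBWIndex.mk.injEq]
  split_ifs with h1 <;> simp only [kf, kh _ _ ht, ke _ _ hu, hv] <;> grind

theorem h0_f (s : ℤ) (w : Verma m k) : vermaAct m k (mode 0 h) (vermaAct m k (mode s f) w) =
    vermaAct m k (mode s f) (vermaAct m k (mode 0 h) w) - (2 : ℂ) • vermaAct m k (mode s f) w := by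
  have h1 := (vermaTriple m k).h_f 0 s w
  rw [zero_add] at h1
  exact h1

theorem h0_e (s : ℤ) (w : Verma m k) : vermaAct m k (mode 0 h) (vermaAct m k (mode s e) w) =
    vermaAct m k (mode s e) (vermaAct m k (mode 0 h) w) + (2 : ℂ) • vermaAct m k (mode s e) w := by
  have h1 := (vermaTriple m k).h_e 0 s w
  rw [zero_add] at h1
  exact h1

/-- An `𝔫₋`-equivariant map sending `v` to `1` shifts the eigenvalues of `h` by `m`. -/
theorem verma_map_h0 (T : LoopTriple Poly 0) (hT : T.h 0 1 = 0) {Θ : Verma m k →ₗ[ℂ] Poly}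
    (hv : Θ (vac m k) = 1)
    (hΘ : ∀ x, negProj x = x → ∀ w, Θ (vermaAct m k x w) = T.act x (Θ w)) (w : Verma m k) :
    Θ (vermaAct m k (mode 0 h) w) = m • Θ w + T.h 0 (Θ w) := by
  induction w using verma_induction with
  | hv => rw [h0_vac, map_smul, hv, hT, add_zero]
  | hadd w w' hw hw' => simp only [map_add, hw, hw', smul_add]; abel
  | hsmul r w hw => simp only [map_smul, hw, smul_add, smul_comm r m]
  | hf w hw =>
    rw [h0_f, map_sub, map_smul, hΘ (mode 0 f) (by simp [negProj_f]),
      hΘ (mode 0 f) (by simp [negProj_f]), hw,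
      LoopTriple.act_f, T.h_f, map_add, map_smul, add_zero]
    module
  | he w hw =>
    rw [h0_e, map_add, map_smul, hΘ (mode (-1) e) (by simp [negProj_e]),
      hΘ (mode (-1) e) (by simp [negProj_e]), hw,
      LoopTriple.act_e, T.h_e, map_add, map_smul, zero_add]
    module

theorem pos_of_zero_notMem_cons {i : ℕ} {s : Multiset ℕ} (hs : 0 ∉ i ::ₘ s) : 1 ≤ i ∧ 0 ∉ s :=
  ⟨Nat.one_le_iff_ne_zero.2 fun h1 => hs (by simp [h1]), fun h1 => hs (by simp [h1])⟩

/-- Words in two kinds of letters killing the constants have only their empty word with non-zero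
image. -/
theorem verma_map_words {Θ : Verma m k →ₗ[ℂ] Poly} (hv : Θ (vac m k) = 1) {x : Sl2}
    {B : ℕ → Prop} (hx : ∀ i j : ℕ, Commute (vermaAct m k (mode (-(i : ℤ)) x))
      (vermaAct m k (mode (-(j : ℤ)) x)))
    (kx : ∀ (j : ℕ) w (r : ℂ), B j → Θ w = C r → Θ (vermaAct m k (mode (-(j : ℤ)) x) w) = 0)
    (kh : ∀ (j : ℕ) w (r : ℂ), 1 ≤ j → Θ w = C r → Θ (vermaAct m k (mode (-(j : ℤ)) h) w) = 0)
    (t u : Multiset ℕ) (ht : 0 ∉ t) (hu : ∀ i ∈ u, B i) :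
    Θ (lowering m k h t (lowering m k x u (vac m k))) = C (if t = 0 ∧ u = 0 then 1 else 0) := by
  have h1 : Θ (lowering m k x u (vac m k)) = C (if u = 0 then 1 else 0) := by
    induction u using Multiset.induction with
    | empty => simp [lowering_zero, hv]
    | cons i u ih =>
      rw [lowering_cons hx, Module.End.mul_apply, kx _ _ _ (hu i (by simp))
        (ih fun i hi => hu i (by simp [hi]))]
      simp
  induction t using Multiset.induction with
  | empty => simp [lowering_zero, h1]
  | cons i t ih =>
    have := pos_of_zero_notMem_cons ht
    rw [lowering_cons commute_h, Module.End.mul_apply, kh _ _ _ this.1 (ih this.2)]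
    simp

/-- A recursive criterion for being dual to the words in the letters `f/Tʲ`. -/
theorem isDualVec_of_f {φ : Multiset ℕ → Contra m k}
    (red : ∀ s (j : ℕ) w, (φ s).1 (vermaAct m k (mode (-(j : ℤ)) f) w) =
      if j ∈ s then (φ (s.erase j)).1 w else 0)
    (wt : ∀ s w, (φ s).1 (vermaAct m k (mode 0 h) w) = (m - 2 * s.card) * (φ s).1 w)
    (base : ∀ s t u, 0 ∉ t → 0 ∉ u → (φ s).1 (lowering m k h t (lowering m k e u (vac m k))) =
      if s = 0 ∧ t = 0 ∧ u = 0 then 1 else 0) (s : Multiset ℕ) :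
    IsDualVec ⟨s, 0, 0⟩ (φ s) := by
  rintro ⟨s', t, u⟩ ⟨ht, hu⟩
  change 0 ∉ t at ht
  change 0 ∉ u at hu
  rw [PBWIndex.mk.injEq, pbwVec]
  change (φ s).1 (if s'.card < u.card then word m k e h f (u, t, s') else
    word m k f h e (s', t, u)) = _
  by_cases hc : s'.card < u.card
  -- the word has a weight larger than `m`, and that of `φ s` is at most `m`
  · rw [if_pos hc, if_neg (by rintro ⟨-, -, rfl⟩; simp at hc)]
    have h1 := wt s (word m k e h f (u, t, s'))
    rw [h0_word_ehf, map_smul, smul_eq_mul, ← sub_eq_zero, ← sub_mul] at h1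
    refine (mul_eq_zero.1 h1).resolve_left fun h2 => ?_
    have h3 : ((u.card + s.card : ℕ) : ℂ) = s'.card := by
      push_cast; linear_combination h2 / 2
    have h4 : u.card + s.card = s'.card := by exact_mod_cast h3
    lia
  · rw [if_neg hc]
    clear hc
    induction s' using Multiset.induction generalizing s with
    | empty =>
      rw [word, lowering_zero, Module.End.one_apply, base s t u ht hu]
      split_ifs <;> grind
    | cons i s' ih =>
      rw [word, lowering_cons commute_f, Module.End.mul_apply, red]
      by_cases hi : i ∈ s
      · rw [if_pos hi]
        have hs : i ::ₘ s' = s ↔ s' = s.erase i := by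
          conv_lhs => rw [← Multiset.cons_erase hi, Multiset.cons_inj_right]
        refine (ih (s.erase i)).trans ?_
        split_ifs <;> tauto
      · rw [if_neg hi, if_neg]
        rintro ⟨rfl, -⟩
        simp at hi

/-- A recursive criterion for being dual to the words in the letters `e/Tʲ⁺¹`. -/
theorem isDualVec_of_e {φ : Multiset ℕ → Contra m k}
    (red : ∀ s (j : ℕ) w, (φ s).1 (vermaAct m k (mode (-(j : ℤ) - 1) e) w) =
      if j ∈ s then (φ (s.erase j)).1 w else 0)
    (wt : ∀ s w, (φ s).1 (vermaAct m k (mode 0 h) w) = (m + 2 * s.card) * (φ s).1 w)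
    (base : ∀ s t u, 0 ∉ t → (φ s).1 (lowering m k h t (lowering m k f u (vac m k))) =
      if s = 0 ∧ t = 0 ∧ u = 0 then 1 else 0) {s : Multiset ℕ} (hs : s ≠ 0) :
    IsDualVec ⟨0, 0, s.map Nat.succ⟩ (φ s) := by
  rintro ⟨s', t, u⟩ ⟨ht, hu⟩
  change 0 ∉ t at ht
  change 0 ∉ u at hu
  obtain ⟨u, rfl⟩ : ∃ u' : Multiset ℕ, u = u'.map Nat.succ := by
    refine ⟨u.map Nat.pred, ?_⟩
    rw [Multiset.map_map]
    conv_lhs => rw [← Multiset.map_id u]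
    refine Multiset.map_congr rfl fun i hi => ?_
    have : i ≠ 0 := fun h0 => hu (h0 ▸ hi)
    simp; lia
  clear hu
  rw [PBWIndex.mk.injEq, pbwVec]
  change (φ s).1 (if s'.card < (u.map Nat.succ).card then word m k e h f (u.map Nat.succ, t, s') else
    word m k f h e (s', t, u.map Nat.succ)) = _
  have inj : u.map Nat.succ = s.map Nat.succ ↔ u = s :=
    (Multiset.map_injective Nat.succ_injective).eq_iff
  rw [inj]
  by_cases hc : s'.card < (u.map Nat.succ).card
  · rw [if_pos hc]
    clear hc inj hs
    induction u using Multiset.induction generalizing s with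
    | empty =>
      rw [word, Multiset.map_zero, lowering_zero, Module.End.one_apply, base s t s' ht]
      grind
    | cons i u ih =>
      rw [word, Multiset.map_cons, lowering_cons commute_e, Module.End.mul_apply]
      have h1 := red s i (word m k e h f (u.map Nat.succ, t, s'))
      rw [show -(i : ℤ) - 1 = -((i.succ : ℕ) : ℤ) by push_cast; ring] at h1
      refine h1.trans ?_
      by_cases hi : i ∈ s
      · rw [if_pos hi]
        have hs : i ::ₘ u = s ↔ u = s.erase i := by
          conv_lhs => rw [← Multiset.cons_erase hi, Multiset.cons_inj_right]
        refine (ih (s := s.erase i)).trans ?_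
        split_ifs <;> tauto
      · rw [if_neg hi, if_neg]
        rintro ⟨-, -, rfl⟩
        simp at hi
  -- the word has weight at most `m`, and that of `φ s` is larger than `m`
  · have hs' : 0 < s.card := Multiset.card_pos.2 hs
    rw [Multiset.card_map] at hc
    rw [if_neg (by rwa [Multiset.card_map]), if_neg (by rintro ⟨rfl, -, rfl⟩; simp at hc; exact hs hc)]
    have h1 := wt s (word m k f h e (s', t, u.map Nat.succ))
    rw [h0_word_fhe, map_smul, smul_eq_mul, ← sub_eq_zero, ← sub_mul] at h1
    refine (mul_eq_zero.1 h1).resolve_left fun h2 => ?_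
    rw [Multiset.card_map] at h2
    have h3 : (u.card : ℂ) = (s'.card + s.card : ℕ) := by
      push_cast; linear_combination h2 / 2
    have h4 : u.card = s'.card + s.card := by exact_mod_cast h3
    lia

/-- The functionals dual to words in the letters `f/Tʲ`: the coefficients of the `𝔫₋`-equivariant map
to the representation on polynomials that sends `v` to `1`. -/
theorem exists_functionals_f (m k : ℂ) : ∃ φ : Multiset ℕ → Contra m k,
    (∀ s, IsDualVec ⟨s, 0, 0⟩ (φ s)) ∧
    (∀ s (j : ℕ) w, (φ s).1 (vermaAct m k (mode (-(j : ℤ)) f) w) =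
      if j ∈ s then (φ (s.erase j)).1 w else 0) ∧
    (∀ s w, (φ s).1 (vermaAct m k (mode 0 h) w) = (m - 2 * s.card) * (φ s).1 w) ∧
    (∀ (j : ℕ) w, 1 ≤ j → (φ 0).1 (vermaAct m k (mode (-(j : ℤ)) h) w) = 0) ∧
    ∀ (j : ℕ) w, 1 ≤ j → (φ 0).1 (vermaAct m k (mode (-(j : ℤ)) e) w) = 0 := by
  obtain ⟨Θ, hv, hΘ⟩ := exists_verma_map m k polyTriple.act polyTriple.act_lie 1
  have tf : ∀ (j : ℕ) w, Θ (vermaAct m k (mode (-(j : ℤ)) f) w) = X (j : ℤ) * Θ w := fun j w => by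
    rw [hΘ _ (by rw [negProj_f, if_pos (by lia)]), LoopTriple.act_f]
    simp [polyTriple]
  have th : ∀ (j : ℕ) w, 1 ≤ j → Θ (vermaAct m k (mode (-(j : ℤ)) h) w) =
      (-2 : ℂ) • shiftDer j (Θ w) := fun j w hj => by
    rw [hΘ _ (by rw [negProj_h, if_pos (by lia)]), LoopTriple.act_h]
    simp [polyTriple]
  have te : ∀ (j : ℕ) w, 1 ≤ j → Θ (vermaAct m k (mode (-(j : ℤ)) e) w) =
      -shiftSecond j (Θ w) := fun j w hj => by
    rw [hΘ _ (by rw [negProj_e, if_pos (by lia)]), LoopTriple.act_e]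
    simp [polyTriple]
  have th0 := verma_map_h0 polyTriple (by simp [polyTriple]) hv hΘ
  have hmem : ∀ s, lcoeff ℂ (expo s) ∘ₗ Θ ∈ Contra m k := fun s => by
    refine coeff_mem_contra (q := (s.card + s.sum, s.sum)) hv (A := LinearMap.mulLeft ℂ (X 0))
      (B := -shiftSecond 1) (a := fun α _ => α) (b := fun α β => β - α)
      (fun w => by simpa using tf 0 w) (fun w => by simpa using te 1 w le_rfl)
      (fun α β p => ?_) (fun α β p => ?_) (fun c c' hc => ?_)
    · simp [Derivation.leibniz, weightDer_X, smul_eq_C_mul]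
      ring
    · simp only [LinearMap.neg_apply, map_neg, weightDer_shiftSecond]
      push_cast
      module
    -- the weights for `(α, β) = (1, 1)` and `(0, 1)` determine the degree
    · have h1 := hc 1 1
      have h2 := hc 0 1
      simp only [mul_one, sub_self, mul_zero, add_zero, zero_add, sub_zero] at h1 h2
      have h1' : s.card + s.sum = c := by exact_mod_cast h1
      have h2' : s.sum = c' := by exact_mod_cast h2
      rw [← h1', ← h2']; simp
  obtain ⟨φ, hφ⟩ : ∃ φ : Multiset ℕ → Contra m k, ∀ s w, (φ s).1 w = coeff (expo s) (Θ w) :=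
    ⟨fun s => ⟨_, hmem s⟩, fun _ _ => rfl⟩
  have wt : ∀ s w, (φ s).1 (vermaAct m k (mode 0 h) w) = (m - 2 * s.card) * (φ s).1 w := fun s w => by
    have h1 : polyTriple.h 0 (Θ w) = (-2 : ℂ) • weightDer 1 0 (Θ w) := by
      rw [weightDer_zero_apply]; simp [polyTriple]
    rw [hφ, hφ, th0, h1, coeff_add, coeff_smul, coeff_smul, coeff_weightDer, smul_eq_mul, smul_eq_mul]
    ring
  have red : ∀ s (j : ℕ) w, (φ s).1 (vermaAct m k (mode (-(j : ℤ)) f) w) =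
      if j ∈ s then (φ (s.erase j)).1 w else 0 := fun s j w => by
    rw [hφ, hφ, tf, coeff_expo_X_mul]
  refine ⟨φ, isDualVec_of_f red wt fun s t u ht hu => ?_, red, wt, fun j w hj => ?_,
    fun j w hj => ?_⟩
  · rw [hφ, verma_map_words hv (B := (1 ≤ ·)) commute_e
      (fun j w r hj hw => by rw [te j w hj, hw, shiftSecond_C, neg_zero])
      (fun j w r hj hw => by rw [th j w hj, hw]; simp [shiftDer]) t u ht
      (fun i hi => Nat.one_le_iff_ne_zero.2 fun h0 => hu (h0 ▸ hi)), ← mul_one (C _), coeff_C_mul,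
      coeff_expo_one]
    grind
  · rw [hφ, th j w hj, expo_zero, coeff_smul, coeff_zero_shiftDer, smul_zero]
  · rw [hφ, te j w hj, expo_zero, coeff_neg, coeff_zero_shiftSecond, neg_zero]

/-- The functionals dual to words in the letters `e/Tʲ⁺¹`, obtained from the twist of the
representation on polynomials by the automorphism interchanging `f₁` and `f₂`.  The empty word needs
a separate argument, as its dual vector has to vanish on words with as many `f` as `e`. -/
theorem exists_functionals_e (m k : ℂ) : ∃ φ : Multiset ℕ → Contra m k,
    (∀ s, IsDualVec ⟨0, 0, s.map Nat.succ⟩ (φ s)) ∧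
    (∀ s (j : ℕ) w, (φ s).1 (vermaAct m k (mode (-(j : ℤ) - 1) e) w) =
      if j ∈ s then (φ (s.erase j)).1 w else 0) ∧
    (∀ s w, (φ s).1 (vermaAct m k (mode 0 h) w) = (m + 2 * s.card) * (φ s).1 w) := by
  obtain ⟨Θ, hv, hΘ⟩ := exists_verma_map m k polyTriple.swap.act polyTriple.swap.act_lie 1
  have te : ∀ (j : ℕ) w, Θ (vermaAct m k (mode (-(j : ℤ) - 1) e) w) = X (j : ℤ) * Θ w := fun j w => by
    rw [hΘ _ (by rw [negProj_e, if_pos (by lia)]), LoopTriple.act_e]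
    simp [polyTriple, LoopTriple.swap]
  have th : ∀ (j : ℕ) w, 1 ≤ j → Θ (vermaAct m k (mode (-(j : ℤ)) h) w) =
      (2 : ℂ) • shiftDer j (Θ w) := fun j w hj => by
    rw [hΘ _ (by rw [negProj_h, if_pos (by lia)]), LoopTriple.act_h]
    simp [polyTriple, LoopTriple.swap]
  have tf : ∀ (j : ℕ) w, Θ (vermaAct m k (mode (-(j : ℤ)) f) w) =
      -shiftSecond (j + 1) (Θ w) := fun j w => by
    rw [hΘ _ (by rw [negProj_f, if_pos (by lia)]), LoopTriple.act_f]
    simp [polyTriple, LoopTriple.swap, add_comm]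
  have th0 := verma_map_h0 polyTriple.swap (by simp [polyTriple, LoopTriple.swap]) hv hΘ
  have hmem : ∀ s, lcoeff ℂ (expo s) ∘ₗ Θ ∈ Contra m k := fun s => by
    refine coeff_mem_contra (q := (s.sum, s.card + s.sum)) hv (A := -shiftSecond 1)
      (B := LinearMap.mulLeft ℂ (X 0)) (a := fun α β => β - α) (b := fun α _ => α)
      (fun w => by simpa using tf 0 w) (fun w => by simpa using te 0 w)
      (fun α β p => ?_) (fun α β p => ?_) (fun c c' hc => ?_)
    · simp only [LinearMap.neg_apply, map_neg, weightDer_shiftSecond]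
      push_cast
      module
    · simp [Derivation.leibniz, weightDer_X, smul_eq_C_mul]
      ring
    -- the weights for `(α, β) = (1, 1)` and `(0, 1)` determine the degree
    · have h1 := hc 1 1
      have h2 := hc 0 1
      simp only [mul_one, sub_self, mul_zero, add_zero, zero_add, sub_zero] at h1 h2
      have h1' : s.card + s.sum = c' := by exact_mod_cast h1
      have h2' : s.sum = c := by exact_mod_cast h2
      rw [← h1', ← h2']; simp
  obtain ⟨φ, hφ⟩ : ∃ φ : Multiset ℕ → Contra m k, ∀ s w, (φ s).1 w = coeff (expo s) (Θ w) :=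
    ⟨fun s => ⟨_, hmem s⟩, fun _ _ => rfl⟩
  have wt : ∀ s w, (φ s).1 (vermaAct m k (mode 0 h) w) = (m + 2 * s.card) * (φ s).1 w := fun s w => by
    have h1 : polyTriple.swap.h 0 (Θ w) = (2 : ℂ) • weightDer 1 0 (Θ w) := by
      rw [weightDer_zero_apply]; simp [polyTriple, LoopTriple.swap]
    rw [hφ, hφ, th0, h1, coeff_add, coeff_smul, coeff_smul, coeff_weightDer, smul_eq_mul, smul_eq_mul]
    ring
  have red : ∀ s (j : ℕ) w, (φ s).1 (vermaAct m k (mode (-(j : ℤ) - 1) e) w) =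
      if j ∈ s then (φ (s.erase j)).1 w else 0 := fun s j w => by
    rw [hφ, hφ, te, coeff_expo_X_mul]
  refine ⟨φ, fun s => ?_, red, wt⟩
  by_cases hs : s = 0
  · subst hs
    refine isDualVec_idxV (by rw [hφ, hv, coeff_expo_one, if_pos rfl]) (fun j w => ?_)
      (fun j w hj => ?_) (fun j w hj => ?_)
    · rw [hφ, tf j w, expo_zero, coeff_neg, coeff_zero_shiftSecond, neg_zero]
    · rw [hφ, th j w hj, expo_zero, coeff_smul, coeff_zero_shiftDer, smul_zero]
    · obtain ⟨j, rfl⟩ := Nat.exists_eq_add_of_le' hj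
      have := red 0 j w
      rw [if_neg (by simp)] at this
      rwa [show -(j : ℤ) - 1 = -((j + 1 : ℕ) : ℤ) by push_cast; ring] at this
  · refine isDualVec_of_e red wt (fun s t u ht => ?_) hs
    rw [hφ, verma_map_words hv (B := fun _ => True) commute_f
      (fun j w r _ hw => by rw [tf j w, hw, shiftSecond_C, neg_zero])
      (fun j w r hj hw => by rw [th j w hj, hw]; simp [shiftDer]) t u ht
      (fun i hi => trivial), ← mul_one (C _), coeff_C_mul, coeff_expo_one]
    grind

/-- The functional dual to the word `∏_{i ∈ s} f/Tⁱ` applied to `v`. -/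
def fDual (m k : ℂ) (s : Multiset ℕ) : Module.Dual ℂ (Verma m k) := (dualVec m k ⟨s, 0, 0⟩).1

/-- The functional dual to the word `∏_{i ∈ s} e/Tⁱ⁺¹` applied to `v`. -/
def eDual (m k : ℂ) (s : Multiset ℕ) : Module.Dual ℂ (Verma m k) :=
  (dualVec m k ⟨0, 0, s.map Nat.succ⟩).1

theorem eDual_zero : eDual m k 0 = fDual m k 0 := rfl

theorem isDualVec_f (s : Multiset ℕ) : IsDualVec ⟨s, 0, 0⟩ (dualVec m k ⟨s, 0, 0⟩) := by
  obtain ⟨φ, hφ, -⟩ := exists_functionals_f m k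
  rw [dualVec_eq (hφ s)]
  exact hφ s

theorem fDual_f (s : Multiset ℕ) (j : ℕ) (w : Verma m k) :
    fDual m k s (vermaAct m k (mode (-(j : ℤ)) f) w) = if j ∈ s then fDual m k (s.erase j) w else 0 := by
  obtain ⟨φ, hφ, h1, -⟩ := exists_functionals_f m k
  simp only [fDual, dualVec_eq (hφ _)]
  exact h1 s j w

theorem fDual_h0 (s : Multiset ℕ) (w : Verma m k) :
    fDual m k s (vermaAct m k (mode 0 h) w) = (m - 2 * s.card) * fDual m k s w := by
  obtain ⟨φ, hφ, -, h1, -⟩ := exists_functionals_f m k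
  simp only [fDual, dualVec_eq (hφ _)]
  exact h1 s w

theorem fDual_zero_h {j : ℕ} (hj : 1 ≤ j) (w : Verma m k) :
    fDual m k 0 (vermaAct m k (mode (-(j : ℤ)) h) w) = 0 := by
  obtain ⟨φ, hφ, -, -, h1, -⟩ := exists_functionals_f m k
  simp only [fDual, dualVec_eq (hφ _)]
  exact h1 j w hj

theorem fDual_zero_e {j : ℕ} (hj : 1 ≤ j) (w : Verma m k) :
    fDual m k 0 (vermaAct m k (mode (-(j : ℤ)) e) w) = 0 := by
  obtain ⟨φ, hφ, -, -, -, h1⟩ := exists_functionals_f m k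
  simp only [fDual, dualVec_eq (hφ _)]
  exact h1 j w hj

theorem eDual_e (s : Multiset ℕ) (j : ℕ) (w : Verma m k) :
    eDual m k s (vermaAct m k (mode (-(j : ℤ) - 1) e) w) =
      if j ∈ s then eDual m k (s.erase j) w else 0 := by
  obtain ⟨φ, hφ, h1, -⟩ := exists_functionals_e m k
  simp only [eDual, dualVec_eq (hφ _)]
  exact h1 s j w

theorem eDual_h0 (s : Multiset ℕ) (w : Verma m k) :
    eDual m k s (vermaAct m k (mode 0 h) w) = (m + 2 * s.card) * eDual m k s w := by
  obtain ⟨φ, hφ, -, h1⟩ := exists_functionals_e m k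
  simp only [eDual, dualVec_eq (hφ _)]
  exact h1 s w

end DualVectors

/-! ### The action of a pole on the dual vectors -/

section PoleIdentity

variable {V : Type*} [AddCommGroup V] [Module ℂ V] {k m : ℂ} {T : LoopTriple V k}
  {φ : Multiset ℕ → Module.Dual ℂ V}

/-- The sum of `φ {i, j}` over the unordered pairs with `i + j = N`. -/
def pairSum (φ : Multiset ℕ → Module.Dual ℂ V) (N : ℕ) : Module.Dual ℂ V :=
  ∑ p ∈ (Finset.HasAntidiagonal.antidiagonal N).filter (fun p => p.2 ≤ p.1), φ {p.1, p.2}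

/-- Only the pair `{j, N - j}` contributes. -/
theorem pairSum_f (red : ∀ s (j : ℕ) w, φ s (T.f (-(j : ℤ)) w) =
    if j ∈ s then φ (s.erase j) w else 0) (N j : ℕ) (w : V) :
    pairSum φ N (T.f (-(j : ℤ)) w) = if j ≤ N then φ {N - j} w else 0 := by
  rw [pairSum, LinearMap.sum_apply]
  simp only [red]
  split_ifs with hj
  · rw [Finset.sum_eq_single (max j (N - j), min j (N - j))]
    · rcases le_total j (N - j) with h0 | h0
      · rw [max_eq_right h0, min_eq_left h0, if_pos (by simp), Multiset.pair_comm]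
        simp
      · rw [max_eq_left h0, min_eq_right h0, if_pos (by simp)]
        simp
    · rintro ⟨a, b⟩ hab hne
      rw [Finset.mem_filter, Finset.HasAntidiagonal.mem_antidiagonal] at hab
      simp only at hab
      rw [if_neg]
      intro hmem
      apply hne
      simp only [Multiset.insert_eq_cons, Multiset.mem_cons, Multiset.mem_singleton] at hmem
      ext <;> simp <;> grind
    · intro h0
      exfalso
      apply h0
      rw [Finset.mem_filter, Finset.HasAntidiagonal.mem_antidiagonal]
      simp only
      constructor <;> grind
  · refine Finset.sum_eq_zero ?_
    rintro ⟨a, b⟩ hab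
    rw [Finset.mem_filter, Finset.HasAntidiagonal.mem_antidiagonal] at hab
    simp only at hab
    rw [if_neg]
    simp only [Multiset.insert_eq_cons, Multiset.mem_cons, Multiset.mem_singleton]
    grind

/-- The action of a pole of order `a` on the dual vectors.  Both sides have weight `m - 2`, so it
suffices to compare them on the vectors `f/Tʲ w`, where the sums telescope. -/
theorem pole_identity (red : ∀ s (j : ℕ) w, φ s (T.f (-(j : ℤ)) w) =
      if j ∈ s then φ (s.erase j) w else 0)
    (wt : ∀ s w, φ s (T.h 0 w) = (m - 2 * s.card) * φ s w)
    (hh : ∀ (j : ℕ) w, 1 ≤ j → φ 0 (T.h (-(j : ℤ)) w) = 0)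
    (ext : ∀ G : Module.Dual ℂ V, (∀ w, G (T.h 0 w) = (m - 2) * G w) →
      (∀ (j : ℕ) w, G (T.f (-(j : ℤ)) w) = 0) → G = 0) (a : ℕ) (w : V) :
    φ 0 (T.e a w) - ∑ i ∈ Finset.range a, (2 * pairSum φ (a - (i + 1)) (T.f (i + 1 : ℕ) w) +
      φ {a - (i + 1)} (T.h (i + 1 : ℕ) w)) = (m + a * (k + 2)) * φ {a} w := by
  let G : Module.Dual ℂ V := φ 0 ∘ₗ T.e a - ∑ i ∈ Finset.range a,
    ((2 : ℂ) • pairSum φ (a - (i + 1)) ∘ₗ T.f (i + 1 : ℕ) + φ {a - (i + 1)} ∘ₗ T.h (i + 1 : ℕ)) -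
    (m + a * (k + 2)) • φ {a}
  have hG : ∀ w, G w = φ 0 (T.e a w) - ∑ i ∈ Finset.range a,
      (2 * pairSum φ (a - (i + 1)) (T.f (i + 1 : ℕ) w) + φ {a - (i + 1)} (T.h (i + 1 : ℕ) w)) -
      (m + a * (k + 2)) * φ {a} w := fun w => by simp [G]
  suffices h0 : G = 0 by
    have h1 := DFunLike.congr_fun h0 w
    rw [hG, LinearMap.zero_apply] at h1
    exact sub_eq_zero.1 h1
  refine ext G (fun w => ?_) (fun j w => ?_)
  · have e1 : φ 0 (T.e a (T.h 0 w)) = (m - 2) * φ 0 (T.e a w) := by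
      have h1 := congrArg (φ 0) (T.h_e 0 a w)
      rw [wt, map_add, map_smul, zero_add] at h1
      simp at h1
      linear_combination -h1
    have e2 : ∀ N l, pairSum φ N (T.f l (T.h 0 w)) = (m - 2) * pairSum φ N (T.f l w) := by
      intro N l
      simp only [pairSum, LinearMap.sum_apply, Finset.mul_sum]
      refine Finset.sum_congr rfl fun p _ => ?_
      have h1 := congrArg (φ {p.1, p.2}) (T.h_f 0 l w)
      rw [wt, map_sub, map_smul, zero_add] at h1
      simp at h1
      linear_combination -h1
    have e3 : ∀ N (i : ℕ), φ {N} (T.h (i + 1 : ℕ) (T.h 0 w)) = (m - 2) * φ {N} (T.h (i + 1 : ℕ) w) := by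
      intro N i
      rw [T.h_h, if_neg (by lia), zero_smul, add_zero, wt]
      simp
    rw [hG, hG, e1, wt, mul_sub, mul_sub, Finset.mul_sum]
    simp only [e2, e3]
    congr 1
    · congr 1
      exact Finset.sum_congr rfl fun i _ => by ring
    · simp; ring
  · have e1 : φ 0 (T.e a (T.f (-(j : ℤ)) w)) =
        φ 0 (T.h ((a : ℤ) - j) w) + (if a = j then a * k else 0) * φ 0 w := by
      rw [T.e_f, map_add, map_add, red, if_neg (by simp), map_smul, zero_add, ← sub_eq_add_neg]
      congr 1
      by_cases h1 : a = j
      · simp [h1]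
      · rw [if_neg (by lia), if_neg h1, zero_smul, zero_mul]
    have e2 : ∀ N l, pairSum φ N (T.f l (T.f (-(j : ℤ)) w)) =
        if j ≤ N then φ {N - j} (T.f l w) else 0 := fun N l => by rw [T.f_f, pairSum_f red]
    have e3 : ∀ N (i : ℕ), φ {N} (T.h i (T.f (-(j : ℤ)) w)) =
        (if j = N then φ 0 (T.h i w) else 0) - 2 * φ {N} (T.f ((i : ℤ) - j) w) := fun N i => by
      rw [T.h_f, map_sub, red, map_smul, smul_eq_mul, ← sub_eq_add_neg]
      simp only [Multiset.mem_singleton]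
      congr 1
      by_cases h1 : j = N
      · simp [h1]
      · simp [h1]
    have e4 : ∀ i < j, φ {a - (i + 1)} (T.f (((i + 1 : ℕ) : ℤ) - j) w) =
        if a - (i + 1) = j - (i + 1) then φ 0 w else 0 := fun i hi => by
      rw [show ((i + 1 : ℕ) : ℤ) - j = -((j - (i + 1) : ℕ) : ℤ) by lia, red]
      simp only [Multiset.mem_singleton]
      by_cases h1 : a - (i + 1) = j - (i + 1)
      · simp [h1]
      · rw [if_neg h1, if_neg (Ne.symm h1)]
    rw [hG, e1, red]
    simp only [e2, e3, Multiset.mem_singleton]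
    rcases lt_trichotomy j a with hja | rfl | hja
    · obtain ⟨b, rfl⟩ := Nat.exists_eq_add_of_lt hja
      have s1 : ∑ i ∈ Finset.range (j + b + 1), (if j ≤ j + b + 1 - (i + 1) then
          φ {j + b + 1 - (i + 1) - j} (T.f (i + 1 : ℕ) w) else 0) =
          ∑ i ∈ Finset.range (b + 1), φ {b - i} (T.f (i + 1 : ℕ) w) := by
        rw [show j + b + 1 = (b + 1) + j by ring, Finset.sum_range_add, add_eq_left.2]
        · refine Finset.sum_congr rfl fun i hi => ?_
          rw [Finset.mem_range] at hi
          rw [if_pos (by lia), show b + 1 + j - (i + 1) - j = b - i by lia]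
        · refine Finset.sum_eq_zero fun i hi => ?_
          rw [Finset.mem_range] at hi
          rw [if_neg (by lia)]
      have s2 : ∑ i ∈ Finset.range (j + b + 1),
          φ {j + b + 1 - (i + 1)} (T.f (((i + 1 : ℕ) : ℤ) - j) w) =
          ∑ i ∈ Finset.range (b + 1), φ {b - i} (T.f (i + 1 : ℕ) w) := by
        rw [add_assoc, Finset.sum_range_add, add_eq_right.2]
        · refine Finset.sum_congr rfl fun i hi => ?_
          rw [Finset.mem_range] at hi
          rw [show j + (b + 1) - (j + i + 1) = b - i by lia,
            show ((j + i + 1 : ℕ) : ℤ) - j = ((i + 1 : ℕ) : ℤ) by push_cast; ring]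
        · refine Finset.sum_eq_zero fun i hi => ?_
          rw [Finset.mem_range] at hi
          rw [← add_assoc, e4 i hi, if_neg (by lia)]
      have s3 : ∑ i ∈ Finset.range (j + b + 1), (if j = j + b + 1 - (i + 1) then
          φ 0 (T.h (i + 1 : ℕ) w) else 0) = φ 0 (T.h (((j + b + 1 : ℕ) : ℤ) - j) w) := by
        rw [Finset.sum_eq_single b]
        · rw [if_pos (by lia)]
          congr 3; push_cast; ring
        · intro i hi hib
          rw [Finset.mem_range] at hi
          rw [if_neg (by lia)]
        · exact fun h1 => absurd (Finset.mem_range.2 (by lia)) h1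
      rw [if_neg (by lia), if_neg (by lia)]
      simp only [Finset.sum_add_distrib, Finset.sum_sub_distrib, ← Finset.mul_sum, s1, s2, s3]
      ring
    · have s1 : ∑ i ∈ Finset.range j, (2 * (if j ≤ j - (i + 1) then
          φ {j - (i + 1) - j} (T.f (i + 1 : ℕ) w) else 0) +
          ((if j = j - (i + 1) then φ 0 (T.h (i + 1 : ℕ) w) else 0) -
            2 * φ {j - (i + 1)} (T.f (((i + 1 : ℕ) : ℤ) - j) w))) = -(2 * j * φ 0 w) := by
        rw [Finset.sum_congr rfl (g := fun _ => -(2 * φ 0 w))]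
        · simp; ring
        · intro i hi
          rw [Finset.mem_range] at hi
          rw [if_neg (by lia), if_neg (by lia), e4 i hi, if_pos rfl]
          ring
      rw [s1, sub_self, wt]
      simp
      ring
    · have s1 : ∑ i ∈ Finset.range a, (2 * (if j ≤ a - (i + 1) then
          φ {a - (i + 1) - j} (T.f (i + 1 : ℕ) w) else 0) +
          ((if j = a - (i + 1) then φ 0 (T.h (i + 1 : ℕ) w) else 0) -
            2 * φ {a - (i + 1)} (T.f (((i + 1 : ℕ) : ℤ) - j) w))) = 0 := by
        refine Finset.sum_eq_zero fun i hi => ?_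
        rw [Finset.mem_range] at hi
        rw [if_neg (by lia), if_neg (by lia), e4 i (by lia), if_neg (by lia)]
        ring
      rw [s1, if_neg (by lia), if_neg (by lia), show (a : ℤ) - j = -((j - a : ℕ) : ℤ) by lia,
        hh _ _ (by lia)]
      ring

end PoleIdentity

section VermaIdentities

variable {m k : ℂ}

/-- The identity for a pole of order `a` at a finite point. -/
theorem fDual_pole (a : ℕ) (w : Verma m k) :
    fDual m k 0 (vermaAct m k (mode a e) w) - ∑ i ∈ Finset.range a,
      (2 * pairSum (fDual m k) (a - (i + 1)) (vermaAct m k (mode (i + 1 : ℕ) f) w) +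
        fDual m k {a - (i + 1)} (vermaAct m k (mode (i + 1 : ℕ) h) w)) =
      (m + a * (k + 2)) * fDual m k {a} w :=
  pole_identity (T := vermaTriple m k) (fun s j w => fDual_f s j w) (fun s w => fDual_h0 s w)
    (fun _ w hj => fDual_zero_h hj w) (fun _ hG hf => eq_zero_of_weight_f hG hf) a w

/-- The identity for a pole of order `a + 1` at infinity: the previous one for the weight `k - m`,
transported by the automorphism interchanging `f₁` and `f₂`. -/
theorem eDual_pole (a : ℕ) (w : Verma m k) :
    eDual m k 0 (vermaAct m k (mode (a + 1 : ℕ) f) w) - ∑ i ∈ Finset.range a,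
      (2 * pairSum (eDual m k) (a - (i + 1)) (vermaAct m k (mode i e) w) -
        eDual m k {a - (i + 1)} (vermaAct m k (mode (i + 1 : ℕ) h) w)) =
      (k - m + a * (k + 2)) * eDual m k {a} w := by
  have h0 : ∀ w, (vermaTriple m k).swap.h 0 w = -vermaAct m k (mode 0 h) w + k • w := fun w => by
    simp [LoopTriple.swap, vermaTriple]
  have h1 : ∀ (j : ℤ) w, j ≠ 0 → (vermaTriple m k).swap.h j w = -vermaAct m k (mode j h) w :=
    fun j w hj => by simp [LoopTriple.swap, vermaTriple, hj]
  have key := pole_identity (T := (vermaTriple m k).swap) (φ := eDual m k) (m := k - m)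
    (fun s j w => eDual_e s j w)
    (fun s w => by rw [h0, map_add, map_neg, map_smul, eDual_h0, smul_eq_mul]; ring)
    (fun j w hj => by rw [h1 _ _ (by lia), map_neg, eDual_zero, fDual_zero_h hj, neg_zero])
    (fun G hG hf => eq_zero_of_weight_e (fun w => by
      have := hG w
      rw [h0, map_add, map_neg, map_smul, smul_eq_mul] at this
      linear_combination -this) hf) a w
  rw [← key]
  congr 1
  refine Finset.sum_congr rfl fun i _ => ?_
  rw [h1 _ _ (by lia), map_neg, sub_eq_add_neg]
  simp only [LoopTriple.swap, vermaTriple]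
  push_cast
  rw [add_sub_cancel_right]

/-- In the contragradient module this is the relation `f v^* = m (f v)^*`. -/
theorem fDual_zero_e0 (w : Verma m k) :
    fDual m k 0 (vermaAct m k (mode 0 e) w) = m * fDual m k {0} w := by
  simpa using fDual_pole 0 w

end VermaIdentities

/-! ### Partial fractions and Laurent expansions -/

section PartialFractions

variable {n : ℕ} {z : Fin n → ℂ}

theorem X_sub_C_ne_zero (c : ℂ) : (RatFunc.X - RatFunc.C c : RatFunc ℂ) ≠ 0 := by
  rw [← RatFunc.algebraMap_X, ← RatFunc.algebraMap_C, ← map_sub]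
  exact RatFunc.algebraMap_ne_zero (Polynomial.X_sub_C_ne_zero c)

theorem coordT_mul_invT (i : Fin n) : coordT z * invT z i = 1 + z i • invT z i := by
  apply Subtype.ext
  change RatFunc.X * (RatFunc.X - RatFunc.C (z i))⁻¹ =
    1 + z i • (RatFunc.X - RatFunc.C (z i))⁻¹
  have h0 := X_sub_C_ne_zero (z i)
  rw [RatFunc.smul_eq_C_mul]
  field_simp
  ring

theorem invT_mul_invT {i p : Fin n} (hip : z i ≠ z p) :
    invT z i * invT z p = (z i - z p)⁻¹ • (invT z i - invT z p) := by
  rw [eq_inv_smul_iff₀ (sub_ne_zero.2 hip)]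
  apply Subtype.ext
  change (z i - z p) • ((RatFunc.X - RatFunc.C (z i))⁻¹ * (RatFunc.X - RatFunc.C (z p))⁻¹) =
    (RatFunc.X - RatFunc.C (z i))⁻¹ - (RatFunc.X - RatFunc.C (z p))⁻¹
  have h0 := X_sub_C_ne_zero (z i)
  have h1 := X_sub_C_ne_zero (z p)
  rw [RatFunc.smul_eq_C_mul, map_sub]
  field_simp
  ring

/-- Partial fractions of `1 / ((t - z_i) (t - z_p)^a)` for `z_i ≠ z_p`. -/
theorem invT_mul_invT_pow {i p : Fin n} (hip : z i ≠ z p) (a : ℕ) :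
    invT z i * invT z p ^ a = (z i - z p)⁻¹ ^ a • invT z i -
      ∑ l ∈ Finset.range a, (z i - z p)⁻¹ ^ (l + 1) • invT z p ^ (a - l) := by
  induction a with
  | zero => simp
  | succ a ih =>
    have h1 : invT z i * invT z p ^ (a + 1) = (z i - z p)⁻¹ • (invT z i * invT z p ^ a) -
        (z i - z p)⁻¹ • invT z p ^ (a + 1) := by
      rw [pow_succ' (invT z p), ← mul_assoc, invT_mul_invT hip, smul_mul_assoc, sub_mul, smul_sub]
    rw [h1, ih, Finset.sum_range_succ', smul_sub, Finset.smul_sum, smul_smul, ← pow_succ',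
      sub_sub]
    congr 2
    · refine Finset.sum_congr rfl fun l _ => ?_
      rw [smul_smul, ← pow_succ', Nat.add_sub_add_right]
    · simp

/-- Division of `t^a` by `t - z_i` with remainder. -/
theorem coordT_pow_mul_invT (i : Fin n) (a : ℕ) :
    coordT z ^ a * invT z i = z i ^ a • invT z i +
      ∑ r ∈ Finset.range a, z i ^ r • coordT z ^ (a - 1 - r) := by
  induction a with
  | zero => simp
  | succ a ih =>
    rw [pow_succ, mul_assoc, coordT_mul_invT, mul_add, mul_one, mul_smul_comm, ih,
      Finset.sum_range_succ', smul_add, Finset.smul_sum, smul_smul, ← pow_succ']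
    have h1 : ∀ r, z i • z i ^ r • coordT z ^ (a - 1 - r) =
        z i ^ (r + 1) • coordT z ^ (a + 1 - 1 - (r + 1)) := fun r => by
      rw [smul_smul, ← pow_succ']
      congr 2
      lia
    simp only [h1, pow_zero, one_smul, Nat.add_sub_cancel, Nat.sub_zero]
    abel

theorem coe_deRham (u : Omega0 z) : (deRham z u).1 = derivFun u.1 := rfl

theorem deRham_coordT_pow (a : ℕ) : deRham z (coordT z ^ a) = (a : ℂ) • coordT z ^ (a - 1) := by
  apply Subtype.ext
  rw [coe_deRham, Subalgebra.coe_smul, Subalgebra.coe_pow, Subalgebra.coe_pow, coordT]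
  have h0 : (RatFunc.X ^ a : RatFunc ℂ) =
      algebraMap (Polynomial ℂ) _ (Polynomial.X ^ a) / algebraMap (Polynomial ℂ) _ 1 := by simp
  rw [h0, derivFun_div _ _ one_ne_zero, Polynomial.derivative_X_pow]
  simp [RatFunc.smul_eq_C_mul]

theorem deRham_invT_pow (i : Fin n) (a : ℕ) :
    deRham z (invT z i ^ a) = -((a : ℂ) • invT z i ^ (a + 1)) := by
  apply Subtype.ext
  rw [coe_deRham, Subalgebra.coe_neg, Subalgebra.coe_smul, Subalgebra.coe_pow, Subalgebra.coe_pow,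
    invT]
  have h0 : ((RatFunc.X - RatFunc.C (z i))⁻¹ ^ a : RatFunc ℂ) =
      algebraMap (Polynomial ℂ) _ 1 /
        algebraMap (Polynomial ℂ) _ ((Polynomial.X - Polynomial.C (z i)) ^ a) := by simp
  rw [h0, derivFun_div _ _ (pow_ne_zero _ (Polynomial.X_sub_C_ne_zero _))]
  have h1 := X_sub_C_ne_zero (z i)
  rcases a with _ | a
  · simp
  · simp [RatFunc.smul_eq_C_mul, Polynomial.derivative_X_sub_C_pow]
    field_simp
    ring

/-- The partial fractions `1/(t - z_i)^(a+1)` and `t^a`. -/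
def partialFraction (z : Fin n → ℂ) : (Fin n × ℕ) ⊕ ℕ → Omega0 z :=
  Sum.elim (fun p => invT z p.1 ^ (p.2 + 1)) (fun a => coordT z ^ a)

theorem coordT_pow_mem (a : ℕ) :
    coordT z ^ a ∈ Submodule.span ℂ (Set.range (partialFraction z)) :=
  Submodule.subset_span ⟨Sum.inr a, rfl⟩

theorem invT_pow_mem (i : Fin n) (a : ℕ) :
    invT z i ^ a ∈ Submodule.span ℂ (Set.range (partialFraction z)) := by
  rcases a with _ | a
  · simpa using coordT_pow_mem (z := z) 0
  · exact Submodule.subset_span ⟨Sum.inl (i, a), rfl⟩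

theorem invT_mul_mem (hz : Function.Injective z) (i : Fin n) {u : Omega0 z}
    (hu : u ∈ Submodule.span ℂ (Set.range (partialFraction z))) :
    invT z i * u ∈ Submodule.span ℂ (Set.range (partialFraction z)) := by
  induction hu using Submodule.span_induction with
  | mem u hu =>
    obtain ⟨⟨p, a⟩ | a, rfl⟩ := hu
    · change invT z i * invT z p ^ (a + 1) ∈ _
      by_cases hip : i = p
      · subst hip
        rw [← pow_succ']
        exact invT_pow_mem i _
      · rw [invT_mul_invT_pow (hz.ne hip)]
        refine sub_mem (Submodule.smul_mem _ _ (by simpa using invT_pow_mem i 1)) ?_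
        exact sum_mem fun l _ => Submodule.smul_mem _ _ (invT_pow_mem p _)
    · change invT z i * coordT z ^ a ∈ _
      rw [mul_comm, coordT_pow_mul_invT]
      refine add_mem (Submodule.smul_mem _ _ (by simpa using invT_pow_mem i 1)) ?_
      exact sum_mem fun l _ => Submodule.smul_mem _ _ (coordT_pow_mem _)
  | zero => rw [mul_zero]; exact zero_mem _
  | add u v _ _ hu hv => rw [mul_add]; exact add_mem hu hv
  | smul c u _ hu => rw [mul_smul_comm]; exact Submodule.smul_mem _ _ hu

/-- Fractions whose denominator is a product of factors `t - z_i` are combinations of partial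
fractions. -/
theorem exists_mem_span_eq_div (hz : Function.Injective z) (p : Polynomial ℂ) (s : Multiset ℂ)
    (hs : ∀ r ∈ s, ∃ i, r = z i) :
    ∃ u ∈ Submodule.span ℂ (Set.range (partialFraction z)),
      u.1 = algebraMap (Polynomial ℂ) (RatFunc ℂ) p /
        algebraMap (Polynomial ℂ) (RatFunc ℂ)
          (s.map fun r => Polynomial.X - Polynomial.C r).prod := by
  induction s using Multiset.induction_on with
  | empty =>
    refine ⟨Polynomial.aeval (coordT z) p, ?_, ?_⟩
    · rw [Polynomial.aeval_eq_sum_range]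
      exact sum_mem fun a _ => Submodule.smul_mem _ _ (coordT_pow_mem a)
    · have h1 := Polynomial.aeval_algHom_apply (Omega0 z).val (coordT z) p
      change _ = (Polynomial.aeval (coordT z) p : Omega0 z).1 at h1
      rw [← h1]
      change Polynomial.aeval RatFunc.X p = _
      rw [← RatFunc.algebraMap_X, Polynomial.aeval_algebraMap_apply]
      simp
  | cons r s ih =>
    obtain ⟨u, hu, huv⟩ := ih fun r hr => hs r (Multiset.mem_cons_of_mem hr)
    obtain ⟨i, rfl⟩ := hs r (Multiset.mem_cons_self _ _)
    refine ⟨invT z i * u, invT_mul_mem hz i hu, ?_⟩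
    change (RatFunc.X - RatFunc.C (z i))⁻¹ * u.1 = _
    rw [huv, Multiset.map_cons, Multiset.prod_cons, map_mul, map_sub, RatFunc.algebraMap_X,
      RatFunc.algebraMap_C, inv_mul_eq_div, div_div, mul_comm]

theorem span_partialFraction (hz : Function.Injective z) :
    Submodule.span ℂ (Set.range (partialFraction z)) = ⊤ := by
  refine eq_top_iff.2 fun u _ => ?_
  have h1 : (u.1.denom.roots.map fun r => Polynomial.X - Polynomial.C r).prod = u.1.denom :=
    ((IsAlgClosed.splits u.1.denom).eq_prod_roots_of_monic (RatFunc.monic_denom u.1)).symm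
  obtain ⟨v, hv, huv⟩ := exists_mem_span_eq_div hz u.1.num u.1.denom.roots fun r hr => by
    by_contra! hne
    exact u.2 r hne (Polynomial.isRoot_of_mem_roots hr)
  rw [h1, RatFunc.num_div_denom] at huv
  exact Subtype.ext huv ▸ hv

/-- The rational function `u` is regular at the point labelled by `j`, with value `r` there. -/
def RegularAt (z : Fin n → ℂ) (j : Option (Fin n)) (u : RatFunc ℂ) (r : ℂ) : Prop :=
  ∃ P : PowerSeries ℂ, expand z j u = HahnSeries.ofPowerSeries ℤ ℂ P ∧
    PowerSeries.constantCoeff P = r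

namespace RegularAt

variable {j : Option (Fin n)} {u v : RatFunc ℂ} {r s : ℂ}

theorem mul (hu : RegularAt z j u r) (hv : RegularAt z j v s) : RegularAt z j (u * v) (r * s) := by
  obtain ⟨P, hP, rfl⟩ := hu
  obtain ⟨Q, hQ, rfl⟩ := hv
  exact ⟨P * Q, by rw [map_mul, map_mul, hP, hQ], map_mul _ _ _⟩

theorem pow (hu : RegularAt z j u r) (a : ℕ) : RegularAt z j (u ^ a) (r ^ a) := by
  induction a with
  | zero => exact ⟨1, by simp, by simp⟩
  | succ a ih => rw [pow_succ, pow_succ]; exact ih.mul hu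

theorem laurentCoeff_zero (hu : RegularAt z j u r) : laurentCoeff z j 0 u = r := by
  obtain ⟨P, hP, rfl⟩ := hu
  change (expand z j u).coeff 0 = _
  rw [hP]
  simpa using HahnSeries.ofPowerSeries_apply_coeff (Γ := ℤ) P 0

theorem laurentCoeff_neg (hu : RegularAt z j u r) {s : ℤ} (hs : s < 0) :
    laurentCoeff z j s u = 0 := by
  obtain ⟨P, hP, rfl⟩ := hu
  change (expand z j u).coeff s = _
  rw [hP, PowerSeries.coeff_coe, if_pos hs]

end RegularAt

theorem expand_some_X (i : Fin n) :
    expand z (some i) RatFunc.X = HahnSeries.C (z i) + HahnSeries.single 1 1 := by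
  have h0 : (RatFunc.X : RatFunc ℂ) = algebraMap (Polynomial ℂ) _ Polynomial.X /
      algebraMap (Polynomial ℂ) _ 1 := by simp
  rw [h0, expand, expandAt, RatFunc.liftRingHom_apply_div]
  simp

theorem expand_none_X : expand z none RatFunc.X = HahnSeries.single (-1) 1 := by
  have h0 : (RatFunc.X : RatFunc ℂ) = algebraMap (Polynomial ℂ) _ Polynomial.X /
      algebraMap (Polynomial ℂ) _ 1 := by simp
  rw [h0, expand, expandInfty, RatFunc.liftRingHom_apply_div]
  simp

/-- At `z_i` the function `1/(t - z_i)ᵃ` is the monomial `T⁻ᵃ`. -/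
theorem expand_invT_pow_self (i : Fin n) (a : ℕ) :
    expand z (some i) ((invT z i).1 ^ a) = HahnSeries.single (-(a : ℤ)) 1 := by
  rw [invT, map_pow, map_inv₀, map_sub, expand_some_X, expand_C, add_sub_cancel_left]
  rw [inv_eq_of_mul_eq_one_right (b := HahnSeries.single (-1) (1 : ℂ)) (by simp),
    HahnSeries.single_pow]
  simp

/-- At `∞` the function `tᵃ` is the monomial `T⁻ᵃ`. -/
theorem expand_coordT_pow (a : ℕ) :
    expand z none ((coordT z).1 ^ a) = HahnSeries.single (-(a : ℤ)) 1 := by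
  rw [coordT, map_pow, expand_none_X, HahnSeries.single_pow]
  simp

theorem regularAt_invT {i p : Fin n} (hip : z i ≠ z p) :
    RegularAt z (some i) (invT z p).1 (z i - z p)⁻¹ := by
  refine ⟨(PowerSeries.C (z i - z p) + PowerSeries.X)⁻¹, ?_, by simp⟩
  rw [invT, map_inv₀, map_sub, expand_some_X, expand_C]
  refine inv_eq_of_mul_eq_one_right ?_
  have h1 : (HahnSeries.C (z i) + HahnSeries.single 1 1 - HahnSeries.C (z p) : LaurentSeries ℂ) =
      HahnSeries.ofPowerSeries ℤ ℂ (PowerSeries.C (z i - z p) + PowerSeries.X) := by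
    rw [map_add, HahnSeries.ofPowerSeries_C, HahnSeries.ofPowerSeries_X, map_sub]
    ring
  rw [h1, ← map_mul, PowerSeries.mul_inv_cancel _ (by simpa using sub_ne_zero.2 hip), map_one]

theorem regularAt_none_invT (i : Fin n) : RegularAt z none (invT z i).1 0 := by
  -- `1/(T⁻¹ - z) = T/(1 - zT)`
  refine ⟨PowerSeries.X * (1 - PowerSeries.C (z i) * PowerSeries.X)⁻¹, ?_, by simp⟩
  rw [invT, map_inv₀, map_sub, expand_none_X, expand_C]
  refine inv_eq_of_mul_eq_one_right ?_
  have h1 : (HahnSeries.single (-1) 1 - HahnSeries.C (z i) : LaurentSeries ℂ) *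
      HahnSeries.ofPowerSeries ℤ ℂ PowerSeries.X =
      HahnSeries.ofPowerSeries ℤ ℂ (1 - PowerSeries.C (z i) * PowerSeries.X) := by
    rw [map_sub, map_mul, (HahnSeries.ofPowerSeries ℤ ℂ).map_one, HahnSeries.ofPowerSeries_C,
      HahnSeries.ofPowerSeries_X, sub_mul, HahnSeries.single_mul_single]
    simp
  rw [map_mul, ← mul_assoc, h1, ← map_mul, PowerSeries.mul_inv_cancel _ (by simp), map_one]

theorem regularAt_coordT (i : Fin n) : RegularAt z (some i) (coordT z).1 (z i) := by
  refine ⟨PowerSeries.C (z i) + PowerSeries.X, ?_, by simp⟩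
  rw [coordT, expand_some_X, map_add, HahnSeries.ofPowerSeries_C, HahnSeries.ofPowerSeries_X]

theorem laurentCoeff_of_expand_single {j : Option (Fin n)} {u : RatFunc ℂ} {d : ℤ}
    (hu : expand z j u = HahnSeries.single d 1) (s : ℤ) :
    laurentCoeff z j s u = if s = d then 1 else 0 := by
  change (expand z j u).coeff s = _
  rw [hu, HahnSeries.coeff_single]
  congr

theorem linearIndependent_partialFraction (hz : Function.Injective z) :
    LinearIndependent ℂ (partialFraction z) := by
  -- the functionals are the coefficients of the principal parts at `z₁, …, zₙ, ∞`
  refine LinearIndependent.of_pairwise_dual_eq_zero_one (partialFraction z)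
    (Sum.elim (fun p => laurentCoeff z (some p.1) (-((p.2 + 1 : ℕ) : ℤ)) ∘ₗ (Omega0 z).val.toLinearMap)
      (fun a => laurentCoeff z none (-(a : ℤ)) ∘ₗ (Omega0 z).val.toLinearMap)) ?_ ?_
  · rintro (⟨i, a⟩ | a) (⟨p, b⟩ | b) hne
    · change laurentCoeff z (some i) (-((a + 1 : ℕ) : ℤ)) ((invT z p).1 ^ (b + 1)) = 0
      by_cases hip : i = p
      · subst hip
        have : a ≠ b := fun h1 => hne (by rw [h1])
        rw [laurentCoeff_of_expand_single (expand_invT_pow_self i (b + 1)), if_neg (by lia)]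
      · exact ((regularAt_invT (hz.ne hip)).pow _).laurentCoeff_neg (by lia)
    · change laurentCoeff z (some i) (-((a + 1 : ℕ) : ℤ)) ((coordT z).1 ^ b) = 0
      exact ((regularAt_coordT i).pow _).laurentCoeff_neg (by lia)
    · change laurentCoeff z none (-(a : ℤ)) ((invT z p).1 ^ (b + 1)) = 0
      have h1 := (regularAt_none_invT (z := z) p).pow (b + 1)
      rcases a with _ | a
      · simpa using h1.laurentCoeff_zero
      · exact h1.laurentCoeff_neg (by lia)
    · change laurentCoeff z none (-(a : ℤ)) ((coordT z).1 ^ b) = 0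
      have : a ≠ b := fun h1 => hne (by rw [h1])
      rw [laurentCoeff_of_expand_single (expand_coordT_pow b), if_neg (by lia)]
  · rintro (⟨i, a⟩ | a)
    · change laurentCoeff z (some i) (-((a + 1 : ℕ) : ℤ)) ((invT z i).1 ^ (a + 1)) = 1
      rw [laurentCoeff_of_expand_single (expand_invT_pow_self i (a + 1)), if_pos rfl]
    · change laurentCoeff z none (-(a : ℤ)) ((coordT z).1 ^ a) = 1
      rw [laurentCoeff_of_expand_single (expand_coordT_pow a), if_pos rfl]

/-- The basis of `Ω⁰(U)` given by the partial fraction decomposition. -/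
def partialFractionBasis (hz : Function.Injective z) : Module.Basis ((Fin n × ℕ) ⊕ ℕ) ℂ (Omega0 z) :=
  Module.Basis.mk (linearIndependent_partialFraction hz) (span_partialFraction hz).ge

theorem partialFractionBasis_inl (hz : Function.Injective z) (i : Fin n) (a : ℕ) :
    partialFractionBasis hz (Sum.inl (i, a)) = invT z i ^ (a + 1) := by
  rw [partialFractionBasis, Module.Basis.mk_apply]; rfl

theorem partialFractionBasis_inr (hz : Function.Injective z) (a : ℕ) :
    partialFractionBasis hz (Sum.inr a) = coordT z ^ a := by
  rw [partialFractionBasis, Module.Basis.mk_apply]; rfl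

end PartialFractions

/-! ### The local actions on the contragradient modules -/

section ContraVectors

variable {m k : ℂ}

/-- The vector `v^*`. -/
def vacDual (m k : ℂ) : Contra m k := dualVec m k idxV

/-- The vector `(f/Tᵃ v)^*`. -/
def poleDual (m k : ℂ) (a : ℕ) : Contra m k := dualVec m k (idxF a)

/-- The vector `(e/T^(a+1) v)^*`. -/
def inftyDual (m k : ℂ) (a : ℕ) : Contra m k := dualVec m k (idxE (a + 1))

/-- The sum of the vectors `((f/Tⁱ)(f/Tʲ) v)^*` over `i + j = N`, `i ≥ j`. -/
def polePairDual (m k : ℂ) (N : ℕ) : Contra m k :=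
  ∑ p ∈ (Finset.HasAntidiagonal.antidiagonal N).filter (fun p => p.2 ≤ p.1),
    dualVec m k (idxFF p.1 p.2)

/-- The sum of the vectors `((e/T^(i+1))(e/T^(j+1)) v)^*` over `i + j = N`, `i ≥ j`. -/
def inftyPairDual (m k : ℂ) (N : ℕ) : Contra m k :=
  ∑ p ∈ (Finset.HasAntidiagonal.antidiagonal N).filter (fun p => p.2 ≤ p.1),
    dualVec m k (idxEE (p.1 + 1) (p.2 + 1))

theorem vacDual_apply (w : Verma m k) : (vacDual m k).1 w = fDual m k 0 w := rfl

theorem poleDual_apply (a : ℕ) (w : Verma m k) : (poleDual m k a).1 w = fDual m k {a} w := rfl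

theorem inftyDual_apply (a : ℕ) (w : Verma m k) : (inftyDual m k a).1 w = eDual m k {a} w := by
  rw [eDual, Multiset.map_singleton]; rfl

theorem polePairDual_apply (N : ℕ) (w : Verma m k) :
    (polePairDual m k N).1 w = pairSum (fDual m k) N w := by
  rw [polePairDual, pairSum, Submodule.coe_sum]
  rfl

theorem inftyPairDual_apply (N : ℕ) (w : Verma m k) :
    (inftyPairDual m k N).1 w = pairSum (eDual m k) N w := by
  rw [inftyPairDual, pairSum, Submodule.coe_sum]
  simp only [eDual, Multiset.insert_eq_cons, Multiset.map_cons, Multiset.map_singleton]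
  rfl

theorem contra_ext {φ ψ : Contra m k} (h1 : ∀ w, φ.1 w = ψ.1 w) : φ = ψ :=
  Subtype.ext (LinearMap.ext h1)

theorem contraAct_mode_e (s : ℤ) (φ : Contra m k) (w : Verma m k) :
    (contraAct m k (mode s e) φ).1 w = φ.1 (vermaAct m k (mode (-s) f) w) := by
  rw [contraAct_apply, tau_mode, sl2Transpose_e]

theorem contraAct_mode_f (s : ℤ) (φ : Contra m k) (w : Verma m k) :
    (contraAct m k (mode s f) φ).1 w = φ.1 (vermaAct m k (mode (-s) e) w) := by
  rw [contraAct_apply, tau_mode, sl2Transpose_f]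

theorem contraAct_mode_h (s : ℤ) (φ : Contra m k) (w : Verma m k) :
    (contraAct m k (mode s h) φ).1 w = φ.1 (vermaAct m k (mode (-s) h) w) := by
  rw [contraAct_apply, tau_mode, sl2Transpose_h]

theorem mode_e_vacDual {s : ℤ} (hs : 0 ≤ s) : contraAct m k (mode s e) (vacDual m k) = 0 :=
  contra_ext fun w => by
    lift s to ℕ using hs
    rw [contraAct_mode_e, vacDual_apply, fDual_f, if_neg (by simp)]
    rfl

theorem mode_f_vacDual {s : ℤ} (hs : 1 ≤ s) : contraAct m k (mode s f) (vacDual m k) = 0 :=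
  contra_ext fun w => by
    lift s to ℕ using (by lia)
    rw [contraAct_mode_f, vacDual_apply, fDual_zero_e (by lia)]
    rfl

theorem mode_f_zero_vacDual : contraAct m k (mode 0 f) (vacDual m k) = m • poleDual m k 0 :=
  contra_ext fun w => by
    rw [contraAct_mode_f, vacDual_apply, neg_zero, fDual_zero_e0]
    rfl

theorem mode_h_vacDual {s : ℤ} (hs : 1 ≤ s) : contraAct m k (mode s h) (vacDual m k) = 0 :=
  contra_ext fun w => by
    lift s to ℕ using (by lia)
    rw [contraAct_mode_h, vacDual_apply, fDual_zero_h (by lia)]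
    rfl

theorem mode_h_zero_vacDual : contraAct m k (mode 0 h) (vacDual m k) = m • vacDual m k :=
  contra_ext fun w => by
    rw [contraAct_mode_h, vacDual_apply, neg_zero, fDual_h0]
    simp [vacDual_apply]

/-- The identity in the contragradient module behind the formula for `η⁰(1/(t - z_p)ᵃ)`. -/
theorem contraAct_pole (a : ℕ) :
    contraAct m k (mode (-(a : ℤ)) f) (vacDual m k) - ∑ i ∈ Finset.range a,
      ((2 : ℂ) • contraAct m k (mode (-((i + 1 : ℕ) : ℤ)) e) (polePairDual m k (a - (i + 1))) +
        contraAct m k (mode (-((i + 1 : ℕ) : ℤ)) h) (poleDual m k (a - (i + 1)))) =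
      (m + a * (k + 2)) • poleDual m k a := by
  refine contra_ext fun w => ?_
  have key := fDual_pole (m := m) (k := k) a w
  rw [Submodule.coe_sub, Submodule.coe_sum, LinearMap.sub_apply, LinearMap.sum_apply]
  simp only [Submodule.coe_add, Submodule.coe_smul, LinearMap.add_apply, LinearMap.smul_apply,
    contraAct_mode_f, contraAct_mode_e, contraAct_mode_h, neg_neg, vacDual_apply, poleDual_apply,
    polePairDual_apply, smul_eq_mul]
  exact key

/-- The identity in the contragradient module behind the formula for `η⁰(t^(b+1))`. -/
theorem contraAct_infty (b : ℕ) :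
    contraAct m k (mode (-((b + 1 : ℕ) : ℤ)) e) (vacDual m k) - ∑ i ∈ Finset.range b,
      ((2 : ℂ) • contraAct m k (mode (-(i : ℤ)) f) (inftyPairDual m k (b - (i + 1))) -
        contraAct m k (mode (-((i + 1 : ℕ) : ℤ)) h) (inftyDual m k (b - (i + 1)))) =
      (k - m + b * (k + 2)) • inftyDual m k b := by
  refine contra_ext fun w => ?_
  have key := eDual_pole (m := m) (k := k) b w
  rw [Submodule.coe_sub, Submodule.coe_sum, LinearMap.sub_apply, LinearMap.sum_apply]
  simp only [Submodule.coe_sub, Submodule.coe_smul, LinearMap.sub_apply, LinearMap.smul_apply,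
    contraAct_mode_f, contraAct_mode_e, contraAct_mode_h, neg_neg, vacDual_apply, inftyDual_apply,
    inftyPairDual_apply, smul_eq_mul]
  push_cast at key ⊢
  exact key

end ContraVectors

section LaurentActions

variable {n : ℕ} {z : Fin n → ℂ} {W : Type*} [AddCommGroup W] [Module ℂ W]
  {A : Affine →ₗ[ℂ] Module.End ℂ W} (hA : FinitenessProperty A) {j : Option (Fin n)}

/-- If the positive modes kill `w`, a function regular at the point acts through its value. -/
theorem laurentAct_of_regularAt {u : Omega0 z} {r : ℂ} (hu : RegularAt z j u.1 r) {x : Sl2}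
    {w : W} (hw : ∀ s : ℤ, 1 ≤ s → A (mode s x) w = 0) :
    laurentAct A hA z j (u ⊗ₜ x) w = r • A (mode 0 x) w := by
  rw [laurentAct_apply, finsum_eq_single _ 0, hu.laurentCoeff_zero]
  intro s hs
  rcases lt_or_gt_of_ne hs with hs | hs
  · rw [hu.laurentCoeff_neg hs, zero_smul]
  · rw [hw s hs, smul_zero]

theorem laurentAct_of_expand_single {u : Omega0 z} {d : ℤ}
    (hu : expand z j u.1 = HahnSeries.single d 1) (x : Sl2) (w : W) :
    laurentAct A hA z j (u ⊗ₜ x) w = A (mode d x) w := by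
  rw [laurentAct_apply, finsum_eq_single _ d, laurentCoeff_of_expand_single hu, if_pos rfl,
    one_smul]
  intro s hs
  rw [laurentCoeff_of_expand_single hu, if_neg hs, zero_smul]

end LaurentActions

section LocalActions

variable {n : ℕ} {z : Fin n → ℂ} (m : Fin n → ℂ) (k : ℂ)

/-- The action of `𝔰𝔩₂(U)` on the tensor factor at the point labelled by `j`. -/
abbrev localAct (z m : Fin n → ℂ) (k : ℂ) (j : Option (Fin n)) :
    Sl2U z →ₗ[ℂ] Module.End ℂ (Contra (weight m j) k) :=
  laurentAct (pointAct m k j) (pointAct_finiteness m k j) z j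

theorem pointAct_none_e (s : ℤ) :
    pointAct m k none (mode s e) = contraAct (weight m none) k (mode s f) := by
  rw [pointAct, LinearMap.comp_apply, piAut_mode, sl2Swap_e]

theorem pointAct_none_f (s : ℤ) :
    pointAct m k none (mode s f) = contraAct (weight m none) k (mode s e) := by
  rw [pointAct, LinearMap.comp_apply, piAut_mode, sl2Swap_f]

theorem pointAct_none_h (s : ℤ) :
    pointAct m k none (mode s h) = -contraAct (weight m none) k (mode s h) := by
  rw [pointAct, LinearMap.comp_apply, piAut_mode, sl2Swap_h, map_neg, map_neg]

variable {u : Omega0 z} {r : ℂ}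

theorem localAct_some_e {q : Fin n} (hu : RegularAt z (some q) u.1 r) :
    localAct z m k (some q) (u ⊗ₜ e) (vacDual (weight m (some q)) k) = 0 := by
  refine (laurentAct_of_regularAt (A := contraAct (weight m (some q)) k) _ hu
    fun s hs => mode_e_vacDual (by lia)).trans ?_
  rw [mode_e_vacDual le_rfl, smul_zero]

theorem localAct_some_h {q : Fin n} (hu : RegularAt z (some q) u.1 r) :
    localAct z m k (some q) (u ⊗ₜ h) (vacDual (weight m (some q)) k) =
      (r * m q) • vacDual (weight m (some q)) k := by
  refine (laurentAct_of_regularAt (A := contraAct (weight m (some q)) k) _ hu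
    fun s hs => mode_h_vacDual hs).trans ?_
  rw [mode_h_zero_vacDual, smul_smul]
  rfl

theorem localAct_some_f {q : Fin n} (hu : RegularAt z (some q) u.1 r) :
    localAct z m k (some q) (u ⊗ₜ f) (vacDual (weight m (some q)) k) =
      (r * m q) • poleDual (weight m (some q)) k 0 := by
  refine (laurentAct_of_regularAt (A := contraAct (weight m (some q)) k) _ hu
    fun s hs => mode_f_vacDual hs).trans ?_
  rw [mode_f_zero_vacDual, smul_smul]
  rfl

/-- A function that vanishes at `∞` acts by zero on the vector `v^*` there. -/
theorem localAct_none_eq_zero (hu : RegularAt z none u.1 0) (x : Sl2)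
    (hx : x = e ∨ x = h ∨ x = f) :
    localAct z m k none (u ⊗ₜ x) (vacDual (weight m none) k) = 0 := by
  rw [localAct, laurentAct_of_regularAt _ hu, zero_smul]
  intro s hs
  rcases hx with rfl | rfl | rfl
  · rw [pointAct_none_e, mode_f_vacDual hs]
  · rw [pointAct_none_h, LinearMap.neg_apply, mode_h_vacDual hs, neg_zero]
  · rw [pointAct_none_f, mode_e_vacDual (by lia)]

end LocalActions

section Tensors

variable {n : ℕ} {z : Fin n → ℂ} (m : Fin n → ℂ) (k : ℂ)

/-- The linear map `w ↦ v^* ⊗ ⋯ ⊗ w ⊗ ⋯ ⊗ v^*` with `w` at the place `j`. -/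
def insertLin (j : Option (Fin n)) : Contra (weight m j) k →ₗ[ℂ] TensorV m k :=
  (PiTensorProduct.tprod ℂ).toLinearMap (fun i => vacDual (weight m i) k) j

theorem tensorAct_vacTensor (g : Sl2U z) :
    tensorAct z m k g (vacTensor m k) =
      ∑ j, insertLin m k j (localAct z m k j g (vacDual (weight m j) k)) :=
  tensorAct_tprod z m k g _

/-- The action on a tensor with one entry different from `v^*`, if the vectors `v^*` at the
other places are eigenvectors. -/
theorem tensorAct_insertLin (g : Sl2U z) (j : Option (Fin n)) (w : Contra (weight m j) k)
    (c : Option (Fin n) → ℂ) (hc : ∀ i ≠ j, localAct z m k i g (vacDual (weight m i) k) =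
      c i • vacDual (weight m i) k) :
    tensorAct z m k g (insertLin m k j w) =
      insertLin m k j (localAct z m k j g w + (∑ i ∈ Finset.univ.erase j, c i) • w) := by
  change tensorAct z m k g (PiTensorProduct.tprod ℂ (Function.update _ j w)) = _
  rw [tensorAct_tprod, ← Finset.add_sum_erase _ _ (Finset.mem_univ j), map_add, map_smul,
    Finset.sum_smul]
  congr 1
  · rw [Function.update_self, Function.update_idem]
    rfl
  · refine Finset.sum_congr rfl fun i hi => ?_
    have hij := Finset.ne_of_mem_erase hi
    rw [Function.update_of_ne hij, hc i hij, MultilinearMap.map_update_smul]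
    have h1 : Function.update (Function.update (fun i => vacDual (weight m i) k) j w) i
        (vacDual (weight m i) k) = Function.update (fun i => vacDual (weight m i) k) j w :=
      by rw [Function.update_eq_self_iff, Function.update_of_ne hij]
    exact congrArg (fun v => c i • PiTensorProduct.tprod ℂ v) h1

end Tensors

/-! ### The chain map property -/

section Actions

variable {n : ℕ} {z : Fin n → ℂ} (m : Fin n → ℂ) (k : ℂ)

/-- The tensor with `(f/Tᵃ v_p)^*` at the place `p` and `v^*` at the others. -/
def poleVec (p : Fin n) (a : ℕ) : TensorV m k :=
  insertLin m k (some p) (poleDual (weight m (some p)) k a)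

/-- The tensor with `(e/T^(a+1) v_{n+1})^*` at the place `∞` and `v^*` at the others. -/
def inftyVec (a : ℕ) : TensorV m k :=
  insertLin m k none (inftyDual (weight m none) k a)

theorem localAct_none_invT_pow (p : Fin n) {a : ℕ} (ha : a ≠ 0) (x : Sl2)
    (hx : x = e ∨ x = h ∨ x = f) :
    localAct z m k none ((invT z p ^ a) ⊗ₜ x) (vacDual (weight m none) k) = 0 := by
  refine localAct_none_eq_zero m k ?_ x hx
  have h1 := (regularAt_none_invT (z := z) p).pow a
  rwa [zero_pow ha] at h1

theorem regularAt_invT_pow (hz : Function.Injective z) {p q : Fin n} (hq : q ≠ p) (a : ℕ) :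
    RegularAt z (some q) (invT z p ^ a).1 ((z q - z p)⁻¹ ^ a) :=
  (regularAt_invT (hz.ne hq)).pow a

theorem localAct_invT_pow_self (p : Fin n) (a : ℕ) (x : Sl2)
    (w : Contra (weight m (some p)) k) :
    localAct z m k (some p) ((invT z p ^ a) ⊗ₜ x) w =
      contraAct (weight m (some p)) k (mode (-(a : ℤ)) x) w :=
  laurentAct_of_expand_single (A := contraAct (weight m (some p)) k) _
    (expand_invT_pow_self p a) x w

theorem sum_erase_some (p : Fin n) (c : Option (Fin n) → ℂ) (hc : c none = 0) :
    ∑ j ∈ Finset.univ.erase (some p), c j = ∑ q ∈ Finset.univ.erase p, c (some q) := by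
  rw [Finset.sum_erase_eq_sub (Finset.mem_univ _), Finset.sum_erase_eq_sub (Finset.mem_univ _),
    Fintype.sum_option, hc, zero_add]

theorem sum_erase_none (c : Option (Fin n) → ℂ) :
    ∑ j ∈ Finset.univ.erase none, c j = ∑ q, c (some q) := by
  rw [Finset.sum_erase_eq_sub (Finset.mem_univ _), Fintype.sum_option, add_sub_cancel_left]

/-- The function `1/(t - z_p)ᵃ` vanishes at `∞`, which therefore does not contribute. -/
theorem tensorAct_invT_pow_f (hz : Function.Injective z) (p : Fin n) {a : ℕ} (ha : a ≠ 0) :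
    tensorAct z m k ((invT z p ^ a) ⊗ₜ f) (vacTensor m k) =
      insertLin m k (some p) (contraAct (weight m (some p)) k (mode (-(a : ℤ)) f) (vacDual (weight m (some p)) k)) +
        ∑ q ∈ Finset.univ.erase p, ((z q - z p)⁻¹ ^ a * m q) •
          poleVec m k q 0 := by
  rw [tensorAct_vacTensor, Fintype.sum_option, localAct_none_invT_pow m k p ha f (by simp),
    map_zero, zero_add, ← Finset.add_sum_erase _ _ (Finset.mem_univ p), localAct_invT_pow_self]
  refine congrArg₂ _ rfl (Finset.sum_congr rfl fun q hq => ?_)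
  rw [localAct_some_f m k (regularAt_invT_pow hz (Finset.ne_of_mem_erase hq) a), map_smul]
  rfl

theorem tensorAct_invT_pow_e (hz : Function.Injective z) (p : Fin n) {a : ℕ} (ha : a ≠ 0)
    (w : Contra (weight m (some p)) k) :
    tensorAct z m k ((invT z p ^ a) ⊗ₜ e) (insertLin m k (some p) w) =
      insertLin m k (some p) (contraAct (weight m (some p)) k (mode (-(a : ℤ)) e) w) := by
  rw [tensorAct_insertLin m k _ _ _ (fun _ => 0), localAct_invT_pow_self, Finset.sum_const_zero,
    zero_smul, add_zero]
  rintro (_ | q) hq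
  · rw [localAct_none_invT_pow m k p ha e (by simp), zero_smul]
  · rw [localAct_some_e m k (regularAt_invT_pow hz (fun h1 => hq (by rw [h1])) a), zero_smul]

theorem tensorAct_invT_pow_h (hz : Function.Injective z) (p : Fin n) {a : ℕ} (ha : a ≠ 0)
    (w : Contra (weight m (some p)) k) :
    tensorAct z m k ((invT z p ^ a) ⊗ₜ h) (insertLin m k (some p) w) =
      insertLin m k (some p) (contraAct (weight m (some p)) k (mode (-(a : ℤ)) h) w +
        (∑ q ∈ Finset.univ.erase p, (z q - z p)⁻¹ ^ a * m q) • w) := by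
  rw [tensorAct_insertLin m k _ _ _ (fun j => j.elim 0 fun q => (z q - z p)⁻¹ ^ a * m q),
    localAct_invT_pow_self, sum_erase_some _ _ rfl]
  · rfl
  · rintro (_ | q) hq
    · rw [localAct_none_invT_pow m k p ha h (by simp)]
      exact (zero_smul _ _).symm
    · rw [localAct_some_h m k (regularAt_invT_pow hz (fun h1 => hq (by rw [h1])) a)]
      rfl

theorem localAct_none_coordT_pow (a : ℕ) (x : Sl2) (w : Contra (weight m none) k) :
    localAct z m k none ((coordT z ^ a) ⊗ₜ x) w = pointAct m k none (mode (-(a : ℤ)) x) w :=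
  laurentAct_of_expand_single _ (expand_coordT_pow a) x w

theorem regularAt_coordT_pow (q : Fin n) (a : ℕ) :
    RegularAt z (some q) (coordT z ^ a).1 (z q ^ a) :=
  (regularAt_coordT q).pow a

theorem tensorAct_coordT_pow_f (a : ℕ) :
    tensorAct z m k ((coordT z ^ a) ⊗ₜ f) (vacTensor m k) =
      insertLin m k none (contraAct (weight m none) k (mode (-(a : ℤ)) e)
        (vacDual (weight m none) k)) +
        ∑ q, (z q ^ a * m q) • poleVec m k q 0 := by
  rw [tensorAct_vacTensor, Fintype.sum_option, localAct_none_coordT_pow, pointAct_none_f]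
  refine congrArg₂ _ rfl (Finset.sum_congr rfl fun q hq => ?_)
  rw [localAct_some_f m k (regularAt_coordT_pow q a), map_smul]
  rfl

theorem tensorAct_coordT_pow_e (a : ℕ) (w : Contra (weight m none) k) :
    tensorAct z m k ((coordT z ^ a) ⊗ₜ e) (insertLin m k none w) =
      insertLin m k none (contraAct (weight m none) k (mode (-(a : ℤ)) f) w) := by
  rw [tensorAct_insertLin m k _ _ _ (fun _ => 0), localAct_none_coordT_pow, pointAct_none_e,
    Finset.sum_const_zero, zero_smul, add_zero]
  rintro (_ | q) hq
  · exact absurd rfl hq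
  · rw [localAct_some_e m k (regularAt_coordT_pow q a), zero_smul]

theorem tensorAct_coordT_pow_h (a : ℕ) (w : Contra (weight m none) k) :
    tensorAct z m k ((coordT z ^ a) ⊗ₜ h) (insertLin m k none w) =
      insertLin m k none (-contraAct (weight m none) k (mode (-(a : ℤ)) h) w +
        (∑ q, z q ^ a * m q) • w) := by
  rw [tensorAct_insertLin m k _ _ _ (fun j => j.elim 0 fun q => z q ^ a * m q),
    localAct_none_coordT_pow, pointAct_none_h, sum_erase_none]
  · rfl
  · rintro (_ | q) hq
    · exact absurd rfl hq
    · rw [localAct_some_h m k (regularAt_coordT_pow q a)]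
      rfl

end Actions

section ChainMap

variable {n : ℕ} (z m : Fin n → ℂ) (k : ℂ)

/-- The value prescribed for `η⁰` on `1/(t - z_p)ᵃ`. -/
def etaZeroPole (p : Fin n) (a : ℕ) : Sl2U z ⊗[ℂ] TensorV m k :=
  ((invT z p ^ a) ⊗ₜ[ℂ] f) ⊗ₜ[ℂ] vacTensor m k - ∑ i ∈ Finset.range a,
    (((invT z p ^ (i + 1)) ⊗ₜ[ℂ] e) ⊗ₜ[ℂ]
        insertLin m k (some p) ((2 : ℂ) • polePairDual (weight m (some p)) k (a - (i + 1))) +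
      ((invT z p ^ (i + 1)) ⊗ₜ[ℂ] h) ⊗ₜ[ℂ]
        poleVec m k p (a - (i + 1)))

/-- The value prescribed for `η⁰` on `tᵃ`. -/
def etaZeroInfty (a : ℕ) : Sl2U z ⊗[ℂ] TensorV m k :=
  ((coordT z ^ a) ⊗ₜ[ℂ] f) ⊗ₜ[ℂ] vacTensor m k - ∑ i ∈ Finset.range (a - 1),
    (((coordT z ^ i) ⊗ₜ[ℂ] e) ⊗ₜ[ℂ]
        insertLin m k none ((2 : ℂ) • inftyPairDual (weight m none) k (a - 1 - (i + 1))) +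
      ((coordT z ^ (i + 1)) ⊗ₜ[ℂ] h) ⊗ₜ[ℂ]
        inftyVec m k (a - 1 - (i + 1)))

variable {z}

/-- The left-hand side of the chain map property on `1/(t - z_p)ᵃ`: the local contribution of the
point `z_p` is evaluated by `contraAct_pole`, the other points contribute through values of
functions. -/
theorem chainD_etaZeroPole (hz : Function.Injective z) (p : Fin n) {a : ℕ} (ha : a ≠ 0) :
    chainD z m k (etaZeroPole z m k p a) =
      (m p + a * (k + 2)) • poleVec m k p a -
        ∑ i ∈ Finset.range a, (∑ q ∈ Finset.univ.erase p, (z q - z p)⁻¹ ^ (i + 1) * m q) •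
          poleVec m k p (a - (i + 1)) +
        ∑ q ∈ Finset.univ.erase p, ((z q - z p)⁻¹ ^ a * m q) •
          poleVec m k q 0 := by
  rw [poleVec, ← map_smul (insertLin m k (some p)),
    show m p = weight m (some p) from rfl, ← contraAct_pole]
  have h1 : ∀ i : ℕ, i + 1 ≠ 0 := Nat.succ_ne_zero
  simp only [etaZeroPole, poleVec, chainD, map_sub, map_sum, map_add, TensorProduct.lift.tmul, map_smul,
    tensorAct_invT_pow_f m k hz p ha, tensorAct_invT_pow_e m k hz p (h1 _),
    tensorAct_invT_pow_h m k hz p (h1 _), Finset.sum_add_distrib]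
  abel

theorem chainD_etaZeroInfty_zero :
    chainD z m k (etaZeroInfty z m k 0) = ∑ q, m q • poleVec m k q 0 := by
  have h0 := tensorAct_coordT_pow_f (z := z) m k 0
  rw [mode_e_vacDual (by simp), map_zero, zero_add] at h0
  simp only [pow_zero, one_mul] at h0
  simp only [etaZeroInfty, Nat.zero_sub, Finset.sum_range_zero, chainD, map_sub, map_zero,
    TensorProduct.lift.tmul, pow_zero, h0]
  abel

/-- The left-hand side of the chain map property on `t^(b+1)`; the local contribution of `∞` is
evaluated by `contraAct_infty`. -/
theorem chainD_etaZeroInfty_succ (b : ℕ) :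
    chainD z m k (etaZeroInfty z m k (b + 1)) =
      (k - weight m none + b * (k + 2)) • inftyVec m k b -
        ∑ i ∈ Finset.range b, (∑ q, z q ^ (i + 1) * m q) •
          inftyVec m k (b - (i + 1)) +
        ∑ q, (z q ^ (b + 1) * m q) • poleVec m k q 0 := by
  rw [inftyVec, ← map_smul (insertLin m k none), ← contraAct_infty]
  simp only [etaZeroInfty, inftyVec, chainD, map_sub, map_sum, map_add, TensorProduct.lift.tmul, map_smul,
    map_neg, tensorAct_coordT_pow_f m k, tensorAct_coordT_pow_e m k, tensorAct_coordT_pow_h m k,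
    Finset.sum_add_distrib, Finset.sum_sub_distrib, Finset.sum_neg_distrib, Nat.add_sub_cancel]
  abel

theorem twistedD_apply (κ : ℂ) (u : Omega0 z) :
    twistedD z m κ u = deRham z u - κ⁻¹ • ∑ q, m q • (invT z q * u) := by
  rw [twistedD, LinearMap.add_apply, LinearMap.mulLeft_apply, alphaForm, smul_mul_assoc,
    Finset.sum_mul, one_div, neg_smul, sub_eq_add_neg]
  simp only [smul_mul_assoc]

end ChainMap

section TwistedDifferential

variable {n : ℕ} {z m : Fin n → ℂ} {M : Type*} [AddCommGroup M] [Module ℂ M]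
  {η : Omega1 z →ₗ[ℂ] M} {κ : ℂ} {P : Fin n → ℕ → M} {E : ℕ → M}

/-- The value at `∂ (1/(t - z_p)ᵃ)` of a linear map given on partial fractions. -/
theorem map_twistedD_invT_pow (hz : Function.Injective z) (hκ : κ ≠ 0)
    (hη : ∀ p a, η (invT z p ^ (a + 1)) = -(κ • P p a)) (p : Fin n) (a : ℕ) :
    η (twistedD z m κ (invT z p ^ a)) =
      (m p + a * κ) • P p a -
        ∑ i ∈ Finset.range a, (∑ q ∈ Finset.univ.erase p, (z q - z p)⁻¹ ^ (i + 1) * m q) •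
          P p (a - (i + 1)) +
        ∑ q ∈ Finset.univ.erase p, ((z q - z p)⁻¹ ^ a * m q) • P q 0 := by
  have h1 : ∀ q ∈ Finset.univ.erase p, m q • η (invT z q * invT z p ^ a) =
      -κ • (((z q - z p)⁻¹ ^ a * m q) • P q 0 -
        ∑ i ∈ Finset.range a, ((z q - z p)⁻¹ ^ (i + 1) * m q) • P p (a - (i + 1))) := by
    intro q hq
    rw [invT_mul_invT_pow (hz.ne (Finset.ne_of_mem_erase hq)), map_sub, map_sum, map_smul,
      ← pow_one (invT z q), ← zero_add 1, hη]
    have h2 : ∀ i ∈ Finset.range a, η ((z q - z p)⁻¹ ^ (i + 1) • invT z p ^ (a - i)) =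
        -κ • (z q - z p)⁻¹ ^ (i + 1) • P p (a - (i + 1)) := fun i hi => by
      rw [Finset.mem_range] at hi
      rw [map_smul, show a - i = a - (i + 1) + 1 by lia, hη]
      module
    rw [Finset.sum_congr rfl h2, ← Finset.smul_sum]
    simp only [mul_comm _ (m q), mul_smul, ← Finset.smul_sum]
    module
  rw [twistedD_apply, deRham_invT_pow, map_sub, map_neg, map_smul, hη, map_smul, map_sum]
  simp only [map_smul]
  rw [← Finset.add_sum_erase _ _ (Finset.mem_univ p), ← pow_succ', hη, Finset.sum_congr rfl h1,
    ← Finset.smul_sum, Finset.sum_sub_distrib, Finset.sum_comm]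
  simp only [Finset.sum_smul]
  match_scalars <;> field_simp
  ring

/-- The value at `∂ tᵃ` of a linear map given on partial fractions. -/
theorem map_twistedD_coordT_pow (hκ : κ ≠ 0)
    (hη : ∀ p a, η (invT z p ^ (a + 1)) = -(κ • P p a))
    (hη' : ∀ a, η (coordT z ^ a) = κ • E a) (a : ℕ) :
    η (twistedD z m κ (coordT z ^ a)) =
      (a * κ) • E (a - 1) -
        ∑ i ∈ Finset.range a, (∑ q, z q ^ i * m q) • E (a - 1 - i) +
        ∑ q, (z q ^ a * m q) • P q 0 := by
  have h1 : ∀ q, m q • η (invT z q * coordT z ^ a) =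
      -κ • ((z q ^ a * m q) • P q 0 -
        ∑ i ∈ Finset.range a, (z q ^ i * m q) • E (a - 1 - i)) := by
    intro q
    rw [mul_comm (invT z q), coordT_pow_mul_invT, map_add, map_sum, map_smul,
      ← pow_one (invT z q), ← zero_add 1, hη]
    have h2 : ∀ i, η (z q ^ i • coordT z ^ (a - 1 - i)) = κ • z q ^ i • E (a - 1 - i) :=
      fun i => by
        rw [map_smul, hη', smul_comm]
    simp only [h2, ← Finset.smul_sum, mul_comm _ (m q), mul_smul]
    module
  rw [twistedD_apply, deRham_coordT_pow, map_sub, map_smul, hη', map_smul, map_sum]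
  simp only [map_smul, h1]
  rw [← Finset.smul_sum, Finset.sum_sub_distrib, Finset.sum_comm]
  simp only [Finset.sum_smul]
  match_scalars <;> field_simp

end TwistedDifferential

/-! ### The maps and their injectivity -/

section Formulas

variable {n : ℕ} {z m : Fin n → ℂ} {k : ℂ}

theorem sum_Icc_one {M : Type*} [AddCommMonoid M] (g : ℕ → M) (a : ℕ) :
    ∑ l ∈ Finset.Icc 1 a, g l = ∑ i ∈ Finset.range a, g (i + 1) := by
  induction a with
  | zero => rfl
  | succ a ih => rw [Finset.sum_Icc_succ_top (by lia), ih, Finset.sum_range_succ]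

/-- Exponents of `e` start at `1`; shifting them by one removes this constraint. -/
theorem sum_idxEE (m k : ℂ) (N : ℕ) :
    ∑ p ∈ (Finset.HasAntidiagonal.antidiagonal (N + 2)).filter (fun p => 1 ≤ p.2 ∧ p.2 ≤ p.1),
      dualVec m k (idxEE p.1 p.2) = inftyPairDual m k N := by
  refine Finset.sum_bij' (fun p _ => (p.1 - 1, p.2 - 1)) (fun p _ => (p.1 + 1, p.2 + 1))
    ?_ ?_ ?_ ?_ ?_
  · rintro ⟨i, j⟩ hp
    simp only [Finset.mem_filter, Finset.HasAntidiagonal.mem_antidiagonal] at hp ⊢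
    lia
  · rintro ⟨i, j⟩ hp
    simp only [Finset.mem_filter, Finset.HasAntidiagonal.mem_antidiagonal] at hp ⊢
    lia
  · rintro ⟨i, j⟩ hp
    simp only [Finset.mem_filter, Finset.HasAntidiagonal.mem_antidiagonal] at hp
    ext <;> simp <;> lia
  · rintro ⟨i, j⟩ -
    rfl
  · rintro ⟨i, j⟩ hp
    simp only [Finset.mem_filter, Finset.HasAntidiagonal.mem_antidiagonal] at hp
    rw [Nat.sub_add_cancel (by lia), Nat.sub_add_cancel (by lia)]

theorem etaZeroFormulas_iff {η : Omega0 z →ₗ[ℂ] Sl2U z ⊗[ℂ] TensorV m k} :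
    EtaZeroFormulas z m k η ↔ (∀ p a, η (invT z p ^ (a + 1)) = etaZeroPole z m k p (a + 1)) ∧
      ∀ a, η (coordT z ^ a) = etaZeroInfty z m k a := by
  refine and_congr ⟨fun H p a => (H p (a + 1) a.succ_pos).trans ?_, fun H p a ha => ?_⟩
    (forall_congr' fun a => ?_)
  · rw [sum_Icc_one]; rfl
  · obtain ⟨b, rfl⟩ := Nat.exists_eq_add_of_lt ha
    rw [zero_add, H, sum_Icc_one]; rfl
  · refine Eq.congr_right ?_
    rw [etaZeroInfty]
    refine congrArg _ (Finset.sum_congr rfl fun i hi => ?_)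
    rw [Finset.mem_range] at hi
    rw [show a - i = a - 1 - (i + 1) + 2 by lia, sum_idxEE]
    rfl

theorem etaOneFormulas_iff {η : Omega1 z →ₗ[ℂ] TensorV m k} :
    EtaOneFormulas z m k η ↔ (∀ p a, η (invT z p ^ (a + 1)) = -((k + 2) • poleVec m k p a)) ∧
      ∀ a, η (coordT z ^ a) = (k + 2) • inftyVec m k a := by
  refine and_congr ⟨fun H p a => H p (a + 1) a.succ_pos, fun H p a ha => ?_⟩
    ⟨fun H a => H (a + 1) a.succ_pos, fun H a ha => ?_⟩
  · obtain ⟨b, rfl⟩ := Nat.exists_eq_add_of_lt ha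
    rw [zero_add]
    exact H p b
  · obtain ⟨b, rfl⟩ := Nat.exists_eq_add_of_lt ha
    rw [zero_add]
    exact H b

theorem existsUnique_on_partialFractions (hz : Function.Injective z) {M : Type*}
    [AddCommMonoid M] [Module ℂ M] (P : Fin n → ℕ → M) (E : ℕ → M) :
    ∃! η : Omega0 z →ₗ[ℂ] M, (∀ p a, η (invT z p ^ (a + 1)) = P p a) ∧
      ∀ a, η (coordT z ^ a) = E a := by
  refine ⟨(partialFractionBasis hz).constr ℂ (Sum.elim (fun q => P q.1 q.2) E),
    ⟨fun p a => ?_, fun a => ?_⟩, fun η hη => (partialFractionBasis hz).ext ?_⟩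
  · rw [← partialFractionBasis_inl hz, Module.Basis.constr_basis]; rfl
  · rw [← partialFractionBasis_inr hz, Module.Basis.constr_basis]; rfl
  · rintro (⟨p, a⟩ | a)
    · rw [Module.Basis.constr_basis, partialFractionBasis_inl, hη.1]; rfl
    · rw [Module.Basis.constr_basis, partialFractionBasis_inr, hη.2]; rfl

/-- The chain map property.  At `∞` the coefficient `k - m_{n+1} + bκ` equals
`(b + 1)κ - ∑ m_i`, since `m_{n+1} = ∑ m_i - 2` and `κ = k + 2`. -/
theorem chainD_comp_etaZero (hz : Function.Injective z) (hk : k + 2 ≠ 0)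
    {η₀ : Omega0 z →ₗ[ℂ] Sl2U z ⊗[ℂ] TensorV m k} {η₁ : Omega1 z →ₗ[ℂ] TensorV m k}
    (h₀ : EtaZeroFormulas z m k η₀) (h₁ : EtaOneFormulas z m k η₁) :
    chainD z m k ∘ₗ η₀ = η₁ ∘ₗ twistedD z m (k + 2) := by
  rw [etaZeroFormulas_iff] at h₀
  rw [etaOneFormulas_iff] at h₁
  refine (partialFractionBasis hz).ext ?_
  rintro (⟨p, a⟩ | a)
  · rw [partialFractionBasis_inl, LinearMap.comp_apply, LinearMap.comp_apply, h₀.1,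
      chainD_etaZeroPole m k hz p a.succ_ne_zero]
    exact (map_twistedD_invT_pow (M := TensorV m k) (η := η₁) (P := poleVec m k) hz hk h₁.1 p (a + 1)).symm
  · rw [partialFractionBasis_inr, LinearMap.comp_apply, LinearMap.comp_apply, h₀.2]
    refine Eq.trans ?_ (map_twistedD_coordT_pow (M := TensorV m k) (η := η₁)
      (P := poleVec m k) (E := inftyVec m k) hk h₁.1 h₁.2 a).symm
    rcases a with _ | b
    · rw [chainD_etaZeroInfty_zero]
      simp
    · rw [chainD_etaZeroInfty_succ, Finset.sum_range_succ' _ b, weight]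
      simp only [pow_zero, one_mul, Nat.add_sub_cancel, Nat.sub_zero]
      push_cast
      module

end Formulas

section Injectivity

theorem vacDual_vac (m k : ℂ) : (vacDual m k).1 (vac m k) = 1 := by
  have h1 := isDualVec_f (m := m) (k := k) 0 ⟨0, 0, 0⟩ (by simp [PBWIndex.Valid])
  rw [if_pos rfl] at h1
  simpa [pbwVec, lowering_zero, vacDual, idxV] using h1

theorem vacDual_f (m k : ℂ) (a : ℕ) :
    (vacDual m k).1 (vermaAct m k (mode (-(a : ℤ)) f) (vac m k)) = 0 := by
  rw [vacDual_apply, fDual_f, if_neg (by simp)]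

theorem vacDual_e (m k : ℂ) (a : ℕ) :
    (vacDual m k).1 (vermaAct m k (mode (-(a : ℤ) - 1) e) (vac m k)) = 0 := by
  rw [vacDual_apply, ← eDual_zero, eDual_e, if_neg (by simp)]

theorem poleDual_f (m k : ℂ) (a b : ℕ) :
    (poleDual m k a).1 (vermaAct m k (mode (-(b : ℤ)) f) (vac m k)) = if b = a then 1 else 0 := by
  rw [poleDual_apply, fDual_f]
  by_cases hb : b = a
  · subst hb
    rw [if_pos (by simp), if_pos rfl, ← vacDual_vac m k, vacDual_apply]
    simp
  · rw [if_neg (by simpa using hb), if_neg hb]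

theorem inftyDual_e (m k : ℂ) (a b : ℕ) :
    (inftyDual m k a).1 (vermaAct m k (mode (-(b : ℤ) - 1) e) (vac m k)) =
      if b = a then 1 else 0 := by
  rw [inftyDual_apply, eDual_e]
  by_cases hb : b = a
  · subst hb
    rw [if_pos (by simp), if_pos rfl, ← vacDual_vac m k, vacDual_apply, ← eDual_zero]
    simp
  · rw [if_neg (by simpa using hb), if_neg hb]

variable {n : ℕ} {z : Fin n → ℂ} (m : Fin n → ℂ) (k : ℂ)

/-- The functional `w₁ ⊗ ⋯ ⊗ w_{n+1} ↦ ∏ⱼ ⟨wⱼ, xⱼ⟩` defined by vectors `xⱼ` of the Verma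
modules. -/
def evalTensor (x : (j : Option (Fin n)) → Verma (weight m j) k) : TensorV m k →ₗ[ℂ] ℂ :=
  PiTensorProduct.lift ((MultilinearMap.mkPiAlgebra ℂ (Option (Fin n)) ℂ).compLinearMap
    fun j => LinearMap.applyₗ (x j) ∘ₗ (Contra (weight m j) k).subtype)

theorem evalTensor_tprod (x : (j : Option (Fin n)) → Verma (weight m j) k)
    (w : (j : Option (Fin n)) → Contra (weight m j) k) :
    evalTensor m k x (PiTensorProduct.tprod ℂ w) = ∏ j, (w j).1 (x j) := by
  rw [evalTensor, PiTensorProduct.lift.tprod]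
  rfl

theorem evalTensor_vacTensor :
    evalTensor m k (fun j => vac (weight m j) k) (vacTensor m k) = 1 := by
  rw [vacTensor, evalTensor_tprod]
  exact Finset.prod_eq_one fun j _ => vacDual_vac _ _

theorem evalTensor_insertLin_self (j : Option (Fin n)) (x : Verma (weight m j) k)
    (w : Contra (weight m j) k) :
    evalTensor m k (Function.update (fun j => vac (weight m j) k) j x) (insertLin m k j w) =
      w.1 x := by
  change evalTensor m k _ (PiTensorProduct.tprod ℂ (Function.update _ j w)) = _
  rw [evalTensor_tprod, Finset.prod_eq_single j]
  · simp
  · intro i _ hi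
    rw [Function.update_of_ne hi, Function.update_of_ne hi, vacDual_vac]
  · exact fun h1 => absurd (Finset.mem_univ j) h1

theorem evalTensor_insertLin_of_ne {i j : Option (Fin n)} (hij : j ≠ i)
    {x : Verma (weight m j) k} (hx : (vacDual (weight m j) k).1 x = 0)
    (w : Contra (weight m i) k) :
    evalTensor m k (Function.update (fun j => vac (weight m j) k) j x) (insertLin m k i w) = 0 := by
  change evalTensor m k _ (PiTensorProduct.tprod ℂ (Function.update _ i w)) = _
  rw [evalTensor_tprod]
  refine Finset.prod_eq_zero (Finset.mem_univ j) ?_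
  rw [Function.update_self, Function.update_of_ne hij, hx]

variable {m k}

/-- Pairing with `f/Tᵃ v_p` at one place, or `e/T^(a+1) v_{n+1}` at infinity, and with `v_j` at the
others recovers the coefficients of a form up to the factors `∓κ`. -/
theorem injective_etaOne (hz : Function.Injective z) (hk : k + 2 ≠ 0)
    {η : Omega1 z →ₗ[ℂ] TensorV m k} (hη : EtaOneFormulas z m k η) : Function.Injective η := by
  rw [etaOneFormulas_iff] at hη
  set b := partialFractionBasis hz
  have hf : ∀ p (a : ℕ), evalTensor m k (Function.update (fun j => vac (weight m j) k) (some p)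
      (vermaAct _ k (mode (-(a : ℤ)) f) (vac _ k))) ∘ₗ η = -(k + 2) • b.coord (Sum.inl (p, a)) := by
    refine fun p a => b.ext ?_
    rintro (⟨q, c⟩ | c)
    · rw [LinearMap.comp_apply, partialFractionBasis_inl, hη.1, map_neg, map_smul, ← neg_smul, poleVec,
        LinearMap.smul_apply, ← partialFractionBasis_inl hz, Module.Basis.coord_apply,
        Module.Basis.repr_self]
      congr 1
      by_cases hq : p = q
      · subst hq
        rw [evalTensor_insertLin_self, poleDual_f, Finsupp.single_apply]
        simp [eq_comm]
      · rw [evalTensor_insertLin_of_ne m k (by simpa using hq) (vacDual_f _ _ _),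
          Finsupp.single_eq_of_ne (by simp [hq])]
    · rw [LinearMap.comp_apply, partialFractionBasis_inr, hη.2, map_smul, inftyVec,
        evalTensor_insertLin_of_ne m k (by simp) (vacDual_f _ _ _), LinearMap.smul_apply,
        ← partialFractionBasis_inr hz, Module.Basis.coord_apply, Module.Basis.repr_self,
        Finsupp.single_eq_of_ne (by simp), smul_zero, smul_zero]
  have he : ∀ a : ℕ, evalTensor m k (Function.update (fun j => vac (weight m j) k) none
      (vermaAct _ k (mode (-(a : ℤ) - 1) e) (vac _ k))) ∘ₗ η = (k + 2) • b.coord (Sum.inr a) := by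
    refine fun a => b.ext ?_
    rintro (⟨q, c⟩ | c)
    · rw [LinearMap.comp_apply, partialFractionBasis_inl, hη.1, map_neg, map_smul, ← neg_smul, poleVec,
        evalTensor_insertLin_of_ne m k (by simp) (vacDual_e _ _ _), LinearMap.smul_apply,
        ← partialFractionBasis_inl hz, Module.Basis.coord_apply, Module.Basis.repr_self,
        Finsupp.single_eq_of_ne (by simp), smul_zero, smul_zero]
    · rw [LinearMap.comp_apply, partialFractionBasis_inr, hη.2, map_smul, inftyVec,
        evalTensor_insertLin_self, inftyDual_e, LinearMap.smul_apply,
        ← partialFractionBasis_inr hz, Module.Basis.coord_apply, Module.Basis.repr_self,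
        Finsupp.single_apply]
      simp [eq_comm]
  refine (injective_iff_map_eq_zero η).2 fun u hu => b.forall_coord_eq_zero_iff.1 ?_
  rintro (⟨p, a⟩ | a)
  · have h1 := LinearMap.congr_fun (hf p a) u
    rw [LinearMap.comp_apply, hu, map_zero, LinearMap.smul_apply] at h1
    exact (smul_eq_zero.1 h1.symm).resolve_left (neg_ne_zero.2 hk)
  · have h1 := LinearMap.congr_fun (he a) u
    rw [LinearMap.comp_apply, hu, map_zero, LinearMap.smul_apply] at h1
    exact (smul_eq_zero.1 h1.symm).resolve_left hk

/-- The coefficient of `f` in a traceless matrix. -/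
def coeffF : Sl2 →ₗ[ℂ] ℂ where
  toFun x := x.1 1 0
  map_add' _ _ := rfl
  map_smul' _ _ := rfl

variable (z m k) in
/-- The map `(u ⊗ x) ⊗ w ↦ ⟨w, v₁ ⊗ ⋯ ⊗ v_{n+1}⟩ x_f u`, where `x_f` is the coefficient of `f`. -/
def etaZeroRetraction : Sl2U z ⊗[ℂ] TensorV m k →ₗ[ℂ] Omega0 z :=
  (TensorProduct.rid ℂ (Omega0 z)).toLinearMap ∘ₗ TensorProduct.map
    ((TensorProduct.rid ℂ (Omega0 z)).toLinearMap ∘ₗ LinearMap.lTensor (Omega0 z) coeffF)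
    (evalTensor m k fun j => vac (weight m j) k)

theorem etaZeroRetraction_tmul (u : Omega0 z) (x : Sl2) (w : TensorV m k) :
    etaZeroRetraction z m k ((u ⊗ₜ x) ⊗ₜ w) =
      evalTensor m k (fun j => vac (weight m j) k) w • coeffF x • u := rfl

theorem coeffF_e : coeffF e = 0 := rfl
theorem coeffF_h : coeffF h = 0 := rfl
theorem coeffF_f : coeffF f = 1 := rfl

/-- The coefficient of `f ⊗ v^* ⊗ ⋯ ⊗ v^*` in `η⁰ u` is `u`. -/
theorem injective_etaZero (hz : Function.Injective z)
    {η : Omega0 z →ₗ[ℂ] Sl2U z ⊗[ℂ] TensorV m k} (hη : EtaZeroFormulas z m k η) :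
    Function.Injective η := by
  rw [etaZeroFormulas_iff] at hη
  have h1 : etaZeroRetraction z m k ∘ₗ η = LinearMap.id := by
    refine (partialFractionBasis hz).ext ?_
    rintro (⟨p, a⟩ | a)
    · rw [LinearMap.comp_apply, partialFractionBasis_inl, hη.1]
      simp only [etaZeroPole, map_sub, map_sum, map_add, etaZeroRetraction_tmul, coeffF_e, coeffF_h,
        coeffF_f, zero_smul, smul_zero, add_zero, Finset.sum_const_zero, sub_zero, one_smul,
        evalTensor_vacTensor, LinearMap.id_apply]
    · rw [LinearMap.comp_apply, partialFractionBasis_inr, hη.2]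
      simp only [etaZeroInfty, map_sub, map_sum, map_add, etaZeroRetraction_tmul, coeffF_e,
        coeffF_h, coeffF_f, zero_smul, smul_zero, add_zero, Finset.sum_const_zero, sub_zero,
        one_smul, evalTensor_vacTensor, LinearMap.id_apply]
  exact Function.LeftInverse.injective (g := etaZeroRetraction z m k) (LinearMap.congr_fun h1)

end Injectivity

end SlDeRham

end

theorem theorem4p1 (n : ℕ) (z m : Fin n → ℂ) (hz : Function.Injective z) (k : ℂ)
    (hk : k + 2 ≠ 0) :
    (∃! η₁ : SlDeRham.Omega1 z →ₗ[ℂ] SlDeRham.TensorV m k, SlDeRham.EtaOneFormulas z m k η₁) ∧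
    (∃! η₀ : SlDeRham.Omega0 z →ₗ[ℂ] SlDeRham.Sl2U z ⊗[ℂ] SlDeRham.TensorV m k,
      SlDeRham.EtaZeroFormulas z m k η₀) ∧
    ∀ (η₀ : SlDeRham.Omega0 z →ₗ[ℂ] SlDeRham.Sl2U z ⊗[ℂ] SlDeRham.TensorV m k)
      (η₁ : SlDeRham.Omega1 z →ₗ[ℂ] SlDeRham.TensorV m k),
      SlDeRham.EtaZeroFormulas z m k η₀ → SlDeRham.EtaOneFormulas z m k η₁ →
        SlDeRham.chainD z m k ∘ₗ η₀ = η₁ ∘ₗ SlDeRham.twistedD z m (k + 2) ∧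
        Function.Injective η₀ ∧ Function.Injective η₁ := by
  refine ⟨?_, ?_, fun η₀ η₁ h₀ h₁ => ⟨SlDeRham.chainD_comp_etaZero hz hk h₀ h₁,
    SlDeRham.injective_etaZero hz h₀, SlDeRham.injective_etaOne hz hk h₁⟩⟩
  · simp only [SlDeRham.etaOneFormulas_iff]
    exact SlDeRham.existsUnique_on_partialFractions hz _ _
  · simp only [SlDeRham.etaZeroFormulas_iff]
    exact SlDeRham.existsUnique_on_partialFractions hz _ _
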